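/- For $n\ge 2$ let $v_n>0$ and $\hat V(x)=v_nx^{2n}$. At temperature $T=1/\beta>0$ consider the large-$N$ saddle point equations of the spherically constrained $N\times N$ matrix integral $\int dM\,\delta(\mathrm{tr}\,MM^T-N^2)\,e^{-\beta N^{1-n}v_n\,\mathrm{tr}(MM^T)^n}$ for the symmetrized density $\rho$ of singular values of $M/\sqrt N$: $\rho$ is even, Hölder continuous and compactly supported, and for some $\hat\mu\in\mathbb R$ $$\int\rho\,dx=1,\qquad \int\rho\, x^2dx=1,\qquad \hat\mu x+\tfrac{\beta}{2}\hat V'(x)=\mathrm{P}\!\!\int\frac{\rho(y)}{x-y}\,dy\quad\text{in the interior of }\operatorname{supp}\rho .$$ Put $$T_c=\frac{v_n}{2\sqrt\pi}\Big[\frac43\Big(1+\frac1n\Big)\Big]^n\frac{\Gamma(n-\frac12)}{\Gamma(n-1)} .$$ 1. For every $T>0$ there is exactly one (possibly signed) single-cut solution, i.e. solution with $\operatorname{supp}\rho=[-a,a]$, $a>0$. For $T>T_c$ it is positive on $(-a,a)$; at $T=T_c$ it vanishes on $(-a,a)$ only at the origin, and $a^2=\frac43\frac{1+n}{n}$; for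 $0<T<T_c$ it is negative at the origin. 2. For every $T>0$ there is exactly one everywhere non-negative solution $(\hat\mu_T,\rho_T)$. For $T\ge T_c$ it is the single-cut solution. For $0<T<T_c$ it is a two-cut solution: $\operatorname{supp}\rho_T=[-b,-a]\cup[a,b]$ for some $0<a<b$, with $\rho_T>0$ on $(a,b)$. 3. Let $E(T)=\int\rho_T\hat V\,dx$ (energy per $N^2$) and $F(\beta)=\beta\int\rho\hat V\,dx-\frac12\iint\rho(x)\rho(y)\log|x^2-y^2|\,dx\,dy$ at $\rho=\rho_{1/\beta}$ (the leading order of $-\log Z/N^2$, up to a constant). Then $E=dF/d\beta$. The function $E$ is $C^1$ on $(0,\infty)$ and $C^2$ on $(0,T_c)$ and on $(T_c,\infty)$, with $$E(T_c)=T_c\,\frac{1-4n^2}{2n(1-n^2)},\qquad E'(T_c)=\frac{(1-2n)^2}{2n(1+n)^2},$$ $$E''(T_c^+)=-\frac{2}{T_c}\,\frac{3(1-2n)^2}{4n(1+n)^3},\qquad E''(T_c^-)=-\frac{2}{T_c}\,\frac{3(n-2)(2n-7)}{2n(1+n)^3},$$ and these one-sided limits of $E''$ are different. The transition is third order: $F$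 is $C^2$ on $(0,\infty)$ and $C^3$ away from $\beta_c=1/T_c$, and $F'''$ has one-sided limits at $\beta_c$ which are different. 4. $T_c/v_n$ is strictly increasing in $n\ge2$, with $T_c=v_2$ at $n=2$, and $T_c\sim v_n\sqrt{\frac{ne^2}{4\pi}}\left(\frac43\right)^n$ as $n\to\infty$. -/

import Mathlib

open Set Filter Topology MeasureTheory Asymptotics

noncomputable section

namespace SphericalMatrix

/-- The monomial potential `x ↦ v x^(2n)`. -/
def potential (n : ℕ) (v : ℝ) (x : ℝ) : ℝ := v * x ^ (2 * n)

/-- The Cauchy principal value of `∫ f(y) / (x - y) dy` exists and equals `L`. -/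
def HasPV (f : ℝ → ℝ) (x L : ℝ) : Prop :=
  Tendsto (fun ε : ℝ => ∫ y in {y : ℝ | ε < |x - y|}, f y / (x - y)) (𝓝[>] 0) (𝓝 L)

/-- `ρ` solves the large-`N` saddle point equations at temperature `T = 1/β`, with real Lagrange
multiplier `μ` for the spherical constraint, in the potential `V`:
`∫ ρ = 1`, `∫ ρ x² = 1` and `μ x + (β/2) V'(x) = P ∫ ρ(y)/(x - y) dy` in the interior of the support.
Nothing is required about the sign of `ρ` here. Solutions are taken in the usual class for
singular integral equations: Hölder continuous with compact support (in particular bounded at the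
ends of the cuts). -/
structure IsSaddleSolution (V : ℝ → ℝ) (T μ : ℝ) (ρ : ℝ → ℝ) : Prop where
  holder : ∃ C r : NNReal, 0 < r ∧ HolderWith C r ρ
  compact : HasCompactSupport ρ
  even : ∀ x, ρ (-x) = ρ x
  mass : ∫ x, ρ x = 1
  sphere : ∫ x, ρ x * x ^ 2 = 1
  saddle : ∀ x ∈ interior (tsupport ρ), HasPV ρ x (μ * x + T⁻¹ / 2 * deriv V x)

/-- A single-cut solution: the support is one interval `[-a, a]`. It may be a signed density. -/
def IsSingleCut (V : ℝ → ℝ) (T a μ : ℝ) (ρ : ℝ → ℝ) : Prop :=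
  0 < a ∧ tsupport ρ = Icc (-a) a ∧ IsSaddleSolution V T μ ρ

/-- A two-cut solution: the support is `[-b, -a] ∪ [a, b]` with `0 < a < b`. -/
def IsTwoCut (V : ℝ → ℝ) (T a b μ : ℝ) (ρ : ℝ → ℝ) : Prop :=
  0 < a ∧ a < b ∧ tsupport ρ = Icc (-b) (-a) ∪ Icc a b ∧ IsSaddleSolution V T μ ρ

/-- A symmetrized density of singular values: an everywhere non-negative saddle point solution,
with no assumption on the shape of its support. -/
def IsSaddleDensity (V : ℝ → ℝ) (T μ : ℝ) (ρ : ℝ → ℝ) : Prop :=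
  IsSaddleSolution V T μ ρ ∧ ∀ x, 0 ≤ ρ x

/-- The energy per `N²`. -/
def energy (V ρ : ℝ → ℝ) : ℝ := ∫ x, ρ x * V x

/-- The large-`N` action, i.e. `-(log Z)/N²` evaluated on `ρ`, up to a constant that depends
neither on `β` nor on `ρ`. -/
def action (V : ℝ → ℝ) (β : ℝ) (ρ : ℝ → ℝ) : ℝ :=
  β * energy V ρ - 1 / 2 * ∫ x, ρ x * ∫ y, ρ y * Real.log |x ^ 2 - y ^ 2|

/-- `T_c = v / (2 √π) * [4/3 (1 + 1/n)]^n * Γ(n - 1/2) / Γ(n - 1)`. -/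
def criticalTemp (n : ℕ) (v : ℝ) : ℝ :=
  v / (2 * Real.sqrt Real.pi) * (4 / 3 * (1 + 1 / (n : ℝ))) ^ n
    * (Real.Gamma ((n : ℝ) - 1 / 2) / Real.Gamma ((n : ℝ) - 1))

end SphericalMatrix

end

noncomputable section

/-! ### The Hilbert transform on compactly supported Hölder functions. -/

namespace SphericalMatrix

/-! For compactly supported Hölder functions the principal value exists everywhere and equals the
absolutely convergent integral `Hil`, so the saddle point equation reads `Hil ρ x = μ x + γ
x^(2n-1)` on the support, with `γ = n v / T`. Two facts about `Hil` do most of the work: it is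
antisymmetric (`Hol.integral_mul_hil`) and it is the derivative of the logarithmic potential
(`Hol.hasDerivAt_logPot`). Testing against polynomial multiples of a semicircle, antisymmetry shows
that a Hölder function vanishing at both ends of an interval is zero as soon as its transform is
constant there (`eq_zero_of_hil_eq_const`). The inverse is explicit: the preimage of `x^k`, modulo
constants, is a semicircle times a polynomial whose coefficients are moments of the arcsine law
(`hil_secPoly`, `eq_cutDensity`).

A single-cut solution is this inversion on `[-a, a]`. A symmetric two-cut solution becomes a
one-interval problem in `t = x²` with right-hand side `μ + γ t^(n-1)` (`SquareDensity.hil_eq`). The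
constraints on mass and second moment are then algebraic. They parametrize the single-cut branch by
`y = a²` in `(0, 4)` and the two-cut branch by the ratio `u` in `(0, 1)` of radius to center of the
interval of squares, with `τ = T / (n v)` equal to `tauOne n y` or `tauTwo n u`. Both functions are
strictly increasing, with images `(0, ∞)` and `(0, tauC n)`; for `tauTwo` this rests on
`pDelta_pos`, a bound on ratios of consecutive moments. The sign of the single-cut density at the
origin is that of `y - yC n` (`single_origin`), so positivity is lost exactly where the two-cut
branch ends.

A non-negative solution has no other shape: in a gap of the support on the positive axis `Hil ρ x /
x` does not increase, while the equation at the ends of the gap forces it to increase (`no_gap`).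

For the thermodynamics, the virial identity gives `E = (T/n)(1/2 - μ)`, and arcsine averages fix the
additive constant of the logarithmic potential, hence the action. On each branch everything is a
closed form in the branch parameter. The multipliers, actions and energy derivatives of the branches
agree where they meet, so `E` is `C¹` and `F' = E` throughout; the limits of `E''` differ by a
nonzero multiple of `2n - 3`, and the chain rule moves this jump to `F'''`. The critical temperature
is a central binomial expression, treated with Bernoulli's inequality and Wallis' product. -/

/-- Compactly supported Hölder continuous functions on the line. -/
structure Hol (f : ℝ → ℝ) : Prop where
  compact : HasCompactSupport f
  holder : ∃ C r : NNReal, 0 < r ∧ HolderWith C r f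

/-- The Hilbert transform `P ∫ f(y) / (x - y) dy`, as an absolutely convergent integral. -/
def Hil (f : ℝ → ℝ) (x : ℝ) : ℝ := ∫ s in Ioi (0 : ℝ), (f (x - s) - f (x + s)) * s⁻¹

/-- The logarithmic potential. -/
def logPot (f : ℝ → ℝ) (x : ℝ) : ℝ := ∫ y, f y * Real.log |x - y|

/-- The regularized Cauchy kernel. -/
def ker (ε s : ℝ) : ℝ := s / (s ^ 2 + ε ^ 2)

variable {f g : ℝ → ℝ}

lemma Hol.continuous (hf : Hol f) : Continuous f := by
  obtain ⟨C, r, hr, h⟩ := hf.holder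
  exact h.continuous hr

lemma Hol.integrable (hf : Hol f) : Integrable f :=
  hf.continuous.integrable_of_hasCompactSupport hf.compact

lemma Hol.exists_radius (hf : Hol f) : ∃ R > 0, ∀ x, R ≤ |x| → f x = 0 := by
  obtain ⟨R, hR, h⟩ := hf.compact.exists_pos_le_norm
  exact ⟨R, hR, fun x hx => h x (by simpa using hx)⟩

lemma Hol.exists_bound (hf : Hol f) : ∃ C, ∀ x, |f x| ≤ C := by
  simpa using hf.continuous.bounded_above_of_compact_support hf.compact

lemma Hol.diff_le (hf : Hol f) : ∃ C r : ℝ, 0 ≤ C ∧ 0 < r ∧ ∀ x y, |f x - f y| ≤ C * |x - y| ^ r := by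
  obtain ⟨C, r, hr, h⟩ := hf.holder
  exact ⟨C, r, C.2, hr, fun x y => by simpa [Real.dist_eq] using h.dist_le x y⟩

/-- Folding the line about `x` and using oddness brings out the difference `f (x - s) - f (x + s)`,
which the Hölder bound controls against a singular kernel. -/
lemma integral_odd_kernel (hf : Integrable f) {k : ℝ → ℝ} (hk : Measurable k) {M : ℝ}
    (hM : ∀ s, |k s| ≤ M) (hodd : ∀ s, k (-s) = -k s) (x : ℝ) :
    ∫ y, f y * k (x - y) = ∫ s in Ioi (0 : ℝ), (f (x - s) - f (x + s)) * k s := by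
  have h1 : ∫ y, f y * k (x - y) = ∫ s, f (x - s) * k s := by
    rw [← integral_sub_left_eq_self (fun s => f (x - s) * k s) volume x]
    simp
  have hb : ∀ᵐ s : ℝ, ‖k s‖ ≤ M := ae_of_all _ hM
  have i1 : Integrable (fun s => f (x - s) * k s) :=
    (hf.comp_sub_left x).mul_bdd (c := M) hk.aestronglyMeasurable hb
  have i2 : Integrable (fun s => f (x + s) * k s) :=
    (hf.comp_add_left x).mul_bdd (c := M) hk.aestronglyMeasurable hb
  rw [h1, ← intervalIntegral.integral_Iic_add_Ioi i1.integrableOn (b := 0) i1.integrableOn]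
  have h2 := integral_comp_neg_Ioi (0 : ℝ) (fun s => f (x - s) * k s)
  rw [neg_zero] at h2
  rw [← h2, ← integral_add]
  · congr 1
    ext s
    rw [hodd, sub_neg_eq_add]
    ring
  · refine (i2.neg.integrableOn (s := Ioi 0)).congr_fun (fun s _ => ?_) measurableSet_Ioi
    simp [hodd]
  · exact i1.integrableOn

/-- Hölder continuity bounds the integrand by a multiple of `s ^ (r - 1)`, integrable at `0`, and
for `s > M + R` it vanishes, `R` bounding the support. A dominating function valid for all `|x| ≤ M`
serves existence, continuity and convergence of the regularizations alike. -/
lemma Hol.exists_dominant (hf : Hol f) (M : ℝ) : ∃ G : ℝ → ℝ, IntegrableOn G (Ioi 0) ∧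
    ∀ x, |x| ≤ M → ∀ s, 0 < s → |f (x - s) - f (x + s)| * s⁻¹ ≤ G s := by
  obtain ⟨R, hR, hR0⟩ := hf.exists_radius
  obtain ⟨C, r, hC, hr, h⟩ := hf.diff_le
  refine ⟨(Iic (M + R)).indicator (fun s => C * 2 ^ r * s ^ (r - 1)), ?_, fun x hx s hs => ?_⟩
  · rw [integrableOn_indicator_iff measurableSet_Iic, Iic_inter_Ioi]
    have : IntervalIntegrable (fun s : ℝ => C * 2 ^ r * s ^ (r - 1)) volume 0 (max 0 (M + R)) :=
      (intervalIntegral.intervalIntegrable_rpow' (by linarith)).const_mul _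
    rw [intervalIntegrable_iff_integrableOn_Ioc_of_le (le_max_left _ _)] at this
    exact this.mono_set (Ioc_subset_Ioc_right (le_max_right _ _))
  · by_cases hsM : s ≤ M + R
    · rw [indicator_of_mem (by exact hsM)]
      have h1 := h (x - s) (x + s)
      have h2 : |x - s - (x + s)| = 2 * s := by
        rw [show x - s - (x + s) = -(2 * s) by ring, abs_neg, abs_of_pos (by linarith)]
      rw [h2, Real.mul_rpow (by norm_num) hs.le] at h1
      rw [Real.rpow_sub_one hs.ne']
      calc _ ≤ (C * (2 ^ r * s ^ r)) * s⁻¹ := by gcongr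
        _ = _ := by field_simp
    · push Not at hsM
      rw [indicator_of_notMem (by simpa using hsM)]
      have h1 : f (x - s) = 0 := hR0 _ (by
        rw [abs_sub_comm]; have := abs_le.1 hx; rw [abs_of_nonneg (by linarith)]; linarith)
      have h2 : f (x + s) = 0 := hR0 _ (by
        have := abs_le.1 hx; rw [abs_of_nonneg (by linarith)]; linarith)
      simp [h1, h2]

/-- The general kernel serves twice: for the sharp truncation in the principal value, and for the
continuous bounded kernel `ker`, with which integrals can be exchanged. -/
lemma Hol.tendsto_kernel (hf : Hol f) {k : ℝ → ℝ → ℝ} (hk : ∀ ε, Measurable (k ε))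
    (hb : ∀ ε, 0 < ε → ∀ s, 0 < s → |k ε s| ≤ s⁻¹)
    (hlim : ∀ s, 0 < s → Tendsto (fun ε => k ε s) (𝓝[>] 0) (𝓝 s⁻¹)) (x : ℝ) :
    Tendsto (fun ε => ∫ s in Ioi (0 : ℝ), (f (x - s) - f (x + s)) * k ε s) (𝓝[>] 0)
      (𝓝 (Hil f x)) := by
  obtain ⟨G, hG, hle⟩ := hf.exists_dominant |x|
  have hc := hf.continuous
  refine tendsto_integral_filter_of_dominated_convergence G ?_ ?_ hG ?_
  · refine Eventually.of_forall fun ε => ?_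
    have : Measurable fun s => (f (x - s) - f (x + s)) * k ε s :=
      Measurable.mul (by fun_prop) (hk ε)
    exact this.aestronglyMeasurable
  · filter_upwards [self_mem_nhdsWithin] with ε hε
    filter_upwards [ae_restrict_mem measurableSet_Ioi] with s hs
    refine le_trans ?_ (hle x le_rfl s hs)
    rw [Real.norm_eq_abs, abs_mul]
    exact mul_le_mul_of_nonneg_left (hb ε hε s hs) (abs_nonneg _)
  · filter_upwards [ae_restrict_mem measurableSet_Ioi] with s hs
    exact (hlim s hs).const_mul _

lemma Hol.hasPV (hf : Hol f) (x : ℝ) : HasPV f x (Hil f x) := by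
  let k : ℝ → ℝ → ℝ := fun ε s => if ε < |s| then s⁻¹ else 0
  have hk : ∀ ε, Measurable (k ε) := fun ε =>
    Measurable.ite (measurableSet_lt measurable_const (by fun_prop)) measurable_inv measurable_const
  have key := hf.tendsto_kernel hk (fun ε hε s hs => by
    by_cases h : ε < |s|
    · rw [show k ε s = s⁻¹ from if_pos h, abs_inv, abs_of_pos hs]
    · simp [k, h, hs.le]) (fun s hs => by
    refine tendsto_const_nhds.congr' ?_
    filter_upwards [Ioo_mem_nhdsGT hs] with ε hε
    have : ε < |s| := by rw [abs_of_pos hs]; exact hε.2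
    simp [k, this]) x
  refine key.congr' ?_
  filter_upwards [self_mem_nhdsWithin] with ε hε
  have hε : 0 < ε := hε
  rw [← integral_odd_kernel hf.integrable (hk ε) (M := ε⁻¹) _ _ x,
    ← integral_indicator (by
      exact measurableSet_lt measurable_const (by fun_prop))]
  · congr 1
    ext y
    by_cases h : ε < |x - y|
    · simp [k, h, div_eq_mul_inv]
    · simp [k, h]
  · intro s
    by_cases h : ε < |s|
    · simp only [k, h, if_true, abs_inv]
      exact inv_anti₀ hε h.le
    · simp [k, h, hε.le]
  · intro s
    by_cases h : ε < |s| <;> simp [k, h, inv_neg]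

lemma Hol.hasPV_iff (hf : Hol f) {x L : ℝ} : HasPV f x L ↔ L = Hil f x :=
  ⟨fun h => tendsto_nhds_unique h (hf.hasPV x), fun h => h ▸ hf.hasPV x⟩

lemma ker_odd (ε s : ℝ) : ker ε (-s) = -ker ε s := by simp [ker, neg_div]

lemma ker_le_inv {ε s : ℝ} (hs : 0 < s) : |ker ε s| ≤ s⁻¹ := by
  rw [ker, abs_div, abs_of_pos hs, abs_of_pos (by positivity : 0 < s ^ 2 + ε ^ 2),
    div_le_iff₀ (by positivity)]
  field_simp
  nlinarith [sq_nonneg ε]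

lemma ker_le {ε : ℝ} (hε : 0 < ε) (s : ℝ) : |ker ε s| ≤ ε⁻¹ := by
  rw [ker, abs_div, abs_of_pos (by positivity : 0 < s ^ 2 + ε ^ 2), div_le_iff₀ (by positivity)]
  field_simp
  nlinarith [sq_nonneg (|s| - ε), sq_abs s, abs_nonneg s, sq_nonneg ε, sq_nonneg s]

lemma continuous_ker {ε : ℝ} (hε : 0 < ε) : Continuous (ker ε) := by
  unfold ker
  exact continuous_id.div (by fun_prop) fun s => by positivity

lemma measurable_ker (ε : ℝ) : Measurable (ker ε) := by unfold ker; fun_prop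

lemma Hol.integral_ker (hf : Hol f) {ε : ℝ} (hε : 0 < ε) (x : ℝ) :
    ∫ y, f y * ker ε (x - y) = ∫ s in Ioi (0 : ℝ), (f (x - s) - f (x + s)) * ker ε s :=
  integral_odd_kernel hf.integrable (measurable_ker ε) (ker_le hε) (ker_odd ε) x

lemma Hol.tendsto_ker (hf : Hol f) (x : ℝ) :
    Tendsto (fun ε => ∫ y, f y * ker ε (x - y)) (𝓝[>] 0) (𝓝 (Hil f x)) := by
  refine (hf.tendsto_kernel (k := ker) measurable_ker (fun ε _ s hs => ker_le_inv hs)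
    (fun s hs => ?_) x).congr' ?_
  · have h : ContinuousAt (fun ε => ker ε s) 0 := by
      unfold ker
      exact ContinuousAt.div (by fun_prop) (by fun_prop) (by positivity)
    have h2 := h.tendsto.mono_left (nhdsWithin_le_nhds (s := Ioi (0 : ℝ)))
    have h3 : ker 0 s = s⁻¹ := by simp only [ker]; field_simp; ring
    rwa [h3] at h2
  · filter_upwards [self_mem_nhdsWithin] with ε hε
    exact (hf.integral_ker hε x).symm

lemma Hol.exists_ker_bound (hf : Hol f) (M : ℝ) : ∃ B, 0 ≤ B ∧ ∀ ε, 0 < ε → ∀ x, |x| ≤ M →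
    |∫ y, f y * ker ε (x - y)| ≤ B := by
  obtain ⟨G, hG, hle⟩ := hf.exists_dominant M
  refine ⟨|∫ s in Ioi 0, G s|, abs_nonneg _, fun ε hε x hx => ?_⟩
  rw [hf.integral_ker hε, ← Real.norm_eq_abs]
  refine (norm_integral_le_of_norm_le hG ?_).trans (le_abs_self _)
  filter_upwards [ae_restrict_mem measurableSet_Ioi] with s hs
  rw [norm_mul]
  exact (mul_le_mul_of_nonneg_left (ker_le_inv hs) (norm_nonneg _)).trans (hle x hx s hs)

lemma Hol.continuous_hil (hf : Hol f) : Continuous (Hil f) := by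
  rw [continuous_iff_continuousAt]
  intro x
  obtain ⟨G, hG, hle⟩ := hf.exists_dominant (|x| + 1)
  have hc := hf.continuous
  refine tendsto_integral_filter_of_dominated_convergence G ?_ ?_ hG ?_
  · refine Eventually.of_forall fun z => ?_
    have : Measurable fun s => (f (z - s) - f (z + s)) * s⁻¹ :=
      Measurable.mul (by fun_prop) (by fun_prop)
    exact this.aestronglyMeasurable
  · filter_upwards [Metric.ball_mem_nhds x one_pos] with z hz
    filter_upwards [ae_restrict_mem measurableSet_Ioi] with s hs
    have hs : 0 < s := hs
    refine le_trans ?_ (hle z ?_ s hs)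
    · rw [norm_mul, norm_inv, Real.norm_eq_abs, Real.norm_eq_abs, abs_of_pos hs]
    · rw [Metric.mem_ball, Real.dist_eq] at hz
      have := abs_sub_abs_le_abs_sub z x
      linarith
  · refine ae_of_all _ fun s => ?_
    have : Continuous fun z => (f (z - s) - f (z + s)) * s⁻¹ := by fun_prop
    exact this.tendsto x

lemma Hol.aestronglyMeasurable_ker (hf : Hol f) {ε : ℝ} (hε : 0 < ε) :
    AEStronglyMeasurable (fun x => ∫ y, f y * ker ε (x - y)) := by
  have hc : Continuous (fun p : ℝ × ℝ => f p.2 * ker ε (p.1 - p.2)) := by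
    have := hf.continuous
    have := continuous_ker hε
    fun_prop
  exact (hc.stronglyMeasurable.integral_prod_right).aestronglyMeasurable

lemma Hol.tendsto_integral_mul_ker (hf : Hol f) (hg : Hol g) :
    Tendsto (fun ε => ∫ x, g x * ∫ y, f y * ker ε (x - y)) (𝓝[>] 0)
      (𝓝 (∫ x, g x * Hil f x)) := by
  obtain ⟨R, hR, hR0⟩ := hg.exists_radius
  obtain ⟨B, hB0, hB⟩ := hf.exists_ker_bound R
  refine tendsto_integral_filter_of_dominated_convergence (fun x => |g x| * B) ?_ ?_
    (hg.integrable.abs.mul_const B) ?_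
  · filter_upwards [self_mem_nhdsWithin] with ε hε
    exact hg.integrable.aestronglyMeasurable.mul (hf.aestronglyMeasurable_ker hε)
  · filter_upwards [self_mem_nhdsWithin] with ε hε
    refine ae_of_all _ fun x => ?_
    rw [norm_mul, Real.norm_eq_abs, Real.norm_eq_abs]
    rcases le_or_gt R |x| with h | h
    · simp [hR0 x h]
    · exact mul_le_mul_of_nonneg_left (hB ε hε x h.le) (abs_nonneg _)
  · exact ae_of_all _ fun x => (hf.tendsto_ker x).const_mul _

/-- The Hilbert transform is antisymmetric. -/
theorem Hol.integral_mul_hil (hf : Hol f) (hg : Hol g) :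
    ∫ x, g x * Hil f x = -∫ x, f x * Hil g x := by
  refine tendsto_nhds_unique (hf.tendsto_integral_mul_ker hg)
    ((hg.tendsto_integral_mul_ker hf).neg.congr' ?_)
  -- At fixed `ε > 0` the kernel is bounded and odd, so Fubini gives antisymmetry exactly, before
  -- the limit is taken.
  filter_upwards [self_mem_nhdsWithin] with ε hε
  have hε : 0 < ε := hε
  have hi : Integrable (Function.uncurry fun x y => f x * (g y * ker ε (x - y)))
      (volume.prod volume) := by
    have h := (hf.integrable.mul_prod hg.integrable).mul_bdd (g := fun p : ℝ × ℝ => ker ε (p.1 - p.2))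
      (c := ε⁻¹) (((continuous_ker hε).comp (continuous_fst.sub continuous_snd)).aestronglyMeasurable)
      (ae_of_all _ fun p => ker_le hε _)
    refine h.congr (ae_of_all _ fun p => ?_)
    simp only [Function.uncurry]
    ring
  have h1 : ∫ x, f x * ∫ y, g y * ker ε (x - y) = ∫ x, ∫ y, f x * (g y * ker ε (x - y)) := by
    simp_rw [integral_const_mul]
  have h2 : ∫ x, g x * ∫ y, f y * ker ε (x - y) = ∫ x, ∫ y, g x * (f y * ker ε (x - y)) := by
    simp_rw [integral_const_mul]
  rw [h1, h2, integral_integral_swap hi, ← integral_neg]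
  congr 1
  ext x
  rw [← integral_neg]
  congr 1
  ext y
  rw [← neg_sub x y, ker_odd]
  ring

end SphericalMatrix

/-! ### Stability of the Hölder class, rules for `Hil`, and the logarithmic potential. -/

namespace SphericalMatrix

variable {f g : ℝ → ℝ}

/-- Hölder continuity on a compact interval, in terms of real numbers. -/
def HolOn (f : ℝ → ℝ) (A B : ℝ) : Prop :=
  ∃ C r : ℝ, 0 ≤ C ∧ 0 < r ∧ ∀ x ∈ Icc A B, ∀ y ∈ Icc A B, |f x - f y| ≤ C * |x - y| ^ r

lemma Hol.holOn (hf : Hol f) (A B : ℝ) : HolOn f A B := by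
  obtain ⟨C, r, hC, hr, h⟩ := hf.diff_le
  exact ⟨C, r, hC, hr, fun x _ y _ => h x y⟩

lemma Hol.of_real {C r : ℝ} (hC : 0 ≤ C) (hr : 0 < r) (h : ∀ x y, |f x - f y| ≤ C * |x - y| ^ r)
    (hs : HasCompactSupport f) : Hol f := by
  refine ⟨hs, C.toNNReal, r.toNNReal, by simpa, fun x y => ?_⟩
  rw [Real.coe_toNNReal r hr.le, edist_dist, edist_dist,
    ENNReal.ofReal_rpow_of_nonneg dist_nonneg hr.le, ← ENNReal.ofReal_coe_nnreal,
    Real.coe_toNNReal C hC, ← ENNReal.ofReal_mul hC]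
  exact ENNReal.ofReal_le_ofReal (h x y)

lemma hasCompactSupport_of_Icc {A B : ℝ} (h0 : ∀ x, x ∉ Icc A B → f x = 0) :
    HasCompactSupport f :=
  HasCompactSupport.intro isCompact_Icc h0

/-- Extension by zero of a function that is Hölder on an interval and vanishes at its ends. -/
lemma HolOn.hol {A B : ℝ} (hh : HolOn f A B) (hAB : A ≤ B) (h0 : ∀ x, x ∉ Ioo A B → f x = 0) :
    Hol f := by
  obtain ⟨C, r, hC, hr, h⟩ := hh
  -- Since `f` vanishes at both ends, extension by zero is composition with the projection onto `[A,
  -- B]`, which is 1-Lipschitz.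
  have hp : ∀ x, f x = f (projIcc A B hAB x) := by
    intro x
    rcases le_or_gt x A with hx | hx
    · rw [projIcc_of_le_left hAB hx, h0 x (fun h => by linarith [h.1]), h0 A (fun h => lt_irrefl _ h.1)]
    rcases le_or_gt B x with hx' | hx'
    · rw [projIcc_of_right_le hAB hx', h0 x (fun h => by linarith [h.2]),
        h0 B (fun h => lt_irrefl _ h.2)]
    · rw [projIcc_of_mem hAB ⟨hx.le, hx'.le⟩]
  refine Hol.of_real hC hr (fun x y => ?_)
    (hasCompactSupport_of_Icc fun x hx => h0 x fun h => hx (Ioo_subset_Icc_self h))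
  rw [hp x, hp y]
  refine (h _ (projIcc A B hAB x).2 _ (projIcc A B hAB y).2).trans ?_
  have := (LipschitzWith.projIcc hAB).dist_le_mul x y
  rw [Subtype.dist_eq, Real.dist_eq, Real.dist_eq, NNReal.coe_one, one_mul] at this
  gcongr

/-- On a bounded interval a Hölder exponent may be lowered at the cost of the constant; sums and
products use this to bring both functions to a common exponent. -/
lemma HolOn.lower {A B : ℝ} (h : HolOn f A B) : ∃ r₀ : ℝ, 0 < r₀ ∧ ∀ s : ℝ, 0 < s → s ≤ r₀ →
    ∃ C, 0 ≤ C ∧ ∀ x ∈ Icc A B, ∀ y ∈ Icc A B, |f x - f y| ≤ C * |x - y| ^ s := by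
  obtain ⟨C, r, hC, hr, h⟩ := h
  refine ⟨r, hr, fun s hs hsr => ⟨C * |B - A| ^ (r - s), by positivity, fun x hx y hy => ?_⟩⟩
  refine (h x hx y hy).trans ?_
  rw [mul_assoc]
  refine mul_le_mul_of_nonneg_left ?_ hC
  have : |x - y| ≤ |B - A| := by
    rw [abs_le]; have := le_abs_self (B - A); have := hx.1; have := hx.2; have := hy.1; have := hy.2
    constructor <;> linarith
  calc |x - y| ^ r = |x - y| ^ (r - s) * |x - y| ^ s := by
        rw [← Real.rpow_add_of_nonneg (abs_nonneg _) (by linarith) hs.le]; simp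
    _ ≤ _ := by gcongr

lemma HolOn.bound {A B : ℝ} (h : HolOn f A B) : ∃ M, 0 ≤ M ∧ ∀ x ∈ Icc A B, |f x| ≤ M := by
  obtain ⟨C, r, hC, hr, h⟩ := h
  refine ⟨|f A| + C * |B - A| ^ r, by positivity, fun x hx => ?_⟩
  have h1 := h x hx A ⟨le_rfl, hx.1.trans hx.2⟩
  have h2 : |x - A| ≤ |B - A| := by
    rw [abs_of_nonneg (by linarith [hx.1]), abs_of_nonneg (by linarith [hx.1, hx.2])]
    linarith [hx.2]
  have h3 : C * |x - A| ^ r ≤ C * |B - A| ^ r := by gcongr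
  have := abs_sub_abs_le_abs_sub (f x) (f A)
  linarith

lemma HolOn.mul {A B : ℝ} (hf : HolOn f A B) (hg : HolOn g A B) :
    HolOn (fun x => f x * g x) A B := by
  obtain ⟨M, hM0, hM⟩ := hf.bound
  obtain ⟨N, hN0, hN⟩ := hg.bound
  obtain ⟨r₁, h1, hr1⟩ := hf.lower
  obtain ⟨r₂, h2, hr2⟩ := hg.lower
  obtain ⟨C, hC, hC'⟩ := hr1 (min r₁ r₂) (by positivity) (min_le_left _ _)
  obtain ⟨D, hD, hD'⟩ := hr2 (min r₁ r₂) (by positivity) (min_le_right _ _)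
  refine ⟨C * N + M * D, min r₁ r₂, by positivity, by positivity, fun x hx y hy => ?_⟩
  have e : f x * g x - f y * g y = (f x - f y) * g x + f y * (g x - g y) := by ring
  rw [e, add_mul]
  refine (abs_add_le _ _).trans (add_le_add ?_ ?_)
  · rw [abs_mul]
    calc _ ≤ (C * |x - y| ^ min r₁ r₂) * N :=
          mul_le_mul (hC' x hx y hy) (hN x hx) (abs_nonneg _) (by positivity)
      _ = _ := by ring
  · rw [abs_mul]
    calc _ ≤ M * (D * |x - y| ^ min r₁ r₂) :=
          mul_le_mul (hM y hy) (hD' x hx y hy) (abs_nonneg _) (by positivity)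
      _ = _ := by ring

lemma holOn_of_contDiffOn {A B : ℝ} (hg : ContDiffOn ℝ 1 g (Icc A B)) : HolOn g A B := by
  obtain ⟨K, hK⟩ := hg.exists_lipschitzOnWith one_ne_zero (convex_Icc A B) isCompact_Icc
  refine ⟨K, 1, K.2, one_pos, fun x hx y hy => ?_⟩
  simpa [Real.dist_eq] using hK.dist_le_mul x hx y hy

lemma abs_sqrt_sub_sqrt_le (a b : ℝ) : |√a - √b| ≤ √|a - b| := by
  wlog h : b ≤ a generalizing a b
  · rw [abs_sub_comm, abs_sub_comm a]; exact this b a (le_of_not_ge h)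
  rw [abs_of_nonneg (sub_nonneg.2 (Real.sqrt_le_sqrt h)), abs_of_nonneg (sub_nonneg.2 h),
    sub_le_iff_le_add]
  rw [Real.sqrt_le_left (by positivity)]
  rcases le_or_gt b 0 with hb | hb
  · rw [Real.sqrt_eq_zero_of_nonpos hb, add_zero, Real.sq_sqrt (by linarith)]; linarith
  · have := Real.sq_sqrt hb.le
    have := Real.sq_sqrt (sub_nonneg.2 h)
    nlinarith [mul_nonneg (Real.sqrt_nonneg (a - b)) (Real.sqrt_nonneg b)]

lemma holOn_sqrt_comp {A B : ℝ} (hg : ContDiffOn ℝ 1 g (Icc A B)) : HolOn (fun x => √(g x)) A B := by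
  obtain ⟨K, hK⟩ := hg.exists_lipschitzOnWith one_ne_zero (convex_Icc A B) isCompact_Icc
  refine ⟨√K, 1 / 2, Real.sqrt_nonneg _, by norm_num, fun x hx y hy => ?_⟩
  refine (abs_sqrt_sub_sqrt_le _ _).trans ?_
  rw [← Real.sqrt_eq_rpow, ← Real.sqrt_mul (NNReal.coe_nonneg K)]
  exact Real.sqrt_le_sqrt (by simpa [Real.dist_eq] using hK.dist_le_mul x hx y hy)

lemma Hol.mul_contDiff (hf : Hol f) (hg : ContDiff ℝ 1 g) : Hol (fun x => g x * f x) := by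
  obtain ⟨R, hR, hR0⟩ := hf.exists_radius
  refine HolOn.hol ((holOn_of_contDiffOn hg.contDiffOn).mul (hf.holOn (-R) R)) (by linarith)
    fun x hx => ?_
  have : R ≤ |x| := by
    by_contra h
    exact hx (abs_lt.1 (not_le.1 h))
  simp [hR0 x this]

lemma Hol.const_mul (hf : Hol f) (a : ℝ) : Hol (fun x => a * f x) :=
  hf.mul_contDiff contDiff_const

lemma Hol.id_mul (hf : Hol f) : Hol (fun x => x * f x) := hf.mul_contDiff contDiff_id

lemma Hol.add (hf : Hol f) (hg : Hol g) : Hol (fun x => f x + g x) := by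
  obtain ⟨R, hR, hR0⟩ := hf.exists_radius
  obtain ⟨S, hS, hS0⟩ := hg.exists_radius
  have hfo := hf.holOn (-(R + S)) (R + S)
  have hgo := hg.holOn (-(R + S)) (R + S)
  obtain ⟨r₁, h1, hr1⟩ := hfo.lower
  obtain ⟨r₂, h2, hr2⟩ := hgo.lower
  obtain ⟨C, hC, hC'⟩ := hr1 (min r₁ r₂) (by positivity) (min_le_left _ _)
  obtain ⟨D, hD, hD'⟩ := hr2 (min r₁ r₂) (by positivity) (min_le_right _ _)
  refine HolOn.hol (A := -(R + S)) (B := R + S) ⟨C + D, min r₁ r₂, by positivity, by positivity,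
    fun x hx y hy => ?_⟩ (by linarith) fun x hx => ?_
  · rw [add_mul, add_sub_add_comm]
    exact (abs_add_le _ _).trans (add_le_add (hC' x hx y hy) (hD' x hx y hy))
  · have : R + S ≤ |x| := by
      by_contra h
      exact hx (abs_lt.1 (not_le.1 h))
    simp [hR0 x (by linarith), hS0 x (by linarith)]

lemma Hol.sub (hf : Hol f) (hg : Hol g) : Hol (fun x => f x - g x) := by
  simpa [sub_eq_add_neg] using hf.add (hg.const_mul (-1))

lemma Hol.integrableOn_hil (hf : Hol f) (x : ℝ) :
    IntegrableOn (fun s => (f (x - s) - f (x + s)) * s⁻¹) (Ioi 0) := by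
  obtain ⟨G, hG, hle⟩ := hf.exists_dominant |x|
  have hc := hf.continuous
  refine Integrable.mono' hG ?_ ?_
  · have : Measurable fun s => (f (x - s) - f (x + s)) * s⁻¹ :=
      Measurable.mul (by fun_prop) (by fun_prop)
    exact this.aestronglyMeasurable
  · filter_upwards [ae_restrict_mem measurableSet_Ioi] with s hs
    have hs : 0 < s := hs
    rw [norm_mul, norm_inv, Real.norm_eq_abs, Real.norm_eq_abs, abs_of_pos hs]
    exact hle x le_rfl s hs

lemma hil_const_mul (a x : ℝ) : Hil (fun y => a * f y) x = a * Hil f x := by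
  rw [Hil, Hil, ← integral_const_mul]
  congr 1
  ext s
  ring

lemma hil_add (hf : Hol f) (hg : Hol g) (x : ℝ) :
    Hil (fun y => f y + g y) x = Hil f x + Hil g x := by
  rw [Hil, Hil, Hil, ← integral_add (hf.integrableOn_hil x) (hg.integrableOn_hil x)]
  congr 1
  ext s
  ring

lemma hil_sub (hf : Hol f) (hg : Hol g) (x : ℝ) :
    Hil (fun y => f y - g y) x = Hil f x - Hil g x := by
  rw [Hil, Hil, Hil, ← integral_sub (hf.integrableOn_hil x) (hg.integrableOn_hil x)]
  congr 1
  ext s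
  ring

lemma integral_Ioi_reflect (hf : Integrable f) (x : ℝ) :
    ∫ s in Ioi (0 : ℝ), (f (x - s) + f (x + s)) = ∫ y, f y := by
  rw [integral_add (hf.comp_sub_left x).integrableOn (hf.comp_add_left x).integrableOn]
  have h2 := integral_comp_neg_Ioi (0 : ℝ) (fun s => f (x + s))
  rw [neg_zero] at h2
  simp_rw [← sub_eq_add_neg] at h2
  rw [h2, intervalIntegral.integral_Iic_add_Ioi (hf.comp_add_left x).integrableOn
    (hf.comp_add_left x).integrableOn]
  exact integral_add_left_eq_self f x

/-- Write `y = x - (x - y)`: the second term cancels the kernel and leaves the mass. This drives all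
inductions on the degree. -/
lemma hil_id_mul (hf : Hol f) (x : ℝ) :
    Hil (fun y => y * f y) x = x * Hil f x - ∫ y, f y := by
  have hi : IntegrableOn (fun s => f (x - s) + f (x + s)) (Ioi 0) :=
    ((hf.integrable.comp_sub_left x).add (hf.integrable.comp_add_left x)).integrableOn
  rw [← integral_Ioi_reflect hf.integrable x, Hil, Hil, ← integral_const_mul,
    ← integral_sub ((hf.integrableOn_hil x).const_mul x) hi]
  refine setIntegral_congr_fun measurableSet_Ioi fun s hs => ?_
  have hs : s ≠ 0 := ne_of_gt hs
  field_simp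
  ring

/-- Affine covariance of the Hilbert transform. -/
lemma hil_comp_affine (c : ℝ) {r : ℝ} (hr : 0 < r) (x : ℝ) :
    Hil (fun y => f ((y - c) / r)) x = Hil f ((x - c) / r) := by
  have h := integral_comp_mul_left_Ioi
    (fun s => (f ((x - c) / r - s) - f ((x - c) / r + s)) * s⁻¹) 0 (inv_pos.2 hr)
  rw [mul_zero, inv_inv, smul_eq_mul] at h
  rw [Hil, Hil, ← mul_right_inj' (inv_ne_zero hr.ne'), ← mul_right_inj' hr.ne',
    mul_inv_cancel_left₀ hr.ne', mul_inv_cancel_left₀ hr.ne', ← mul_right_inj' hr.ne', ← h,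
    ← integral_const_mul]
  congr 1
  ext s
  rw [mul_inv, inv_inv]
  have e1 : (x - s - c) / r = (x - c) / r - r⁻¹ * s := by field_simp; ring
  have e2 : (x + s - c) / r = (x - c) / r + r⁻¹ * s := by field_simp; ring
  rw [e1, e2]
  ring

lemma Hol.exists_logPot_bound (hf : Hol f) (x : ℝ) :
    ∃ M, 0 ≤ M ∧ ∀ y, f y ≠ 0 → |x - y| ≤ M := by
  obtain ⟨R, hR, hR0⟩ := hf.exists_radius
  refine ⟨|x| + R, by positivity, fun y hy => (abs_sub _ _).trans ?_⟩
  have : |y| ≤ R := by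
    by_contra h
    exact hy (hR0 y (not_le.1 h).le)
  linarith

lemma Hol.integrable_mul_log (hf : Hol f) (x : ℝ) :
    Integrable (fun y => f y * Real.log |x - y|) := by
  obtain ⟨R, hR, hR0⟩ := hf.exists_radius
  obtain ⟨M, hM⟩ := hf.exists_bound
  have h1 : IntervalIntegrable (fun y => Real.log |x - y|) volume (-R) R := by
    have := (intervalIntegral.intervalIntegrable_log' (a := x - R) (b := x - (-R))).comp_sub_left x
    simp only [sub_sub_cancel] at this
    simp_rw [Real.log_abs]
    exact this.symm
  rw [intervalIntegrable_iff_integrableOn_Ioc_of_le (by linarith)] at h1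
  have h2 : IntegrableOn (fun y => f y * Real.log |x - y|) (Ioc (-R) R) :=
    Integrable.bdd_mul (c := M) h1 hf.continuous.aestronglyMeasurable.restrict (ae_of_all _ hM)
  refine h2.integrable_of_forall_notMem_eq_zero fun y hy => ?_
  have : R ≤ |y| := by
    by_contra h
    have := abs_lt.1 (not_le.1 h)
    exact hy ⟨this.1, this.2.le⟩
  simp [hR0 y this]

/-- Dominated convergence: where `f ≠ 0` and `ε < 1`, the regularized logarithm lies between `log |x
- y|` and half of `log (M ^ 2 + 1)`. -/
lemma Hol.tendsto_regLog (hf : Hol f) (x : ℝ) :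
    Tendsto (fun ε => ∫ y, f y * (Real.log ((x - y) ^ 2 + ε ^ 2) / 2)) (𝓝[>] 0)
      (𝓝 (logPot f x)) := by
  obtain ⟨M, hM0, hM⟩ := hf.exists_logPot_bound x
  refine tendsto_integral_filter_of_dominated_convergence
    (fun y => |(f y * Real.log |x - y|)| + |f y| * Real.log (M ^ 2 + 1)) ?_ ?_
    ((hf.integrable_mul_log x).abs.add (hf.integrable.abs.mul_const _)) ?_
  · refine Eventually.of_forall fun ε => (Measurable.aestronglyMeasurable ?_)
    have := hf.continuous.measurable
    fun_prop
  · filter_upwards [Ioo_mem_nhdsGT one_pos] with ε hε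
    filter_upwards [(measure_singleton x : volume {x} = 0) |> compl_mem_ae_iff.2] with y hy
    have hxy : x - y ≠ 0 := sub_ne_zero.2 (Ne.symm hy)
    by_cases h0 : f y = 0
    · simp [h0]
    have hb := hM y h0
    rw [Real.norm_eq_abs, abs_mul, abs_mul, ← mul_add]
    refine mul_le_mul_of_nonneg_left ?_ (abs_nonneg _)
    have hp : 0 < (x - y) ^ 2 := by positivity
    have l1 : Real.log |x - y| * 2 ≤ Real.log ((x - y) ^ 2 + ε ^ 2) := by
      rw [mul_comm, ← Nat.cast_two, ← Real.log_pow, sq_abs]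
      exact Real.log_le_log hp (by nlinarith [sq_nonneg ε])
    have hsq : (x - y) ^ 2 ≤ M ^ 2 := by rw [← sq_abs]; gcongr
    have l2 : Real.log ((x - y) ^ 2 + ε ^ 2) ≤ Real.log (M ^ 2 + 1) :=
      Real.log_le_log (by positivity) (by nlinarith [hε.1, hε.2])
    have l3 : 0 ≤ Real.log (M ^ 2 + 1) := Real.log_nonneg (by nlinarith)
    rw [abs_le]
    have := neg_abs_le (Real.log |x - y|)
    have := abs_nonneg (Real.log |x - y|)
    constructor <;> linarith
  · filter_upwards [(measure_singleton x : volume {x} = 0) |> compl_mem_ae_iff.2] with y hy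
    have hxy : x - y ≠ 0 := sub_ne_zero.2 (Ne.symm hy)
    have hc : ContinuousAt (fun ε : ℝ => f y * (Real.log ((x - y) ^ 2 + ε ^ 2) / 2)) 0 := by
      refine ContinuousAt.mul continuousAt_const (ContinuousAt.div_const
        (ContinuousAt.log (by fun_prop) (by positivity)) _)
    have h := hc.tendsto.mono_left (nhdsWithin_le_nhds (s := Ioi (0 : ℝ)))
    have e : Real.log ((x - y) ^ 2 + 0 ^ 2) / 2 = Real.log |x - y| := by
      rw [← sq_abs, zero_pow two_ne_zero, add_zero, Real.log_pow]
      push_cast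
      ring
    rwa [e] at h

lemma Hol.integral_ker_eq (hf : Hol f) {ε : ℝ} (hε : 0 < ε) (a b : ℝ) :
    ∫ x in a..b, ∫ y, f y * ker ε (x - y) =
      (∫ y, f y * (Real.log ((b - y) ^ 2 + ε ^ 2) / 2))
        - ∫ y, f y * (Real.log ((a - y) ^ 2 + ε ^ 2) / 2) := by
  have hi : Integrable (Function.uncurry fun x y => f y * ker ε (x - y))
      ((volume.restrict (uIoc a b)).prod volume) := by
    have h1 : Integrable (fun _ : ℝ => (1 : ℝ)) (volume.restrict (uIoc a b)) :=
      continuous_const.integrableOn_uIoc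
    have h := (h1.mul_prod hf.integrable).mul_bdd (g := fun p : ℝ × ℝ => ker ε (p.1 - p.2))
      (c := ε⁻¹) (((continuous_ker hε).comp (continuous_fst.sub continuous_snd)).aestronglyMeasurable)
      (ae_of_all _ fun p => ker_le hε _)
    refine h.congr (ae_of_all _ fun p => ?_)
    simp [Function.uncurry]
  have hl : ∀ x, Integrable fun y => f y * (Real.log ((x - y) ^ 2 + ε ^ 2) / 2) := by
    intro x
    have hc : Continuous fun y => Real.log ((x - y) ^ 2 + ε ^ 2) / 2 :=
      (Continuous.log (by fun_prop) fun y => by positivity).div_const _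
    exact (hf.continuous.mul hc).integrable_of_hasCompactSupport hf.compact.mul_right
  rw [intervalIntegral_integral_swap hi, ← integral_sub (hl b) (hl a)]
  congr 1
  ext y
  rw [intervalIntegral.integral_const_mul, ← mul_sub]
  congr 1
  refine intervalIntegral.integral_eq_sub_of_hasDerivAt
    (f := fun x => Real.log ((x - y) ^ 2 + ε ^ 2) / 2) (fun x _ => ?_)
    (((continuous_ker hε).comp (by fun_prop : Continuous fun x => x - y)).intervalIntegrable _ _)
  have h1 : HasDerivAt (fun x => (x - y) ^ 2 + ε ^ 2) (2 * (x - y)) x := by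
    simpa using (((hasDerivAt_id x).sub_const y).pow 2).add_const (ε ^ 2)
  have h2 := (h1.log (by positivity)).div_const 2
  exact h2.congr_deriv (by unfold ker; field_simp)

/-- For `ε > 0` the kernel `ker ε` has the primitive `log (s ^ 2 + ε ^ 2) / 2`, so Fubini and the
fundamental theorem give the regularized identity; the bound uniform in `ε` permits the limit. -/
lemma Hol.integral_hil (hf : Hol f) (a b : ℝ) :
    ∫ x in a..b, Hil f x = logPot f b - logPot f a := by
  refine tendsto_nhds_unique ?_ ((hf.tendsto_regLog b).sub (hf.tendsto_regLog a))
  obtain ⟨B, hB0, hB⟩ := hf.exists_ker_bound (max |a| |b|)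
  have h : Tendsto (fun ε => ∫ x in a..b, ∫ y, f y * ker ε (x - y)) (𝓝[>] 0)
      (𝓝 (∫ x in a..b, Hil f x)) := by
    refine intervalIntegral.tendsto_integral_filter_of_dominated_convergence (fun _ => B) ?_ ?_
      (by simp) ?_
    · filter_upwards [self_mem_nhdsWithin] with ε hε
      exact (hf.aestronglyMeasurable_ker hε).restrict
    · filter_upwards [self_mem_nhdsWithin] with ε hε
      refine ae_of_all _ fun x hx => hB ε hε x ?_
      rcases mem_uIoc.1 hx with h | h
      · exact (abs_le_max_abs_abs h.1.le h.2)
      · exact (abs_le_max_abs_abs h.1.le h.2).trans (max_comm _ _).le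
    · exact ae_of_all _ fun x _ => hf.tendsto_ker x
  refine h.congr' ?_
  filter_upwards [self_mem_nhdsWithin] with ε hε
  exact hf.integral_ker_eq hε a b

/-- The Hilbert transform is the derivative of the logarithmic potential. -/
theorem Hol.hasDerivAt_logPot (hf : Hol f) (x : ℝ) : HasDerivAt (logPot f) (Hil f x) x := by
  have h := (intervalIntegral.integral_hasDerivAt_right
    (hf.continuous_hil.intervalIntegrable 0 x)
    (hf.continuous_hil.stronglyMeasurableAtFilter _ _) hf.continuous_hil.continuousAt).add_const
      (logPot f 0)
  refine h.congr_of_eventuallyEq (Eventually.of_forall fun z => ?_)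
  simp only [hf.integral_hil]
  ring

end SphericalMatrix

/-! ### The semicircle and uniqueness for the finite Hilbert transform. -/

namespace SphericalMatrix

variable {f g : ℝ → ℝ} {c r : ℝ}

/-- The semicircle of center `c` and radius `r`. -/
def semi (c r x : ℝ) : ℝ := √(r ^ 2 - (x - c) ^ 2)

lemma semi_eq_zero (hr : 0 < r) {x : ℝ} (hx : x ∉ Ioo (c - r) (c + r)) : semi c r x = 0 := by
  refine Real.sqrt_eq_zero_of_nonpos ?_
  by_contra h
  push Not at h
  have := abs_lt_of_sq_lt_sq (sub_pos.1 h) hr.le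
  rw [abs_lt] at this
  exact hx ⟨by linarith, by linarith⟩

lemma hol_semi (hr : 0 < r) : Hol (semi c r) := by
  refine HolOn.hol (A := c - r) (B := c + r) (holOn_sqrt_comp ?_) (by linarith)
    fun x hx => semi_eq_zero hr hx
  fun_prop

lemma semi_sq {x : ℝ} (hx : x ∈ Icc (c - r) (c + r)) :
    semi c r x ^ 2 = r ^ 2 - (x - c) ^ 2 :=
  Real.sq_sqrt (by nlinarith [hx.1, hx.2])

lemma semi_pos {x : ℝ} (hx : x ∈ Ioo (c - r) (c + r)) : 0 < semi c r x :=
  Real.sqrt_pos.2 (by nlinarith [hx.1, hx.2])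

lemma semi_scale (hr : 0 < r) (x : ℝ) : semi c r x = r * semi 0 1 ((x - c) / r) := by
  unfold semi
  rw [← Real.sqrt_sq hr.le, ← Real.sqrt_mul (sq_nonneg r), Real.sqrt_sq hr.le]
  congr 1
  field_simp
  ring

/-- A primitive of `y ↦ √(1 - y²) / (x - y)`. -/
lemma hasDerivAt_semi_primitive {x y : ℝ} (hx : x ∈ Ioo (-1) 1) (hy : y ∈ Ioo (-1) 1)
    (hxy : x ≠ y) :
    HasDerivAt (fun y => x * Real.arcsin y - √(1 - y ^ 2)
      + √(1 - x ^ 2) * Real.log (1 - x * y + √(1 - x ^ 2) * √(1 - y ^ 2))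
      - √(1 - x ^ 2) * Real.log (x - y)) (√(1 - y ^ 2) / (x - y)) y := by
  have hy1 : 0 < 1 - y ^ 2 := by nlinarith [hy.1, hy.2]
  have hx1 : 0 < 1 - x ^ 2 := by nlinarith [hx.1, hx.2]
  have hs : 0 < √(1 - y ^ 2) := Real.sqrt_pos.2 hy1
  have hk : 0 < √(1 - x ^ 2) := Real.sqrt_pos.2 hx1
  have hs2 : √(1 - y ^ 2) ^ 2 = 1 - y ^ 2 := Real.sq_sqrt hy1.le
  have hk2 : √(1 - x ^ 2) ^ 2 = 1 - x ^ 2 := Real.sq_sqrt hx1.le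
  have d1 := (Real.hasDerivAt_arcsin (ne_of_gt hy.1) (ne_of_lt hy.2)).const_mul x
  have d0 : HasDerivAt (fun y : ℝ => 1 - y ^ 2) (-(2 * y)) y := by
    simpa using (hasDerivAt_pow 2 y).const_sub 1
  have d2 := d0.sqrt hy1.ne'
  have hden : 0 < 1 - x * y + √(1 - x ^ 2) * √(1 - y ^ 2) := by
    have : 0 < 1 - x * y := by nlinarith [hx.1, hx.2, hy.1, hy.2]
    positivity
  have d3 := ((((hasDerivAt_id y).const_mul x).const_sub 1).add (d2.const_mul (√(1 - x ^ 2)))).log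
    hden.ne'
  have d4 := ((hasDerivAt_id y).const_sub x).log (sub_ne_zero.2 hxy)
  have d := ((d1.sub d2).add (d3.const_mul (√(1 - x ^ 2)))).sub (d4.const_mul (√(1 - x ^ 2)))
  refine d.congr_deriv ?_
  have hxy' : x - y ≠ 0 := sub_ne_zero.2 hxy
  simp only [id, Pi.add_apply] at *
  generalize √(1 - y ^ 2) = s at *
  generalize √(1 - x ^ 2) = k at *
  -- With `s` and `k` the two square roots, this identity reduces the derivative of the first
  -- logarithm to a fraction with denominator `s (x - y)`.
  have key : (s - k) * (1 - x * y + k * s) = (x * s + k * y) * (x - y) := by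
    linear_combination k * hs2 - s * hk2
  have e : (-(x * 1) + k * (-(2 * y) / (2 * s))) / (1 - x * y + k * s)
      = -(s - k) / (s * (x - y)) := by
    rw [div_eq_div_iff hden.ne' (mul_ne_zero hs.ne' hxy')]
    field_simp
    linear_combination key
  rw [e]
  field_simp
  linear_combination -hs2 + hk2

/-- The explicit primitive applies on both sides of the excised interval. The singular logarithms at
`x - ε` and `x + ε` cancel each other, those at `±1` cancel against the other logarithm of the
primitive, and the arcsine leaves `π x`. -/
lemma hil_semi_unit {x : ℝ} (hx : x ∈ Ioo (-1) 1) : Hil (semi 0 1) x = Real.pi * x := by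
  set Ψ : ℝ → ℝ := fun y => x * Real.arcsin y - √(1 - y ^ 2)
      + √(1 - x ^ 2) * Real.log (1 - x * y + √(1 - x ^ 2) * √(1 - y ^ 2)) with hΨ
  have hx1 : 0 < 1 - x ^ 2 := by nlinarith [hx.1, hx.2]
  have hk : 0 < √(1 - x ^ 2) := Real.sqrt_pos.2 hx1
  have hΨc : ContinuousOn Ψ (Icc (-1) 1) := by
    refine ContinuousOn.add (by fun_prop) (ContinuousOn.mul continuousOn_const
      (ContinuousOn.log (by fun_prop) fun y hy => ?_))
    have h1 : 0 < 1 - x * y := by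
      rcases le_total 0 y with h | h
      · nlinarith [hx.1, hx.2, hy.1, hy.2]
      · nlinarith [hx.1, hx.2, hy.1, hy.2]
    positivity
  have hs : ∀ y, semi 0 1 y = √(1 - y ^ 2) := fun y => by simp [semi]
  refine (hol_semi one_pos).hasPV x |> fun h => tendsto_nhds_unique h ?_
  have hlim : Tendsto (fun ε => Real.pi * x + (Ψ (x - ε) - Ψ (x + ε))) (𝓝[>] 0)
      (𝓝 (Real.pi * x)) := by
    have hcx : ContinuousAt Ψ x := hΨc.continuousAt (Icc_mem_nhds hx.1 hx.2)
    have h1 : ContinuousAt (fun ε => Real.pi * x + (Ψ (x - ε) - Ψ (x + ε))) 0 := by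
      refine continuousAt_const.add (ContinuousAt.sub ?_ ?_)
      · exact ContinuousAt.comp (g := Ψ) (f := fun ε => x - ε) (by simpa using hcx) (by fun_prop)
      · exact ContinuousAt.comp (g := Ψ) (f := fun ε => x + ε) (by simpa using hcx) (by fun_prop)
    have h2 := h1.tendsto.mono_left (nhdsWithin_le_nhds (s := Ioi (0 : ℝ)))
    simpa using h2
  refine hlim.congr' ?_
  have hd : 0 < min (1 - x) (1 + x) := lt_min (by linarith [hx.2]) (by linarith [hx.1])
  filter_upwards [Ioo_mem_nhdsGT hd] with ε hε
  have e1 : ε < 1 - x := hε.2.trans_le (min_le_left _ _)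
  have e2 : ε < 1 + x := hε.2.trans_le (min_le_right _ _)
  have e0 : 0 < ε := hε.1
  have hfc : ∀ s : Set ℝ, s ⊆ {x}ᶜ → ContinuousOn (fun y => semi 0 1 y / (x - y)) s :=
    fun s hs => (hol_semi one_pos).continuous.continuousOn.div (by fun_prop)
      fun y hy => sub_ne_zero.2 fun h => hs hy h.symm
  have hΦ : ∀ a b, a ≤ b → -1 ≤ a → b ≤ 1 → x ∉ Icc a b →
      ∫ y in a..b, semi 0 1 y / (x - y) = (Ψ b - √(1 - x ^ 2) * Real.log (x - b))
        - (Ψ a - √(1 - x ^ 2) * Real.log (x - a)) := by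
    intro a b hab ha hb hxab
    refine intervalIntegral.integral_eq_sub_of_hasDerivAt_of_le hab
      (f := fun y => Ψ y - √(1 - x ^ 2) * Real.log (x - y)) ?_ (fun y hy => ?_) ?_
    · refine (hΨc.mono (Icc_subset_Icc ha hb)).sub (continuousOn_const.mul
        (ContinuousOn.log (by fun_prop) fun y hy => sub_ne_zero.2 fun h => hxab (h ▸ hy)))
    · rw [hs]
      exact hasDerivAt_semi_primitive hx ⟨by linarith [hy.1], by linarith [hy.2]⟩
        fun h => hxab (h ▸ Ioo_subset_Icc_self hy)
    · rw [intervalIntegrable_iff_integrableOn_Icc_of_le hab]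
      exact (hfc _ fun y hy h => hxab (h ▸ hy)).integrableOn_Icc
  have hI1 := hΦ (-1) (x - ε) (by linarith) le_rfl (by linarith [hx.2]) fun h => by linarith [h.2]
  have hI2 := hΦ (x + ε) 1 (by linarith) (by linarith [hx.1]) le_rfl fun h => by linarith [h.1]
  have hset : ∫ y in {y : ℝ | ε < |x - y|}, semi 0 1 y / (x - y)
      = ∫ y in Ioo (-1) (x - ε) ∪ Ioo (x + ε) 1, semi 0 1 y / (x - y) := by
    refine setIntegral_eq_of_subset_of_forall_sdiff_eq_zero
      (measurableSet_lt measurable_const (by fun_prop)) ?_ ?_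
    · rintro y (h | h)
      · exact mem_ofPred_eq ▸ lt_of_lt_of_le (by linarith [h.2] : ε < x - y) (le_abs_self _)
      · exact mem_ofPred_eq ▸ lt_of_lt_of_le (by linarith [h.1] : ε < -(x - y)) (neg_le_abs _)
    · rintro y ⟨h1, h2⟩
      rw [mem_ofPred_eq] at h1
      rw [semi_eq_zero one_pos, zero_div]
      intro h
      rcases lt_abs.1 h1 with h3 | h3
      · exact h2 (Or.inl ⟨by linarith [h.1], by linarith⟩)
      · exact h2 (Or.inr ⟨by linarith, by linarith [h.2]⟩)
  rw [hset, setIntegral_union (Set.disjoint_left.2 fun y h1 h2 => by linarith [h1.2, h2.1])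
    measurableSet_Ioo, ← integral_Ioc_eq_integral_Ioo, ← integral_Ioc_eq_integral_Ioo,
    ← intervalIntegral.integral_of_le (by linarith), ← intervalIntegral.integral_of_le (by linarith),
    hI1, hI2]
  · simp only [hΨ, sub_sub_cancel, Real.arcsin_one, Real.arcsin_neg_one]
    rw [show x - (x + ε) = -ε by ring, Real.log_neg_eq_log, ← neg_sub 1 x, Real.log_neg_eq_log]
    norm_num
    ring_nf
  · exact ((hfc _ fun y hy h => by
      rw [mem_singleton_iff] at h; linarith [hy.2]).integrableOn_Icc (a := -1) (b := x - ε)).mono_set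
        Ioo_subset_Icc_self
  · exact ((hfc _ fun y hy h => by
      rw [mem_singleton_iff] at h; linarith [hy.1]).integrableOn_Icc (a := x + ε) (b := 1)).mono_set
        Ioo_subset_Icc_self

lemma hil_semi (hr : 0 < r) {x : ℝ} (hx : x ∈ Ioo (c - r) (c + r)) :
    Hil (semi c r) x = Real.pi * (x - c) := by
  have h1 : semi c r = fun y => r * (fun z => semi 0 1 z) ((y - c) / r) :=
    funext fun y => semi_scale hr y
  rw [h1, hil_const_mul, hil_comp_affine c hr, hil_semi_unit]
  · field_simp
  · constructor
    · rw [lt_div_iff₀ hr]; linarith [hx.1]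
    · rw [div_lt_iff₀ hr]; linarith [hx.2]

/-- The substitution `x = c + r cos θ`. -/
lemma integral_mul_semi (hr : 0 < r) {p : ℝ → ℝ} (hp : Continuous p) :
    ∫ x, p x * semi c r x =
      ∫ θ in (0 : ℝ)..Real.pi, p (c + r * Real.cos θ) * (r * Real.sin θ) ^ 2 := by
  have h1 : ∫ x, p x * semi c r x = ∫ x in (c - r)..(c + r), p x * semi c r x := by
    rw [intervalIntegral.integral_of_le (by linarith), integral_Ioc_eq_integral_Ioo,
      setIntegral_eq_integral_of_forall_compl_eq_zero fun x hx => by rw [semi_eq_zero hr hx, mul_zero]]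
  have h2 := intervalIntegral.integral_comp_mul_deriv (a := 0) (b := Real.pi)
    (f := fun θ : ℝ => c + r * Real.cos θ) (f' := fun θ : ℝ => -(r * Real.sin θ))
    (g := fun x : ℝ => p x * semi c r x) (fun θ _ => by
      simpa using ((Real.hasDerivAt_cos θ).const_mul r).const_add c) (by fun_prop)
    (hp.mul (hol_semi hr).continuous)
  simp only [Real.cos_zero, Real.cos_pi, mul_one, mul_neg, Function.comp_apply] at h2
  rw [← sub_eq_add_neg] at h2
  rw [h1, intervalIntegral.integral_symm, ← h2, ← intervalIntegral.integral_neg]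
  refine intervalIntegral.integral_congr fun θ hθ => ?_
  rw [uIcc_of_le Real.pi_pos.le] at hθ
  have hs : 0 ≤ Real.sin θ := Real.sin_nonneg_of_mem_Icc hθ
  have : semi c r (c + r * Real.cos θ) = r * Real.sin θ := by
    rw [semi, show r ^ 2 - (c + r * Real.cos θ - c) ^ 2 = (r * Real.sin θ) ^ 2 by
      linear_combination (-r ^ 2) * Real.sin_sq_add_cos_sq θ]
    exact Real.sqrt_sq (by positivity)
  simp only [this]
  ring

lemma Hol.integrable_pow_mul (hf : Hol f) (j : ℕ) : Integrable fun x => x ^ j * f x :=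
  (hf.mul_contDiff (contDiff_id.pow j)).integrable

lemma contDiff_eval (p : Polynomial ℝ) : ContDiff ℝ 1 fun x => p.eval x := by
  simp_rw [Polynomial.eval_eq_sum_range]
  fun_prop

lemma integral_eval_mul_eq_zero (hf : Hol f) {j : ℕ} (h : ∀ i ≤ j, ∫ x, x ^ i * f x = 0)
    (p : Polynomial ℝ) (hp : p.natDegree ≤ j) : ∫ x, p.eval x * f x = 0 := by
  simp_rw [p.eval_eq_sum_range' (Nat.lt_succ_of_le hp), Finset.sum_mul, mul_assoc]
  rw [integral_finsetSum _ fun i _ => (hf.integrable_pow_mul i).const_mul _]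
  refine Finset.sum_eq_zero fun i hi => ?_
  rw [integral_const_mul, h i (Nat.lt_succ_iff.1 (Finset.mem_range.1 hi)), mul_zero]

/-- A compactly supported continuous function is determined by its moments. -/
lemma eq_zero_of_moments (hf : Hol f) (h : ∀ i, ∫ x, x ^ i * f x = 0) : f = 0 := by
  obtain ⟨R, hR, hR0⟩ := hf.exists_radius
  have hc := hf.continuous
  have hsq : ∫ x, f x * f x = 0 := by
    have hb : ∀ ε > 0, |∫ x, f x * f x| ≤ ε * ∫ x, |f x| := by
      intro ε hε
      -- Weierstrass approximation: `∫ f²` equals `∫ (f - p) f` for every polynomial `p`, because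
      -- all moments vanish.
      obtain ⟨p, hp⟩ := exists_polynomial_near_of_continuousOn (-R) R f hc.continuousOn ε hε
      have h0 := integral_eval_mul_eq_zero hf (fun i _ => h i) p le_rfl
      have hpi : Integrable fun x => p.eval x * f x :=
        (hf.mul_contDiff (contDiff_eval p)).integrable
      have h2 : Integrable fun x => f x * f x :=
        (hc.mul hc).integrable_of_hasCompactSupport hf.compact.mul_right
      rw [← sub_zero (∫ x, f x * f x), ← h0, ← integral_sub h2 hpi, ← integral_const_mul,
        ← Real.norm_eq_abs]
      refine norm_integral_le_of_norm_le (hf.integrable.abs.const_mul ε) (ae_of_all _ fun x => ?_)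
      rw [← sub_mul, norm_mul]
      rcases le_or_gt R |x| with hx | hx
      · simp [hR0 x hx]
      · refine mul_le_mul_of_nonneg_right ?_ (norm_nonneg _)
        have := hp x (by have := abs_lt.1 hx; exact ⟨this.1.le, this.2.le⟩)
        rw [Real.norm_eq_abs, abs_sub_comm]
        exact this.le
    have hn : 0 ≤ ∫ x, |f x| := integral_nonneg fun x => abs_nonneg _
    have : |∫ x, f x * f x| ≤ 0 := by
      refine le_of_forall_pos_le_add fun ε hε => ?_
      have h1 := hb (ε / (1 + ∫ x, |f x|)) (by positivity)
      refine h1.trans ?_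
      rw [zero_add, div_mul_eq_mul_div, div_le_iff₀ (by positivity)]
      nlinarith
    exact abs_nonpos_iff.1 this
  have h2 : (fun x => f x * f x) = 0 := ((hc.mul hc).ae_eq_iff_eq volume continuous_zero).1
    ((integral_eq_zero_iff_of_nonneg (fun x => mul_self_nonneg (f x))
      ((hc.mul hc).integrable_of_hasCompactSupport hf.compact.mul_right)).1 hsq)
  ext x
  exact mul_self_eq_zero.1 (congrFun h2 x)

/-- Pairing with a function supported on the cut only sees the transform on the cut. -/
lemma integral_mul_hil_of_eqOn {A B : ℝ} (hf : Hol f) (hg : Hol g)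
    (hf0 : ∀ x ∉ Ioo A B, f x = 0) (hg0 : ∀ x ∉ Ioo A B, g x = 0) {F G : ℝ → ℝ}
    (hF : ∀ x ∈ Ioo A B, Hil f x = F x) (hG : ∀ x ∈ Ioo A B, Hil g x = G x) :
    ∫ x, G x * f x = -∫ x, F x * g x := by
  have h := hf.integral_mul_hil hg
  have e1 : ∫ x, g x * Hil f x = ∫ x, F x * g x := by
    congr 1
    ext x
    by_cases hx : x ∈ Ioo A B
    · rw [hF x hx, mul_comm]
    · simp [hg0 x hx]
  have e2 : ∫ x, f x * Hil g x = ∫ x, G x * f x := by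
    congr 1
    ext x
    by_cases hx : x ∈ Ioo A B
    · rw [hG x hx, mul_comm]
    · simp [hf0 x hx]
  rw [← e1, h, e2, neg_neg]

/-- Obtained by iterating `hil_id_mul`. Only the leading coefficient matters: paired with such a
function, a density with vanishing transform reveals its moment of order `j + 1` modulo lower ones.
-/
lemma hil_pow_mul_semi (hr : 0 < r) (j : ℕ) : ∃ p : Polynomial ℝ, p.natDegree ≤ j ∧
    ∀ x ∈ Ioo (c - r) (c + r),
      Hil (fun y => y ^ j * semi c r y) x = Real.pi * x ^ (j + 1) + p.eval x := by
  induction j with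
  | zero =>
    refine ⟨Polynomial.C (-(Real.pi * c)), (Polynomial.natDegree_C _).le, fun x hx => ?_⟩
    simp only [pow_zero, one_mul, hil_semi hr hx, Polynomial.eval_C]
    ring
  | succ j ih =>
    obtain ⟨p, hp, h⟩ := ih
    refine ⟨Polynomial.X * p - Polynomial.C (∫ y, y ^ j * semi c r y), ?_, fun x hx => ?_⟩
    · refine (Polynomial.natDegree_sub_C ..).le.trans (Polynomial.natDegree_mul_le.trans ?_)
      have := Polynomial.natDegree_X_le (R := ℝ)
      omega
    · have e : (fun y => y ^ (j + 1) * semi c r y) = fun y => y * (y ^ j * semi c r y) := by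
        ext y; ring
      have hw : Hol fun y => y ^ j * semi c r y := (hol_semi hr).mul_contDiff (contDiff_id.pow j)
      rw [e, hil_id_mul hw, h x hx]
      simp only [Polynomial.eval_sub, Polynomial.eval_mul, Polynomial.eval_X, Polynomial.eval_C]
      ring

/-- On an interval, a Hölder function vanishing at the ends is determined by its Hilbert transform
and its mass. -/
theorem eq_zero_of_hil_eq_zero (hr : 0 < r) (hg : Hol g) (hg0 : ∀ x ∉ Ioo (c - r) (c + r), g x = 0)
    (h : ∀ x ∈ Ioo (c - r) (c + r), Hil g x = 0) (hm : ∫ x, g x = 0) : g = 0 := by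
  refine eq_zero_of_moments hg fun i => ?_
  induction i using Nat.strong_induction_on with
  | _ i ih =>
    rcases i with _ | j
    · simpa using hm
    obtain ⟨p, hp, hpe⟩ := hil_pow_mul_semi (c := c) hr j
    have hw : Hol fun y => y ^ j * semi c r y := (hol_semi hr).mul_contDiff (contDiff_id.pow j)
    -- The pairing expresses `π` times the moment of order `j + 1` through moments of lower order,
    -- which vanish by induction.
    have h1 := integral_mul_hil_of_eqOn hg hw hg0 (fun x hx => by simp [semi_eq_zero hr hx])
      h hpe
    have h2 : Integrable fun x => p.eval x * g x := (hg.mul_contDiff (contDiff_eval p)).integrable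
    have h3 := integral_eval_mul_eq_zero hg (fun i hi => ih i (by omega)) p hp
    simp only [add_mul, zero_mul, integral_zero, neg_zero, mul_assoc] at h1
    rw [integral_add ((hg.integrable_pow_mul _).const_mul _) h2, h3, add_zero,
      integral_const_mul] at h1
    exact (mul_eq_zero.1 h1).resolve_left Real.pi_ne_zero

/-- A Hölder function vanishing at the ends of an interval whose Hilbert transform is constant there
vanishes. -/
theorem eq_zero_of_hil_eq_const (hr : 0 < r) (hg : Hol g) (hg0 : ∀ x ∉ Ioo (c - r) (c + r), g x = 0)
    {e : ℝ} (h : ∀ x ∈ Ioo (c - r) (c + r), Hil g x = e) : g = 0 ∧ e = 0 := by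
  have hπ := Real.pi_pos
  have hshift : ∀ {f : ℝ → ℝ}, Hol f → Hol fun y => (y - c) * f y := fun hf =>
    hf.mul_contDiff (contDiff_id.sub contDiff_const)
  have hilshift : ∀ {f : ℝ → ℝ}, Hol f → ∀ x, Hil (fun y => (y - c) * f y) x
      = (x - c) * Hil f x - ∫ y, f y := by
    intro f hf x
    simp_rw [sub_mul]
    rw [hil_sub hf.id_mul (hf.const_mul c), hil_id_mul hf, hil_const_mul]
    ring
  set w := semi c r with hw
  have hwH : Hol w := hol_semi hr
  have hw0 : ∀ x ∉ Ioo (c - r) (c + r), w x = 0 := fun x hx => semi_eq_zero hr hx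
  have hwi : ∫ x, w x = Real.pi * r ^ 2 / 2 := by
    have := integral_mul_semi (c := c) hr (p := fun _ => 1) continuous_const
    simp only [one_mul, mul_pow, intervalIntegral.integral_const_mul, integral_sin_sq] at this
    rw [hw, this]
    simp
    ring
  have hw1 : ∫ x, (x - c) * w x = 0 := by
    rw [hw, integral_mul_semi hr (by fun_prop)]
    have : ∀ θ : ℝ, (c + r * Real.cos θ - c) * (r * Real.sin θ) ^ 2
        = r ^ 3 * (Real.sin θ ^ 2 * Real.cos θ) := fun θ => by ring
    simp_rw [this, intervalIntegral.integral_const_mul, integral_sin_sq_mul_cos]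
    simp
  set m := ∫ x, g x with hm
  -- Testing against `w` and `(x - c) w` expresses the first and second centered moments of `g`
  -- through the constant `e` and the mass `m`.
  have hk1 := integral_mul_hil_of_eqOn hg hwH hg0 hw0 h fun x hx => hil_semi hr hx
  have hk2 := integral_mul_hil_of_eqOn hg (hshift hwH) hg0 (fun x hx => by simp [hw0 x hx]) h
    fun x hx => by rw [hilshift hwH, hil_semi hr hx, hwi]
  simp only [mul_assoc, integral_const_mul] at hk1 hk2
  rw [hw1, mul_zero, neg_zero] at hk2
  rw [hwi] at hk1
  have hg1 := hshift hg
  have hg2 := hshift hg1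
  have hm1 : ∫ x, (x - c) * g x = -(e * r ^ 2 / 2) := by
    field_simp at hk1 ⊢
    linarith
  have hm2 : ∫ x, (x - c) * ((x - c) * g x) = m * r ^ 2 / 2 := by
    have e1 : ∀ x, ((x - c) * (Real.pi * (x - c)) - Real.pi * r ^ 2 / 2) * g x
        = Real.pi * ((x - c) * ((x - c) * g x)) - Real.pi * r ^ 2 / 2 * g x := fun x => by ring
    simp_rw [e1] at hk2
    rw [integral_sub (hg2.integrable.const_mul _) (hg.integrable.const_mul _), integral_const_mul,
      integral_const_mul, ← hm] at hk2
    apply mul_left_cancel₀ hπ.ne'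
    linarith
  -- The coefficients are chosen so that transform and mass both vanish. As `w² = r² - (x - c)²` on
  -- the interval, the identity says `π w g = m - e (x - c)` there, and evaluation at both ends
  -- kills `m` and `e`.
  have hk : (fun x => (r ^ 2 * g x - (x - c) * ((x - c) * g x))
      - (m / Real.pi * w x - e / Real.pi * ((x - c) * w x))) = 0 := by
    refine eq_zero_of_hil_eq_zero (c := c) hr (((hg.const_mul _).sub hg2).sub
      ((hwH.const_mul _).sub ((hshift hwH).const_mul _))) (fun x hx => ?_) (fun x hx => ?_) ?_
    · simp [hw0 x hx, hg0 x hx]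
    · rw [hil_sub ((hg.const_mul _).sub hg2) ((hwH.const_mul _).sub ((hshift hwH).const_mul _)),
        hil_sub (hg.const_mul _) hg2, hil_sub (hwH.const_mul _) ((hshift hwH).const_mul _),
        hil_const_mul, hil_const_mul, hil_const_mul, hilshift hg1, hilshift hg, hilshift hwH,
        h x hx, hil_semi hr hx, hwi, hm1]
      field_simp
      ring
    · rw [integral_sub ((hg.const_mul _).sub hg2).integrable
          ((hwH.const_mul _).sub ((hshift hwH).const_mul _)).integrable,
        integral_sub (hg.const_mul _).integrable hg2.integrable,
        integral_sub (hwH.const_mul _).integrable ((hshift hwH).const_mul _).integrable,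
        integral_const_mul, integral_const_mul, integral_const_mul, hm2, hw1, hwi, ← hm]
      field_simp
      ring
  have hgw : ∀ x ∈ Ioo (c - r) (c + r), Real.pi * (w x * g x) = m - e * (x - c) := by
    intro x hx
    have h1 := congrFun hk x
    have h2 := semi_sq (Ioo_subset_Icc_self hx)
    have h3 := semi_pos hx
    rw [← hw] at h2 h3
    have h4 : w x * (Real.pi * (w x * g x)) = w x * (m - e * (x - c)) := by
      simp only [Pi.zero_apply] at h1
      field_simp at h1
      linear_combination h1 + Real.pi * g x * h2
    exact mul_left_cancel₀ h3.ne' h4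
  have hgc := hg.continuous
  have hwc := hwH.continuous
  have hcl : ∀ x ∈ Icc (c - r) (c + r), Real.pi * (w x * g x) = m - e * (x - c) := by
    have : closure (Ioo (c - r) (c + r)) ⊆ {x | Real.pi * (w x * g x) = m - e * (x - c)} :=
      closure_minimal hgw (isClosed_eq (by fun_prop) (by fun_prop))
    rwa [closure_Ioo (by linarith)] at this
  have ha := hcl (c - r) ⟨le_rfl, by linarith⟩
  have hb := hcl (c + r) ⟨by linarith, le_rfl⟩
  rw [hg0 _ fun h => lt_irrefl _ h.1] at ha
  rw [hg0 _ fun h => lt_irrefl _ h.2] at hb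
  have he : e = 0 := by
    have : e * r = 0 := by linarith
    exact (mul_eq_zero.1 this).resolve_right hr.ne'
  have hm0 : m = 0 := by rw [he] at ha; linarith
  exact ⟨eq_zero_of_hil_eq_zero hr hg hg0 (fun x hx => (h x hx).trans he) hm0, he⟩

end SphericalMatrix

/-! ### Moments of the arcsine law and their Legendre recurrence. -/

namespace SphericalMatrix

variable {f g : ℝ → ℝ} {c r : ℝ}

/-- The moments of the arcsine law with center `c` and radius `r`. -/
def mom (c r : ℝ) (k : ℕ) : ℝ :=
  Real.pi⁻¹ * ∫ θ in (0 : ℝ)..Real.pi, (c + r * Real.cos θ) ^ k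

lemma mom_zero : mom c r 0 = 1 := by simp [mom]

lemma mom_one : mom c r 1 = c := by
  have h : ∫ θ in (0 : ℝ)..Real.pi, (c + r * Real.cos θ) = Real.pi * c := by
    rw [intervalIntegral.integral_add (by simp) (by
      exact (Continuous.intervalIntegrable (by fun_prop) _ _)),
      intervalIntegral.integral_const_mul, integral_cos]
    simp
  simp only [mom, pow_one, h]
  field_simp

lemma integral_pow_arcsine (k : ℕ) :
    ∫ θ in (0 : ℝ)..Real.pi, (c + r * Real.cos θ) ^ k = Real.pi * mom c r k := by
  rw [mom, mul_inv_cancel_left₀ Real.pi_ne_zero]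

lemma integral_arcsine_combination (a₁ a₂ a₃ : ℝ) (i j k : ℕ) :
    ∫ θ in (0 : ℝ)..Real.pi, (a₁ * (c + r * Real.cos θ) ^ i + a₂ * (c + r * Real.cos θ) ^ j
      + a₃ * (c + r * Real.cos θ) ^ k)
      = Real.pi * (a₁ * mom c r i + a₂ * mom c r j + a₃ * mom c r k) := by
  have h : ∀ (a : ℝ) (i : ℕ), IntervalIntegrable (fun θ => a * (c + r * Real.cos θ) ^ i) volume 0
      Real.pi := fun a i => Continuous.intervalIntegrable (by fun_prop) _ _
  rw [intervalIntegral.integral_add ((h _ _).add (h _ _)) (h _ _),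
    intervalIntegral.integral_add (h _ _) (h _ _)]
  simp only [intervalIntegral.integral_const_mul, integral_pow_arcsine]
  ring

/-- The combination is, up to the factor `π`, the integral of the derivative of `r sin θ (c + r cos
θ)^(k+1)`, which vanishes at `0` and `π`. It is Bonnet's recurrence for Legendre polynomials in
homogeneous form. -/
lemma mom_rec (c r : ℝ) (k : ℕ) : (k + 2) * mom c r (k + 2) =
    (2 * k + 3) * c * mom c r (k + 1) - (k + 1) * (c ^ 2 - r ^ 2) * mom c r k := by
  have h1 := integral_arcsine_combination (c := c) (r := r) (k + 2) (-((2 * k + 3) * c))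
    ((k + 1) * (c ^ 2 - r ^ 2)) (k + 2) (k + 1) k
  have hd : ∀ θ : ℝ, HasDerivAt (fun θ => r * Real.sin θ * (c + r * Real.cos θ) ^ (k + 1))
      ((k + 2 : ℝ) * (c + r * Real.cos θ) ^ (k + 2)
        + -((2 * k + 3) * c) * (c + r * Real.cos θ) ^ (k + 1)
        + (k + 1) * (c ^ 2 - r ^ 2) * (c + r * Real.cos θ) ^ k) θ := by
    intro θ
    have e1 := ((Real.hasDerivAt_sin θ).const_mul r).mul
      ((((Real.hasDerivAt_cos θ).const_mul r).const_add c).pow (k + 1))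
    refine e1.congr_deriv ?_
    have hs := Real.sin_sq_add_cos_sq θ
    simp only [Pi.pow_apply, Nat.add_sub_cancel]
    push_cast
    linear_combination (-(k + 1) * r ^ 2 * (c + r * Real.cos θ) ^ k) * hs
  have h2 := intervalIntegral.integral_eq_sub_of_hasDerivAt (a := 0) (b := Real.pi)
    (fun θ _ => hd θ) (Continuous.intervalIntegrable (by fun_prop) _ _)
  rw [h1] at h2
  simp only [Real.sin_pi, Real.sin_zero, mul_zero, zero_mul, sub_zero] at h2
  have h3 := (mul_eq_zero.1 h2).resolve_left Real.pi_ne_zero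
  linarith

lemma mom_two (c r : ℝ) : mom c r 2 = c ^ 2 + r ^ 2 / 2 := by
  have h := mom_rec c r 0
  simp only [Nat.cast_zero, zero_add, mom_zero, mom_one] at h
  linarith

lemma mom_scale (c u : ℝ) (k : ℕ) : mom c (c * u) k = c ^ k * mom 1 u k := by
  have h : ∀ θ, (c + c * u * Real.cos θ) ^ k = c ^ k * (1 + u * Real.cos θ) ^ k := fun θ => by
    rw [← mul_pow]
    ring
  simp only [mom, h, intervalIntegral.integral_const_mul]
  ring

lemma integral_pow_mul_semi (hr : 0 < r) (k : ℕ) : ∫ x, x ^ k * semi c r x =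
    Real.pi * -(mom c r (k + 2) - 2 * c * mom c r (k + 1) + (c ^ 2 - r ^ 2) * mom c r k) := by
  have h := integral_arcsine_combination (c := c) (r := r) (-1) (2 * c)
    (-(c ^ 2 - r ^ 2)) (k + 2) (k + 1) k
  rw [integral_mul_semi hr (by fun_prop)]
  refine Eq.trans (intervalIntegral.integral_congr fun θ _ => ?_) (h.trans (by ring))
  have hs := Real.sin_sq_add_cos_sq θ
  linear_combination (r ^ 2 * (c + r * Real.cos θ) ^ k) * hs

/-- The convolution of a solution of the Legendre recurrence with its second difference. -/
lemma convolution_of_legendre_rec {q : ℕ → ℝ} {c d : ℝ} (h0 : q 0 = 1) (h1 : q 1 = c)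
    (hrec : ∀ k : ℕ, (k + 2) * q (k + 2) = (2 * k + 3) * c * q (k + 1) - (k + 1) * d * q k) (k : ℕ) :
    ∑ p ∈ Finset.HasAntidiagonal.antidiagonal k, q p.1 *
      -(q (p.2 + 2) - 2 * c * q (p.2 + 1) + d * q p.2) = q (k + 2) - c * q (k + 1) := by
  let Q : PowerSeries ℝ := PowerSeries.mk q
  let S : PowerSeries ℝ := PowerSeries.mk fun k => -(q (k + 2) - 2 * c * q (k + 1) + d * q k)
  let X : PowerSeries ℝ := PowerSeries.X
  let a : PowerSeries ℝ := PowerSeries.C c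
  let b : PowerSeries ℝ := PowerSeries.C d
  let Q' : PowerSeries ℝ := PowerSeries.derivative ℝ Q
  -- The recurrence is the differential equation `(1 - 2cX + dX²) Q' = (c - dX) Q` for the
  -- generating series.
  have hode : Q' - (X * (a * Q') + X * (a * Q')) + X * (X * (b * Q')) = a * Q - X * (b * Q) := by
    ext k
    rcases k with _ | _ | k
    · have : PowerSeries.coeff 0 Q' = c := by
        simp [Q', Q, PowerSeries.coeff_derivative, h1]
      rw [PowerSeries.coeff_zero_eq_constantCoeff] at this
      simp [X, a, Q, h0, this]
    · have := hrec 0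
      simp [X, a, b, Q, Q', PowerSeries.coeff_derivative, PowerSeries.coeff_succ_X_mul] at *
      linear_combination this
    · have := hrec (k + 1)
      simp [X, a, b, Q, Q', PowerSeries.coeff_derivative, PowerSeries.coeff_succ_X_mul] at *
      linear_combination this
  -- Hence `(1 - 2cX + dX²) Q²` has zero derivative and constant term one: `Q` is the inverse square
  -- root of the quadratic.
  have hD : (1 - (X * a + X * a) + X * (X * b)) * Q ^ 2 = 1 := by
    have dX : PowerSeries.derivative ℝ X = 1 := by simp [X]
    have da : PowerSeries.derivative ℝ a = 0 := by simp [a]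
    have db : PowerSeries.derivative ℝ b = 0 := by simp [b]
    refine PowerSeries.derivative.ext ?_ ?_
    · simp only [Derivation.leibniz, Derivation.leibniz_pow, map_add, map_sub, dX, da, db,
        Derivation.map_one_eq_zero, smul_eq_mul, nsmul_eq_mul]
      push_cast
      linear_combination (2 * Q) * hode
    · simp [X, Q, h0]
  have hXS : X * (X * S) = 1 - X * a - (Q - (X * (a * Q) + X * (a * Q)) + X * (X * (b * Q))) := by
    ext k
    rcases k with _ | _ | k
    · simp [X, Q, h0]
    · simp [X, a, b, Q, h0, h1, PowerSeries.coeff_succ_X_mul, PowerSeries.coeff_one]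
    · simp [X, a, b, Q, S, PowerSeries.coeff_succ_X_mul, PowerSeries.coeff_one,
        PowerSeries.coeff_X]
      ring
  -- The second differences assemble to `1 - cX` minus the quadratic times `Q`; multiplied by `Q`,
  -- the quadratic term becomes one, so the convolution is linear in `Q`.
  have hfin : X * (X * (Q * S)) = Q - X * (a * Q) - 1 := by
    linear_combination Q * hXS - hD
  have h2 := congrArg (PowerSeries.coeff (k + 2)) hfin
  simp only [X] at h2
  rw [PowerSeries.coeff_succ_X_mul, PowerSeries.coeff_succ_X_mul, PowerSeries.coeff_mul] at h2
  simp only [map_sub, PowerSeries.coeff_succ_X_mul, a, PowerSeries.coeff_C_mul, Q, S,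
    PowerSeries.coeff_mk, PowerSeries.coeff_one] at h2
  simpa using h2

end SphericalMatrix

/-! ### Explicit inversion of the finite Hilbert transform for powers. -/

namespace SphericalMatrix

variable {f g : ℝ → ℝ} {c r : ℝ}

/-- The polynomial part of `z ^ k / √((z - c)² - r²)` at infinity. -/
def secPoly (c r : ℝ) (k : ℕ) : Polynomial ℝ :=
  ∑ i ∈ Finset.range k, Polynomial.C (mom c r i) * Polynomial.X ^ (k - 1 - i)

lemma secPoly_zero : secPoly c r 0 = 0 := by simp [secPoly]

lemma secPoly_succ (k : ℕ) :
    secPoly c r (k + 1) = Polynomial.X * secPoly c r k + Polynomial.C (mom c r k) := by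
  rw [secPoly, Finset.sum_range_succ, secPoly, Finset.mul_sum]
  congr 1
  · refine Finset.sum_congr rfl fun i hi => ?_
    have : k + 1 - 1 - i = k - 1 - i + 1 := by have := Finset.mem_range.1 hi; omega
    rw [this, pow_succ]
    ring
  · simp

lemma hol_eval_mul_semi (hr : 0 < r) (p : Polynomial ℝ) : Hol fun x => p.eval x * semi c r x :=
  (hol_semi hr).mul_contDiff (contDiff_eval p)

lemma integral_semi (hr : 0 < r) : ∫ x, semi c r x = Real.pi * (r ^ 2 / 2) := by
  have h := integral_pow_mul_semi (c := c) hr 0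
  simp only [pow_zero, one_mul, zero_add, mom_zero, mom_one, mom_two] at h
  rw [h]
  ring

/-- The mass is a convolution of arcsine moments with semicircle moments. The latter are second
differences of the former, so `convolution_of_legendre_rec` collapses the sum. -/
lemma mass_secPoly (hr : 0 < r) (k : ℕ) : ∫ x, (secPoly c r k).eval x * semi c r x =
    Real.pi * (mom c r (k + 1) - c * mom c r k) := by
  rcases k with _ | k
  · simp [secPoly_zero, mom_zero, mom_one]
  rw [← convolution_of_legendre_rec mom_zero mom_one (mom_rec c r) k,
    Finset.Nat.sum_antidiagonal_eq_sum_range_succ (fun i j => mom c r i *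
      -(mom c r (j + 2) - 2 * c * mom c r (j + 1) + (c ^ 2 - r ^ 2) * mom c r j)) k, secPoly]
  simp only [Polynomial.eval_finsetSum, Polynomial.eval_mul, Polynomial.eval_C,
    Polynomial.eval_pow, Polynomial.eval_X, Finset.sum_mul, mul_assoc]
  rw [integral_finsetSum _ fun i _ => ((hol_semi hr).integrable_pow_mul _).const_mul _,
    Finset.mul_sum]
  refine Finset.sum_congr rfl fun i _ => ?_
  rw [integral_const_mul, Nat.add_sub_cancel, integral_pow_mul_semi hr]
  ring

/-- Multiplication by `y` costs the mass, and the new constant coefficient contributes a multiple of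
`π (x - c)`; with the value of the mass the constants reduce to the next moment. -/
lemma hil_secPoly (hr : 0 < r) {x : ℝ} (hx : x ∈ Ioo (c - r) (c + r)) (k : ℕ) :
    Hil (fun y => (secPoly c r k).eval y * semi c r y) x = Real.pi * (x ^ k - mom c r k) := by
  induction k with
  | zero => simp [secPoly_zero, mom_zero, Hil]
  | succ k ih =>
    have e : (fun y => (secPoly c r (k + 1)).eval y * semi c r y)
        = fun y => y * ((secPoly c r k).eval y * semi c r y) + mom c r k * semi c r y := by
      ext y
      simp only [secPoly_succ, Polynomial.eval_add, Polynomial.eval_mul, Polynomial.eval_X,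
        Polynomial.eval_C]
      ring
    have h1 := hol_eval_mul_semi (c := c) hr (secPoly c r k)
    rw [e, hil_add h1.id_mul ((hol_semi hr).const_mul _), hil_id_mul h1, hil_const_mul, ih,
      hil_semi hr hx, mass_secPoly hr]
    ring

/-- Read off from the mass at index `k + 1`, where the polynomial is `X` times the old one plus a
constant. -/
lemma first_moment_secPoly (hr : 0 < r) (k : ℕ) :
    ∫ x, x * ((secPoly c r k).eval x * semi c r x) =
      Real.pi * (mom c r (k + 2) - c * mom c r (k + 1) - r ^ 2 / 2 * mom c r k) := by
  have h := mass_secPoly (c := c) hr (k + 1)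
  have e : (fun y => (secPoly c r (k + 1)).eval y * semi c r y)
      = fun y => y * ((secPoly c r k).eval y * semi c r y) + mom c r k * semi c r y := by
    ext y
    simp only [secPoly_succ, Polynomial.eval_add, Polynomial.eval_mul, Polynomial.eval_X,
      Polynomial.eval_C]
    ring
  rw [e, integral_add (hol_eval_mul_semi hr _).id_mul.integrable
    ((hol_semi hr).integrable.const_mul _), integral_const_mul, integral_semi hr] at h
  linear_combination h

lemma second_moment_secPoly (hr : 0 < r) (k : ℕ) :
    ∫ x, x ^ 2 * ((secPoly 0 r k).eval x * semi 0 r x) =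
      Real.pi * (mom 0 r (k + 3) - r ^ 2 / 2 * mom 0 r (k + 1)) := by
  have h := first_moment_secPoly (c := 0) hr (k + 1)
  have e : (fun y => y * ((secPoly 0 r (k + 1)).eval y * semi 0 r y))
      = fun y => y ^ 2 * ((secPoly 0 r k).eval y * semi 0 r y) + mom 0 r k * (y ^ 1 * semi 0 r y) := by
    ext y
    simp only [secPoly_succ, Polynomial.eval_add, Polynomial.eval_mul, Polynomial.eval_X,
      Polynomial.eval_C]
    ring
  have h2 := integral_pow_mul_semi (c := 0) hr 1
  have h3 := mom_rec 0 r 1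
  rw [e, integral_add ((hol_eval_mul_semi hr _).integrable_pow_mul 2)
    (((hol_semi hr).integrable_pow_mul 1).const_mul _), integral_const_mul, h2] at h
  simp only [mom_one] at *
  norm_num at h3
  simp only [h3] at h
  linear_combination h

/-- The candidate density for the right-hand side `μ x ^ i + γ x ^ k`. -/
def cutDensity (c r μ γ : ℝ) (i k : ℕ) (x : ℝ) : ℝ :=
  Real.pi⁻¹ * (μ * ((secPoly c r i).eval x * semi c r x)
    + γ * ((secPoly c r k).eval x * semi c r x))

variable {μ γ : ℝ} {i k : ℕ}

lemma hol_cutDensity (hr : 0 < r) : Hol (cutDensity c r μ γ i k) :=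
  (((hol_eval_mul_semi hr _).const_mul _).add ((hol_eval_mul_semi hr _).const_mul _)).const_mul _

lemma cutDensity_eq_zero (hr : 0 < r) {x : ℝ} (hx : x ∉ Ioo (c - r) (c + r)) :
    cutDensity c r μ γ i k x = 0 := by simp [cutDensity, semi_eq_zero hr hx]

lemma hil_cutDensity (hr : 0 < r) {x : ℝ} (hx : x ∈ Ioo (c - r) (c + r)) :
    Hil (cutDensity c r μ γ i k) x
      = μ * x ^ i + γ * x ^ k - (μ * mom c r i + γ * mom c r k) := by
  unfold cutDensity
  rw [hil_const_mul, hil_add ((hol_eval_mul_semi hr _).const_mul _)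
    ((hol_eval_mul_semi hr _).const_mul _), hil_const_mul, hil_const_mul, hil_secPoly hr hx,
    hil_secPoly hr hx]
  field_simp
  ring

lemma mass_cutDensity (hr : 0 < r) : ∫ x, cutDensity c r μ γ i k x =
    μ * (mom c r (i + 1) - c * mom c r i) + γ * (mom c r (k + 1) - c * mom c r k) := by
  unfold cutDensity
  rw [integral_const_mul, integral_add ((hol_eval_mul_semi hr _).const_mul _).integrable
    ((hol_eval_mul_semi hr _).const_mul _).integrable, integral_const_mul, integral_const_mul,
    mass_secPoly hr, mass_secPoly hr]
  field_simp

lemma first_moment_cutDensity (hr : 0 < r) : ∫ x, x * cutDensity c r μ γ i k x =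
    μ * (mom c r (i + 2) - c * mom c r (i + 1) - r ^ 2 / 2 * mom c r i)
      + γ * (mom c r (k + 2) - c * mom c r (k + 1) - r ^ 2 / 2 * mom c r k) := by
  have e : ∀ x, x * cutDensity c r μ γ i k x =
      Real.pi⁻¹ * (μ * (x * ((secPoly c r i).eval x * semi c r x))
        + γ * (x * ((secPoly c r k).eval x * semi c r x))) := fun x => by
    unfold cutDensity
    ring
  simp_rw [e]
  rw [integral_const_mul, integral_add ((hol_eval_mul_semi hr _).id_mul.const_mul _).integrable
    ((hol_eval_mul_semi hr _).id_mul.const_mul _).integrable, integral_const_mul,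
    integral_const_mul, first_moment_secPoly hr, first_moment_secPoly hr]
  field_simp

lemma second_moment_cutDensity (hr : 0 < r) : ∫ x, x ^ 2 * cutDensity 0 r μ γ i k x =
    μ * (mom 0 r (i + 3) - r ^ 2 / 2 * mom 0 r (i + 1))
      + γ * (mom 0 r (k + 3) - r ^ 2 / 2 * mom 0 r (k + 1)) := by
  have e : ∀ x, x ^ 2 * cutDensity 0 r μ γ i k x =
      Real.pi⁻¹ * (μ * (x ^ 2 * ((secPoly 0 r i).eval x * semi 0 r x))
        + γ * (x ^ 2 * ((secPoly 0 r k).eval x * semi 0 r x))) := fun x => by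
    unfold cutDensity
    ring
  simp_rw [e]
  rw [integral_const_mul, integral_add (((hol_eval_mul_semi hr _).integrable_pow_mul 2).const_mul _)
    (((hol_eval_mul_semi hr _).integrable_pow_mul 2).const_mul _), integral_const_mul,
    integral_const_mul, second_moment_secPoly hr, second_moment_secPoly hr]
  field_simp

/-- Inversion of the finite Hilbert transform, bounded at both ends. -/
theorem eq_cutDensity (hr : 0 < r) (hf : Hol f) (hf0 : ∀ x ∉ Ioo (c - r) (c + r), f x = 0)
    (h : ∀ x ∈ Ioo (c - r) (c + r), Hil f x = μ * x ^ i + γ * x ^ k) :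
    f = cutDensity c r μ γ i k ∧ μ * mom c r i + γ * mom c r k = 0 := by
  -- The difference from the candidate has constant transform, so it vanishes together with that
  -- constant. The second conclusion is the solvability condition for vanishing at both ends.
  have h1 := eq_zero_of_hil_eq_const (c := c) hr
    (hf.sub (hol_cutDensity (c := c) (μ := μ) (γ := γ) (i := i) (k := k) hr))
    (e := μ * mom c r i + γ * mom c r k)
    (fun x hx => by rw [hf0 x hx, cutDensity_eq_zero hr hx, sub_zero])
    (fun x hx => by
      rw [hil_sub hf (hol_cutDensity hr), h x hx, hil_cutDensity
        hr hx]
      ring)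
  refine ⟨funext fun x => ?_, h1.2⟩
  have := congrFun h1.1 x
  simp only [Pi.zero_apply] at this
  linarith

lemma Hol.eq_zero_of_notMem_Ioo {A B : ℝ} (hf : Hol f) (h : tsupport f ⊆ Icc A B) :
    ∀ x ∉ Ioo A B, f x = 0 := by
  intro x hx
  have h0 : ∀ x ∉ Icc A B, f x = 0 := fun x hx => image_eq_zero_of_notMem_tsupport fun h1 => hx (h h1)
  by_cases hx' : x ∈ Icc A B
  · have hc : closure (Icc A B)ᶜ ⊆ {x | f x = 0} :=
      closure_minimal h0 (isClosed_eq hf.continuous continuous_const)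
    refine hc ?_
    rw [closure_compl, interior_Icc]
    exact hx
  · exact h0 x hx'

end SphericalMatrix

/-! ### Single-cut solutions. -/

namespace SphericalMatrix

variable {ρ : ℝ → ℝ} {c r : ℝ}

/-- Normalized central binomial coefficients, as the moments of the arcsine law on `[0, 1]`. -/
def cb (k : ℕ) : ℝ := mom (1 / 2) (1 / 2) k

lemma cb_zero : cb 0 = 1 := mom_zero

lemma cb_succ (k : ℕ) : 2 * (k + 1) * cb (k + 1) = (2 * k + 1) * cb k := by
  rcases k with _ | k
  · simp [cb, mom_zero, mom_one]
  · have := mom_rec (1 / 2) (1 / 2) k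
    simp only [cb]
    push_cast
    linear_combination 2 * this

lemma cb_pos (k : ℕ) : 0 < cb k := by
  induction k with
  | zero => simp [cb_zero]
  | succ k ih =>
    have := cb_succ k
    have h : 0 < 2 * ((k : ℝ) + 1) * cb (k + 1) := by rw [this]; positivity
    exact pos_of_mul_pos_right h (by positivity)

lemma mom_half_half (y : ℝ) (k : ℕ) : mom (y / 2) (y / 2) k = cb k * y ^ k := by
  have h1 := mom_scale (y / 2) 1 k
  have h2 := mom_scale (1 / 2) 1 k
  rw [mul_one] at h1 h2
  rw [cb, h1, h2, div_pow, div_pow]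
  ring

lemma mom_centered (a : ℝ) (k : ℕ) :
    mom 0 a (2 * k) = cb k * (a ^ 2) ^ k ∧ mom 0 a (2 * k + 1) = 0 := by
  induction k with
  | zero => simp [mom_zero, mom_one, cb_zero]
  | succ k ih =>
    have h1 := mom_rec 0 a (2 * k)
    have h2 := mom_rec 0 a (2 * k + 1)
    have h3 := cb_succ k
    push_cast at h1 h2
    rw [ih.1] at h1
    rw [show 2 * k + 1 + 2 = 2 * (k + 1) + 1 by ring, ih.2] at h2
    rw [show 2 * k + 2 = 2 * (k + 1) by ring] at h1
    constructor
    · have hk : (2 * (k : ℝ) + 2) ≠ 0 := by positivity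
      apply mul_left_cancel₀ hk
      linear_combination h1 - a ^ 2 * (a ^ 2) ^ k * h3
    · have hk : (2 * (k : ℝ) + 1 + 2) ≠ 0 := by positivity
      apply mul_left_cancel₀ hk
      linear_combination h2

lemma mom_even (a : ℝ) (k : ℕ) : mom 0 a (2 * k) = cb k * (a ^ 2) ^ k := (mom_centered a k).1

lemma mom_odd (a : ℝ) (k : ℕ) : mom 0 a (2 * k + 1) = 0 := (mom_centered a k).2

lemma secPoly_one : secPoly c r 1 = 1 := by simp [secPoly, mom_zero]

lemma eval_secPoly_odd (a x : ℝ) (m : ℕ) : (secPoly 0 a (2 * m + 3)).eval x =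
    x ^ 2 * (secPoly 0 a (2 * m + 1)).eval x + cb (m + 1) * (a ^ 2) ^ (m + 1) := by
  rw [secPoly_succ, secPoly_succ, mom_odd, show 2 * m + 1 + 1 = 2 * (m + 1) by ring, mom_even]
  simp
  ring

lemma eval_secPoly_odd_neg (a x : ℝ) (m : ℕ) :
    (secPoly 0 a (2 * m + 1)).eval (-x) = (secPoly 0 a (2 * m + 1)).eval x := by
  induction m with
  | zero => simp [secPoly_one]
  | succ m ih => rw [show 2 * (m + 1) + 1 = 2 * m + 3 by ring, eval_secPoly_odd, eval_secPoly_odd, ih,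
      neg_sq]

/-- Only even powers of `x` occur, with positive coefficients. In `cutDensity_single`, with `γ > 0`,
the one part of the bracket that can be negative is therefore its value at the origin. -/
lemma eval_secPoly_odd_pos {a : ℝ} (ha : 0 < a) (x : ℝ) (m : ℕ) :
    0 < (secPoly 0 a (2 * m + 1)).eval x := by
  induction m with
  | zero => simp [secPoly_one]
  | succ m ih =>
    rw [show 2 * (m + 1) + 1 = 2 * m + 3 by ring, eval_secPoly_odd]
    have := cb_pos (m + 1)
    positivity

lemma deriv_potential (n : ℕ) (v x : ℝ) :
    deriv (potential n v) x = v * (2 * n * x ^ (2 * n - 1)) := by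
  unfold potential
  simp

lemma IsSaddleSolution.hol {V : ℝ → ℝ} {T μ : ℝ} (h : IsSaddleSolution V T μ ρ) : Hol ρ :=
  ⟨h.compact, h.holder⟩

lemma support_subset_interior_tsupport (h : Continuous ρ) :
    Function.support ρ ⊆ interior (tsupport ρ) :=
  interior_maximal (subset_tsupport ρ) (h.isOpen_support)

/-- The set where `ρ ≠ 0` is open, hence inside the interior of the support, and both sides are
continuous; the equation extends to the closed support, ends of the cuts included. -/
lemma IsSaddleSolution.hil_eq {n : ℕ} {v T μ : ℝ} (h : IsSaddleSolution (potential n v) T μ ρ)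
    {x : ℝ} (hx : x ∈ tsupport ρ) : Hil ρ x = μ * x ^ 1 + n * v / T * x ^ (2 * n - 1) := by
  have hc := h.hol.continuous_hil
  have hcl : tsupport ρ ⊆ {x | Hil ρ x = μ * x ^ 1 + n * v / T * x ^ (2 * n - 1)} := by
    refine closure_minimal (fun x hx => ?_) (isClosed_eq hc (by fun_prop))
    have h1 := h.saddle x (support_subset_interior_tsupport h.hol.continuous hx)
    rw [h.hol.hasPV_iff, deriv_potential] at h1
    rw [mem_ofPred_eq, ← h1]
    ring
  exact hcl hx

lemma isSaddleSolution_of_hil {n : ℕ} {v T μ : ℝ} (hρ : Hol ρ) (he : ∀ x, ρ (-x) = ρ x)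
    (hm : ∫ x, ρ x = 1) (hs : ∫ x, ρ x * x ^ 2 = 1)
    (h : ∀ x ∈ interior (tsupport ρ), Hil ρ x = μ * x ^ 1 + n * v / T * x ^ (2 * n - 1)) :
    IsSaddleSolution (potential n v) T μ ρ where
  holder := hρ.holder
  compact := hρ.compact
  even := he
  mass := hm
  sphere := hs
  saddle x hx := by
    rw [hρ.hasPV_iff, h x hx, deriv_potential]
    ring

/-- The conditions on `y = a²` and the multiplier for a single-cut solution. -/
def SingleCutCond (n : ℕ) (γ y μ : ℝ) : Prop :=
  y + γ * cb n * y ^ n * ((n - 1) / (n + 1)) * y = 4 ∧ μ * y = 2 - 2 * (γ * cb n * y ^ n)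

/-- The mass fixes `μ y` in terms of `γ cb n y^n`; substituting this in the second moment leaves one
equation for `y`. -/
lemma singleCut_moments {n : ℕ} (hn : 2 ≤ n) {γ a μ : ℝ} (ha : 0 < a) :
    (∫ x, cutDensity 0 a μ γ 1 (2 * n - 1) x = 1 ∧
      ∫ x, cutDensity 0 a μ γ 1 (2 * n - 1) x * x ^ 2 = 1) ↔ SingleCutCond n γ (a ^ 2) μ := by
  obtain ⟨m, rfl⟩ : ∃ m, n = m + 1 := ⟨n - 1, by omega⟩
  simp_rw [mul_comm _ (_ ^ 2)]
  rw [mass_cutDensity ha, second_moment_cutDensity ha]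
  have e1 : 2 * (m + 1) - 1 + 1 = 2 * (m + 1) := by omega
  have e2 : 2 * (m + 1) - 1 + 3 = 2 * (m + 2) := by omega
  have e3 : mom 0 a (1 + 1) = a ^ 2 / 2 := by simp [mom_two]
  have e4 : mom 0 a (1 + 3) = 3 / 8 * (a ^ 2) ^ 2 := by
    have h1 := cb_succ 0
    have h2 := cb_succ 1
    rw [cb_zero] at h1
    norm_num at h1 h2
    rw [show 1 + 3 = 2 * 2 by rfl, mom_even]
    linear_combination (a ^ 2) ^ 2 * (h2 / 4 + 3 / 8 * h1)
  have h := cb_succ (m + 1)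
  rw [e1, e2, e3, e4, mom_even, mom_even, SingleCutCond]
  push_cast at h ⊢
  have hy : 0 < a ^ 2 := by positivity
  generalize a ^ 2 = y at *
  have hm : (m : ℝ) + 1 + 1 ≠ 0 := by positivity
  rw [show m + 2 = m + 1 + 1 by rfl]
  have h' : cb (m + 1 + 1) = (2 * (m + 1) + 1) * cb (m + 1) / (2 * ((m : ℝ) + 1 + 1)) := by
    rw [eq_div_iff (by positivity)]
    linarith
  rw [h', pow_succ y (m + 1)]
  generalize cb (m + 1) = b
  generalize y ^ (m + 1) = z
  constructor
  · rintro ⟨h1, h2⟩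
    have h3 : μ * y = 2 - 2 * (γ * b * z) := by linear_combination 2 * h1
    refine ⟨?_, h3⟩
    field_simp at h2 ⊢
    have h4 : (μ * y) * y * (m + 1 + 1) = (2 - 2 * (γ * b * z)) * y * (m + 1 + 1) := by rw [h3]
    linear_combination h2 / 8 - h4 / 2
  · rintro ⟨h1, h2⟩
    refine ⟨by linear_combination h2 / 2, ?_⟩
    field_simp at h1 ⊢
    have h4 : (μ * y) * y * (m + 1 + 1) = (2 - 2 * (γ * b * z)) * y * (m + 1 + 1) := by rw [h2]
    linear_combination 8 * h1 + 4 * h4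

/-- Factorized form of the single-cut density. -/
lemma cutDensity_single {n : ℕ} (hn : 2 ≤ n) (a μ γ x : ℝ) :
    cutDensity 0 a μ γ 1 (2 * n - 1) x = Real.pi⁻¹ * (μ + γ * (cb (n - 1) * (a ^ 2) ^ (n - 1))
      + γ * x ^ 2 * (secPoly 0 a (2 * (n - 2) + 1)).eval x) * semi 0 a x := by
  obtain ⟨m, rfl⟩ : ∃ m, n = m + 2 := ⟨n - 2, by omega⟩
  rw [cutDensity, show 2 * (m + 2) - 1 = 2 * m + 3 by omega, eval_secPoly_odd, secPoly_one]
  simp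
  ring

lemma semi_centered_neg (a x : ℝ) : semi 0 a (-x) = semi 0 a x := by simp [semi]

lemma cutDensity_single_neg {n : ℕ} (hn : 2 ≤ n) (a μ γ x : ℝ) :
    cutDensity 0 a μ γ 1 (2 * n - 1) (-x) = cutDensity 0 a μ γ 1 (2 * n - 1) x := by
  rw [cutDensity_single hn, cutDensity_single hn, eval_secPoly_odd_neg, semi_centered_neg, neg_sq]

/-- The polynomial factor takes different values at `0` and `1`, so it is not zero even when the
density is signed; its finitely many roots do not shrink the support. -/
lemma tsupport_cutDensity_single {n : ℕ} (hn : 2 ≤ n) {a μ γ : ℝ} (ha : 0 < a) (hγ : 0 < γ) :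
    tsupport (cutDensity 0 a μ γ 1 (2 * n - 1)) = Icc (-a) a := by
  set κ := μ + γ * (cb (n - 1) * (a ^ 2) ^ (n - 1)) with hκ
  set p : Polynomial ℝ := Polynomial.C κ + Polynomial.C γ * Polynomial.X ^ 2
    * secPoly 0 a (2 * (n - 2) + 1) with hp
  have hpe : ∀ x, p.eval x = κ + γ * x ^ 2 * (secPoly 0 a (2 * (n - 2) + 1)).eval x := fun x => by
    simp [hp]
  have hp0 : p ≠ 0 := by
    intro h
    have h0 := hpe 0
    have h1 := hpe 1
    have h2 := eval_secPoly_odd_pos ha 1 (n - 2)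
    have h3 := mul_pos hγ h2
    rw [h] at h0 h1
    simp at h0 h1
    linarith
  have hfin : {x | p.eval x = 0}.Finite := Polynomial.finite_setOfPred_isRoot hp0
  apply Subset.antisymm
  · refine closure_minimal (fun x hx => ?_) isClosed_Icc
    by_contra h
    exact hx (cutDensity_eq_zero ha fun h' => h (by
      rw [zero_sub, zero_add] at h'; exact Ioo_subset_Icc_self h'))
  · rw [← closure_Ioo (by linarith)]
    have hd := (hfin.countable.dense_compl ℝ).open_subset_closure_inter (isOpen_Ioo (a := -a) (b := a))
    refine closure_minimal (hd.trans (closure_mono ?_)) isClosed_closure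
    rintro x ⟨hx, hx'⟩
    rw [Function.mem_support, cutDensity_single hn, ← hκ, ← hpe]
    have h1 := semi_pos (c := 0) (r := a) (x := x) (by simpa using hx)
    exact mul_ne_zero (mul_ne_zero (inv_ne_zero Real.pi_ne_zero) hx') h1.ne'

theorem isSingleCut_iff {n : ℕ} (hn : 2 ≤ n) {v T : ℝ} (hv : 0 < v) (hT : 0 < T) {a μ : ℝ} :
    IsSingleCut (potential n v) T a μ ρ ↔ 0 < a ∧ SingleCutCond n (n * v / T) (a ^ 2) μ ∧
      ρ = cutDensity 0 a μ (n * v / T) 1 (2 * n - 1) := by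
  have hn0 : (0 : ℝ) < n := by exact_mod_cast (by omega : 0 < n)
  have hγ : 0 < n * v / T := by positivity
  constructor
  · rintro ⟨ha, hs, h⟩
    have h1 := eq_cutDensity (c := 0) (i := 1) (k := 2 * n - 1) ha h.hol (by
      simpa using h.hol.eq_zero_of_notMem_Ioo hs.subset) (fun x hx => h.hil_eq (by
        rw [hs]; rw [zero_sub, zero_add] at hx; exact Ioo_subset_Icc_self hx))
    refine ⟨ha, (singleCut_moments hn ha).1 ?_, h1.1⟩
    rw [← h1.1]
    exact ⟨h.mass, h.sphere⟩
  · rintro ⟨ha, hc, rfl⟩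
    have hs := tsupport_cutDensity_single (μ := μ) hn ha hγ
    have hm := (singleCut_moments hn ha).2 hc
    refine ⟨ha, hs, isSaddleSolution_of_hil (hol_cutDensity ha)
      (cutDensity_single_neg hn a μ _) hm.1 hm.2 fun x hx => ?_⟩
    rw [hs, interior_Icc] at hx
    rw [hil_cutDensity ha (by simpa using hx)]
    -- Both powers are odd, so their moments about the center `0` vanish and the solvability
    -- condition is automatic.
    have e : 2 * n - 1 = 2 * (n - 1) + 1 := by omega
    rw [e, mom_odd, mom_one]
    ring

end SphericalMatrix

/-! ### The substitution `t = x²` and two-cut solutions. -/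

namespace SphericalMatrix

variable {ρ σ : ℝ → ℝ} {c r : ℝ}

/-- `σ` is the density of the squares of a symmetric density `ρ`. -/
structure SquareDensity (ρ σ : ℝ → ℝ) : Prop where
  even : ∀ x, ρ (-x) = ρ x
  mul_sq : ∀ x, 0 < x → x * σ (x ^ 2) = ρ x
  zero : ∀ t, t ≤ 0 → σ t = 0

lemma SquareDensity.integral (h : SquareDensity ρ σ) (φ : ℝ → ℝ) :
    ∫ x, ρ x * φ (x ^ 2) = ∫ t, σ t * φ t := by
  have h1 : ∫ x, ρ x * φ (x ^ 2) = ∫ x, (fun x => ρ x * φ (x ^ 2)) |x| := by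
    congr 1
    ext x
    rcases abs_choice x with hx | hx <;> simp [hx, h.even]
  have h2 := integral_comp_rpow_Ioi_of_pos (g := fun t => σ t * φ t) (p := 2) two_pos
  have h3 : ∫ t, σ t * φ t = ∫ t in Ioi 0, σ t * φ t :=
    (setIntegral_eq_integral_of_forall_compl_eq_zero fun t ht => by
      rw [h.zero t (not_lt.1 ht), zero_mul]).symm
  rw [h1, integral_comp_abs (f := fun x => ρ x * φ (x ^ 2)), h3, ← h2, ← integral_const_mul]
  refine setIntegral_congr_fun measurableSet_Ioi fun x hx => ?_
  simp only [← h.mul_sq x hx, smul_eq_mul]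
  norm_num
  ring

lemma integral_even_reflect (he : ∀ x, ρ (-x) = ρ x) (φ : ℝ → ℝ) :
    ∫ y, ρ y * φ (-y) = ∫ y, ρ y * φ y := by
  rw [← integral_neg_eq_self (fun y => ρ y * φ y)]
  simp_rw [he]

lemma two_mul_logPot (hρ : Hol ρ) (he : ∀ x, ρ (-x) = ρ x) (x : ℝ) :
    2 * logPot ρ x = ∫ y, ρ y * Real.log |x ^ 2 - y ^ 2| := by
  have h1 := integral_even_reflect he fun y => Real.log |x - y|
  have i1 := hρ.integrable_mul_log x
  have i2 : Integrable fun y => ρ y * Real.log |x - -y| := by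
    have := i1.comp_neg
    simpa only [he] using this
  calc 2 * logPot ρ x = (∫ y, ρ y * Real.log |x - y|) + ∫ y, ρ y * Real.log |x - -y| := by
        rw [h1, logPot]; ring
    _ = ∫ y, (ρ y * Real.log |x - y| + ρ y * Real.log |x - -y|) := (integral_add i1 i2).symm
    _ = _ := by
        refine integral_congr_ae ?_
        filter_upwards [(measure_singleton x : volume {x} = 0) |> compl_mem_ae_iff.2,
          (measure_singleton (-x) : volume {-x} = 0) |> compl_mem_ae_iff.2] with y h1 h2
        have e1 : |x - y| ≠ 0 := abs_ne_zero.2 (sub_ne_zero.2 (Ne.symm h1))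
        have e2 : |x - -y| ≠ 0 := abs_ne_zero.2 fun h => h2 (by
          rw [mem_singleton_iff]; linarith)
        rw [← mul_add, ← Real.log_mul e1 e2, ← abs_mul]
        ring_nf

lemma SquareDensity.logPot_eq (h : SquareDensity ρ σ) (hρ : Hol ρ) (x : ℝ) :
    logPot ρ x = logPot σ (x ^ 2) / 2 := by
  have h1 := two_mul_logPot hρ h.even x
  rw [h.integral fun t => Real.log |x ^ 2 - t|] at h1
  rw [logPot, logPot] at *
  linarith

/-- Differentiate `SquareDensity.logPot_eq`: since the transform is the derivative of the potential,
no change of variables inside a principal value is needed. -/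
lemma SquareDensity.hil_eq (h : SquareDensity ρ σ) (hρ : Hol ρ) (hσ : Hol σ) (x : ℝ) :
    Hil ρ x = x * Hil σ (x ^ 2) := by
  have h1 := hρ.hasDerivAt_logPot x
  have h2 := ((hσ.hasDerivAt_logPot (x ^ 2)).comp x (hasDerivAt_pow 2 x)).div_const 2
  have e : logPot ρ = fun x => (logPot σ ∘ fun x => x ^ 2) x / 2 :=
    funext fun x => h.logPot_eq hρ x
  rw [e] at h1
  rw [h1.unique h2]
  simp
  ring

lemma mom_pos (hr : 0 < r) (hrc : r ≤ c) (k : ℕ) : 0 < mom c r k := by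
  refine mul_pos (inv_pos.2 Real.pi_pos) (intervalIntegral.intervalIntegral_pos_of_pos_on
    (Continuous.intervalIntegrable (by fun_prop) _ _) (fun θ hθ => ?_) Real.pi_pos)
  have h1 : -1 < Real.cos θ := by
    rw [← Real.cos_pi]
    exact Real.cos_lt_cos_of_nonneg_of_le_pi hθ.1.le le_rfl hθ.2
  have : 0 < c + r * Real.cos θ := by nlinarith
  positivity

lemma eval_secPoly_pos (hr : 0 < r) (hrc : r ≤ c) {x : ℝ} (hx : 0 ≤ x) (k : ℕ) :
    0 < (secPoly c r (k + 1)).eval x := by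
  induction k with
  | zero => simp [secPoly_one]
  | succ k ih =>
    rw [secPoly_succ]
    simp only [Polynomial.eval_add, Polynomial.eval_mul, Polynomial.eval_X, Polynomial.eval_C]
    have := mom_pos hr hrc (k + 1)
    positivity

lemma cutDensity_two (c r μ γ : ℝ) (k : ℕ) (t : ℝ) : cutDensity c r μ γ 0 k t =
    Real.pi⁻¹ * (γ * ((secPoly c r k).eval t * semi c r t)) := by
  simp [cutDensity, secPoly_zero]

/-- The conditions on center, radius and multiplier for a two-cut solution. -/
def TwoCutCond (n : ℕ) (γ c r μ : ℝ) : Prop :=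
  μ = -(γ * mom c r (n - 1)) ∧ γ * (mom c r n - c * mom c r (n - 1)) = 1 ∧
    γ * (mom c r (n + 1) - c * mom c r n - r ^ 2 / 2 * mom c r (n - 1)) = 1

lemma SquareDensity.of_sqrt (he : ∀ x, ρ (-x) = ρ x) : SquareDensity ρ fun t => ρ √t / √t where
  even := he
  mul_sq x hx := by simp only [Real.sqrt_sq hx.le]; field_simp
  zero t ht := by simp [Real.sqrt_eq_zero_of_nonpos ht]

/-- The square root costs half of the Hölder exponent, and division by it is harmless because `a >
0` keeps the interval away from the origin. -/
lemma hol_of_sqrt {a b : ℝ} (ha : 0 < a) (hab : a < b) (hρ : Hol ρ) (h0 : ∀ x ∉ Ioo a b, 0 ≤ x → ρ x = 0) :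
    (∀ t ∉ Ioo (a ^ 2) (b ^ 2), ρ √t / √t = 0) ∧ Hol fun t => ρ √t / √t := by
  have hz : ∀ t ∉ Ioo (a ^ 2) (b ^ 2), ρ √t / √t = 0 := by
    intro t ht
    rw [h0 _ (fun h => ht ?_) (Real.sqrt_nonneg t), zero_div]
    exact ⟨(Real.lt_sqrt ha.le).1 h.1, (Real.sqrt_lt' (ha.trans hab)).1 h.2⟩
  refine ⟨hz, HolOn.hol (A := a ^ 2) (B := b ^ 2) ?_ (by gcongr) hz⟩
  simp_rw [div_eq_mul_inv]
  refine HolOn.mul ?_ (holOn_of_contDiffOn ?_)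
  · obtain ⟨C, s, hC, hs, h⟩ := hρ.diff_le
    refine ⟨C, 1 / 2 * s, hC, by positivity, fun x _ y _ => (h _ _).trans ?_⟩
    rw [Real.rpow_mul (abs_nonneg _), ← Real.sqrt_eq_rpow]
    have := abs_sqrt_sub_sqrt_le x y
    gcongr
  · intro t ht
    have ht0 : 0 < t := lt_of_lt_of_le (by positivity) ht.1
    exact ((Real.contDiffAt_sqrt ht0.ne').inv (Real.sqrt_pos.2 ht0).ne').contDiffWithinAt

lemma SquareDensity.of_abs_mul (h0 : ∀ t, t ≤ 0 → σ t = 0) :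
    SquareDensity (fun x => |x| * σ (x ^ 2)) σ where
  even x := by simp
  mul_sq x hx := by simp only [abs_of_pos hx]
  zero := h0

lemma hol_abs_mul {b : ℝ} (hb : 0 < b) (hσ : Hol σ) (h0 : ∀ t, b ^ 2 ≤ t → σ t = 0) :
    Hol fun x => |x| * σ (x ^ 2) := by
  refine HolOn.hol (A := -b) (B := b) (HolOn.mul ?_ ?_) (by linarith) fun x hx => ?_
  · exact ⟨1, 1, zero_le_one, one_pos, fun x _ y _ => by simpa using abs_abs_sub_abs_le x y⟩
  · obtain ⟨C, s, hC, hs, h⟩ := hσ.diff_le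
    refine ⟨C * (2 * b) ^ s, s, by positivity, hs, fun x hx y hy => (h _ _).trans ?_⟩
    rw [mul_assoc, ← Real.mul_rpow (by positivity) (abs_nonneg _), sq_sub_sq, abs_mul]
    have : |x + y| ≤ 2 * b := by
      rw [abs_le]; constructor <;> linarith [hx.1, hx.2, hy.1, hy.2]
    gcongr
  · rw [h0, mul_zero]
    rw [← sq_abs x]
    have : b ≤ |x| := by
      by_contra h
      exact hx (abs_lt.1 (not_le.1 h))
    gcongr

theorem isTwoCut_iff {n : ℕ} (hn : 2 ≤ n) {v T : ℝ} (hv : 0 < v) (hT : 0 < T) {a b μ : ℝ} :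
    IsTwoCut (potential n v) T a b μ ρ ↔ 0 < a ∧ a < b ∧
      TwoCutCond n (n * v / T) ((a ^ 2 + b ^ 2) / 2) ((b ^ 2 - a ^ 2) / 2) μ ∧
      ρ = fun x => |x| * cutDensity ((a ^ 2 + b ^ 2) / 2) ((b ^ 2 - a ^ 2) / 2) μ (n * v / T) 0
        (n - 1) (x ^ 2) := by
  have hn0 : (0 : ℝ) < n := by exact_mod_cast (by omega : 0 < n)
  set γ : ℝ := n * v / T with hγdef
  have hγ : 0 < γ := by positivity
  refine and_congr_right fun ha => and_congr_right fun hab => ?_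
  have hb : 0 < b := ha.trans hab
  set c := (a ^ 2 + b ^ 2) / 2 with hc
  set r := (b ^ 2 - a ^ 2) / 2 with hr
  have hcr : c - r = a ^ 2 := by rw [hc, hr]; ring
  have hcr' : c + r = b ^ 2 := by rw [hc, hr]; ring
  have hr0 : 0 < r := by rw [hr]; nlinarith
  have hrc : r ≤ c := by nlinarith [sq_nonneg a]
  -- The constant term `μ` contributes nothing to the mass and the first moment, since `secPoly` of
  -- index `0` is zero; it enters only through the solvability condition.
  have hmoments : ∀ μ, μ + γ * mom c r (n - 1) = 0 →
      ((∫ t, cutDensity c r μ γ 0 (n - 1) t = 1 ∧ ∫ t, t * cutDensity c r μ γ 0 (n - 1) t = 1) ↔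
        TwoCutCond n γ c r μ) := by
    intro μ hμ
    rw [mass_cutDensity hr0, first_moment_cutDensity hr0, TwoCutCond]
    obtain ⟨m, rfl⟩ : ∃ m, n = m + 1 := ⟨n - 1, by omega⟩
    simp only [mom_zero, mom_one, mom_two, zero_add, Nat.add_sub_cancel] at *
    have e1 : ∀ z, μ * (c - c * 1) + z = z := fun z => by ring
    have e2 : ∀ z, μ * (c ^ 2 + r ^ 2 / 2 - c * c - r ^ 2 / 2 * 1) + z = z := fun z => by ring
    rw [e1, e2]
    constructor
    · exact fun h => ⟨by linarith, h⟩
    · exact fun h => h.2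
  have hpow : ∀ x : ℝ, x * (x ^ 2) ^ (n - 1) = x ^ (2 * n - 1) := fun x => by
    rw [← pow_mul, ← pow_succ']
    congr 1
    omega
  constructor
  · rintro ⟨hs, h⟩
    have hz : ∀ x ∉ Ioo a b, 0 ≤ x → ρ x = 0 := by
      have hb' : ∀ x ∉ Ioo (-b) b, ρ x = 0 := h.hol.eq_zero_of_notMem_Ioo (by
        rw [hs]
        exact union_subset (Icc_subset_Icc_right (by linarith)) (Icc_subset_Icc_left (by linarith)))
      have ha' : ∀ x, |x| < a → ρ x = 0 := fun x hx => image_eq_zero_of_notMem_tsupport (by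
        rw [hs]
        have := abs_lt.1 hx
        rintro (h | h)
        · linarith [h.2]
        · linarith [h.1])
      have haa : ρ a = 0 := by
        have hcl : closure (Ioo (-a) a) ⊆ {x | ρ x = 0} :=
          closure_minimal (fun x hx => ha' x (abs_lt.2 hx))
            (isClosed_eq h.hol.continuous continuous_const)
        rw [closure_Ioo (by linarith)] at hcl
        exact hcl ⟨by linarith, le_rfl⟩
      intro x hx hx0
      rcases lt_trichotomy x a with h1 | h1 | h1
      · exact ha' x (by rwa [abs_of_nonneg hx0])
      · rw [h1, haa]
      · exact hb' x fun h2 => hx ⟨h1, h2.2⟩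
    obtain ⟨hσ0, hσ⟩ := hol_of_sqrt ha hab h.hol hz
    have hsq := SquareDensity.of_sqrt h.even
    set σ : ℝ → ℝ := fun t => ρ √t / √t with hσdef
    rw [← hcr, ← hcr'] at hσ0
    have hH : ∀ t ∈ Ioo (c - r) (c + r), Hil σ t = μ * t ^ 0 + γ * t ^ (n - 1) := by
      intro t ht
      rw [hcr, hcr'] at ht
      have ht0 : 0 < t := lt_trans (by positivity) ht.1
      have hst := Real.sqrt_pos.2 ht0
      have h1 := h.hil_eq (x := √t) (by
        rw [hs]
        exact Or.inr ⟨Real.le_sqrt_of_sq_le ht.1.le, Real.sqrt_le_iff.2 ⟨hb.le, ht.2.le⟩⟩)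
      rw [hsq.hil_eq h.hol hσ, ← hpow, Real.sq_sqrt ht0.le] at h1
      apply mul_left_cancel₀ hst.ne'
      rw [h1]
      ring
    obtain ⟨h1, h2⟩ := eq_cutDensity hr0 hσ hσ0 hH
    have hm := hsq.integral fun _ => 1
    have hm2 := hsq.integral fun t => t
    simp only [mul_one] at hm
    rw [h.mass] at hm
    rw [h.sphere] at hm2
    refine ⟨(hmoments μ (by simpa [mom_zero] using h2)).1 ?_, ?_⟩
    · rw [← h1]
      refine ⟨hm.symm, ?_⟩
      refine Eq.trans ?_ hm2.symm
      congr 1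
      ext t
      ring
    · rw [← h1]
      ext x
      rcases lt_trichotomy x 0 with hx | hx | hx
      · rw [← h.even, ← hsq.mul_sq _ (neg_pos.2 hx), abs_of_neg hx, neg_sq]
      · rw [hx, hz 0 (fun h => by linarith [h.1]) le_rfl]; simp
      · rw [← hsq.mul_sq _ hx, abs_of_pos hx]
  · rintro ⟨hcond, rfl⟩
    have hμ : μ + γ * mom c r (n - 1) = 0 := by rw [hcond.1]; ring
    have hmom := (hmoments μ hμ).2 hcond
    set σ : ℝ → ℝ := cutDensity c r μ γ 0 (n - 1) with hσdef
    have hσ : Hol σ := hol_cutDensity hr0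
    have hσ0 : ∀ t ∉ Ioo (a ^ 2) (b ^ 2), σ t = 0 := fun t ht =>
      cutDensity_eq_zero hr0 (by rwa [hcr, hcr'])
    have hσpos : ∀ t ∈ Ioo (a ^ 2) (b ^ 2), 0 < σ t := by
      intro t ht
      have h1 := semi_pos (c := c) (r := r) (x := t) (by rwa [hcr, hcr'])
      have h2 := eval_secPoly_pos hr0 hrc (x := t) ((sq_nonneg a).trans ht.1.le) (n - 2)
      rw [show n - 2 + 1 = n - 1 by omega] at h2
      rw [hσdef, cutDensity_two]
      positivity
    have hsq : SquareDensity (fun x => |x| * σ (x ^ 2)) σ := SquareDensity.of_abs_mul fun t ht =>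
      hσ0 t fun h => by nlinarith [h.1, sq_nonneg a]
    have hρ : Hol fun x => |x| * σ (x ^ 2) := hol_abs_mul hb hσ fun t ht =>
      hσ0 t fun h => by linarith [h.2]
    have hsupp : Function.support (fun x => |x| * σ (x ^ 2)) = Ioo (-b) (-a) ∪ Ioo a b := by
      have hiff : ∀ x : ℝ, x ∈ Ioo (-b) (-a) ∪ Ioo a b ↔ x ^ 2 ∈ Ioo (a ^ 2) (b ^ 2) := by
        intro x
        rw [mem_Ioo (a := a ^ 2), sq_lt_sq, sq_lt_sq, abs_of_pos ha, abs_of_pos hb]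
        rcases le_total 0 x with hx | hx
        · rw [abs_of_nonneg hx]
          exact ⟨by rintro (h | h) <;> constructor <;> linarith [h.1, h.2], fun h => Or.inr h⟩
        · rw [abs_of_nonpos hx]
          exact ⟨by rintro (h | h) <;> constructor <;> linarith [h.1, h.2],
            fun h => Or.inl ⟨by linarith [h.2], by linarith [h.1]⟩⟩
      ext x
      rw [hiff, Function.mem_support]
      constructor
      · intro h
        by_contra h'
        exact h (by rw [hσ0 _ h', mul_zero])
      · intro h
        have hx : x ≠ 0 := by
          rintro rfl
          have := h.1
          nlinarith [sq_nonneg a]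
        exact mul_ne_zero (abs_ne_zero.2 hx) (hσpos _ h).ne'
    have hs : tsupport (fun x => |x| * σ (x ^ 2)) = Icc (-b) (-a) ∪ Icc a b := by
      rw [tsupport, hsupp, closure_union, closure_Ioo (by linarith), closure_Ioo hab.ne]
    refine ⟨hs, isSaddleSolution_of_hil hρ hsq.even ?_ ?_ fun x hx => ?_⟩
    · have := hsq.integral fun _ => 1
      simp only [mul_one] at this
      rw [this, hmom.1]
    · have := hsq.integral fun t => t
      rw [this, ← hmom.2]
      congr 1
      ext t
      ring
    · have hc1 : Continuous (Hil fun x => |x| * σ (x ^ 2)) := hρ.continuous_hil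
      have hcl : tsupport (fun x => |x| * σ (x ^ 2)) ⊆
          {x | Hil (fun x => |x| * σ (x ^ 2)) x = μ * x ^ 1 + γ * x ^ (2 * n - 1)} := by
        refine closure_minimal (fun x hx => ?_) (isClosed_eq hc1 (by fun_prop))
        have hx2 : x ^ 2 ∈ Ioo (c - r) (c + r) := by
          by_contra h
          exact hx (by simp only; rw [hσ0 _ (by rwa [hcr, hcr'] at h), mul_zero])
        rw [mem_ofPred_eq, hsq.hil_eq hρ hσ, hσdef, hil_cutDensity hr0 hx2, ← hpow, mom_zero]
        linear_combination (-x) * hμ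
      exact hcl (interior_subset hx)

end SphericalMatrix

/-! ### The support of a non-negative solution. -/

namespace SphericalMatrix

variable {ρ : ℝ → ℝ}

/-- Off the support the Hilbert transform of an even function is an ordinary integral. -/
lemma hil_of_notMem_tsupport (hρ : Hol ρ) (he : ∀ x, ρ (-x) = ρ x) {x : ℝ} (hx : x ∉ tsupport ρ)
    (hx0 : x ≠ 0) : Integrable (fun y => ρ y * (x ^ 2 - y ^ 2)⁻¹) ∧
      Hil ρ x = x * ∫ y, ρ y * (x ^ 2 - y ^ 2)⁻¹ := by
  obtain ⟨δ, hδ, hball⟩ := Metric.isOpen_iff.1 (isClosed_tsupport ρ).isOpen_compl x hx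
  have h0 : ∀ y, |x - y| < δ → ρ y = 0 := fun y hy =>
    image_eq_zero_of_notMem_tsupport (hball (by rwa [Metric.mem_ball, dist_comm, Real.dist_eq]))
  have hEq : ∀ ε, 0 < ε → ε < δ → ∫ y in {y : ℝ | ε < |x - y|}, ρ y / (x - y)
      = ∫ y, ρ y / (x - y) := by
    intro ε _ hε
    refine setIntegral_eq_integral_of_forall_compl_eq_zero fun y hy => ?_
    rw [mem_ofPred_eq, not_lt] at hy
    rw [h0 y (hy.trans_lt hε), zero_div]
  have hi : Integrable fun y => ρ y / (x - y) := by
    have h1 : Integrable fun y => ρ y * (if |x - y| < δ then 0 else (x - y)⁻¹) := by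
      refine hρ.integrable.mul_bdd (c := δ⁻¹) (Measurable.aestronglyMeasurable ?_) (ae_of_all _ fun y => ?_)
      · exact Measurable.ite (measurableSet_lt (by fun_prop) measurable_const) measurable_const
          (by fun_prop)
      · split_ifs with h
        · simp [hδ.le]
        · rw [norm_inv, Real.norm_eq_abs]
          exact inv_anti₀ hδ (not_lt.1 h)
    refine h1.congr (ae_of_all _ fun y => ?_)
    simp only
    split_ifs with h
    · rw [h0 y h]; simp
    · rw [div_eq_mul_inv]
  have hH : Hil ρ x = ∫ y, ρ y / (x - y) := by
    refine tendsto_nhds_unique (hρ.hasPV x) (tendsto_const_nhds.congr' ?_)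
    filter_upwards [Ioo_mem_nhdsGT hδ] with ε hε
    exact (hEq ε hε.1 hε.2).symm
  have hi2 : Integrable fun y => ρ y / (x + y) := by
    have := hi.comp_neg
    simpa only [he, sub_neg_eq_add] using this
  have hH2 : Hil ρ x = ∫ y, ρ y / (x + y) := by
    rw [hH, ← integral_neg_eq_self (fun y => ρ y / (x - y))]
    simp only [he, sub_neg_eq_add]
  have hpt : ∀ y, ρ y / (x - y) + ρ y / (x + y) = 2 * x * (ρ y * (x ^ 2 - y ^ 2)⁻¹) := by
    intro y
    by_cases hy : ρ y = 0
    · simp [hy]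
    have e1 : x - y ≠ 0 := fun h => hy (h0 y (by rw [h, abs_zero]; exact hδ))
    have e2 : x + y ≠ 0 := fun h => hy (by
      rw [← he]; exact h0 (-y) (by rw [sub_neg_eq_add, h, abs_zero]; exact hδ))
    rw [sq_sub_sq]
    field_simp
    ring
  have h3 : Integrable fun y => 2 * x * (ρ y * (x ^ 2 - y ^ 2)⁻¹) := by
    simp_rw [← hpt]
    exact hi.add hi2
  have h2x : 2 * x ≠ 0 := mul_ne_zero two_ne_zero hx0
  refine ⟨(integrable_const_mul_iff (IsUnit.mk0 _ h2x) _).1 h3, ?_⟩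
  have h4 : 2 * Hil ρ x = 2 * x * ∫ y, ρ y * (x ^ 2 - y ^ 2)⁻¹ := by
    rw [← integral_const_mul]
    simp_rw [← hpt]
    rw [integral_add hi hi2, ← hH, ← hH2]
    ring
  linarith

/-- The support of a non-negative solution has no gap on the positive half-line. -/
lemma no_gap {n : ℕ} (hn : 2 ≤ n) {γ μ : ℝ} (hγ : 0 < γ) (hρ : Hol ρ) (he : ∀ x, ρ (-x) = ρ x)
    (h0 : ∀ x, 0 ≤ ρ x) (hH : ∀ x ∈ tsupport ρ, Hil ρ x = μ * x ^ 1 + γ * x ^ (2 * n - 1))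
    {p q : ℝ} (hp0 : 0 < p) (hpq : p < q) (hp : p ∈ tsupport ρ) (hq : q ∈ tsupport ρ)
    (hgap : ∀ x ∈ Ioo p q, x ∉ tsupport ρ) : False := by
  have hgap' : ∀ x ∈ Ioo p q, ρ x = 0 := fun x hx => image_eq_zero_of_notMem_tsupport (hgap x hx)
  -- In the gap the quotient is the integral of `ρ y / (x² - y²)`. For each `y` in the support the
  -- denominator keeps its sign across the gap, so with `ρ ≥ 0` the integrand does not increase with
  -- `x`.
  have hanti : ∀ x ∈ Ioo p q, ∀ z ∈ Ioo p q, x < z → Hil ρ z / z ≤ Hil ρ x / x := by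
    intro x hx z hz hxz
    have hx0 : 0 < x := hp0.trans hx.1
    have hz0 : 0 < z := hp0.trans hz.1
    obtain ⟨i1, e1⟩ := hil_of_notMem_tsupport hρ he (hgap x hx) hx0.ne'
    obtain ⟨i2, e2⟩ := hil_of_notMem_tsupport hρ he (hgap z hz) hz0.ne'
    rw [e1, e2, mul_div_cancel_left₀ _ hx0.ne', mul_div_cancel_left₀ _ hz0.ne']
    refine integral_mono i2 i1 fun y => ?_
    by_cases hy : ρ y = 0
    · simp [hy]
    refine mul_le_mul_of_nonneg_left ?_ (h0 y)
    have hy' : |y| ∉ Ioo p q := fun h => hy (by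
      rcases abs_choice y with h' | h' <;> rw [h'] at h
      · exact hgap' y h
      · rw [← he]; exact hgap' _ h)
    have hsq : y ^ 2 = |y| ^ 2 := (sq_abs y).symm
    rw [hsq]
    have hy0 := abs_nonneg y
    rcases le_or_gt |y| p with h | h
    · refine inv_anti₀ ?_ ?_
      · nlinarith [hx.1]
      · nlinarith
    · have hyq : q ≤ |y| := not_lt.1 fun h' => hy' ⟨h, h'⟩
      rw [← neg_le_neg_iff, ← inv_neg, ← inv_neg]
      refine inv_anti₀ ?_ ?_
      · nlinarith [hz.2]
      · nlinarith
  have hc := hρ.continuous_hil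
  have hcd : ∀ x, 0 < x → ContinuousAt (fun x => Hil ρ x / x) x := fun x hx =>
    hc.continuousAt.div continuousAt_id hx.ne'
  have h1 : ∀ z ∈ Ioo p q, Hil ρ z / z ≤ Hil ρ p / p := by
    intro z hz
    have ht := (hcd p hp0).tendsto.mono_left (nhdsWithin_le_nhds (s := Ioi p))
    refine ge_of_tendsto ht ?_
    filter_upwards [Ioo_mem_nhdsGT hz.1] with x hx
    exact hanti x ⟨hx.1, hx.2.trans hz.2⟩ z hz hx.2
  have h2 : Hil ρ q / q ≤ Hil ρ p / p := by
    have ht := (hcd q (hp0.trans hpq)).tendsto.mono_left (nhdsWithin_le_nhds (s := Iio q))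
    refine le_of_tendsto ht ?_
    filter_upwards [Ioo_mem_nhdsLT hpq] with z hz
    exact h1 z hz
  have hval : ∀ x, 0 < x → x ∈ tsupport ρ → Hil ρ x / x = μ + γ * x ^ (2 * n - 2) := by
    intro x hx hxs
    rw [hH x hxs, show 2 * n - 1 = 2 * n - 2 + 1 by omega, pow_succ]
    field_simp
    ring
  -- At the ends of the gap the quotient is `μ + γ x^(2n-2)`, strictly larger at `q` than at `p`.
  rw [hval p hp0 hp, hval q (hp0.trans hpq) hq] at h2
  have : p ^ (2 * n - 2) < q ^ (2 * n - 2) := pow_lt_pow_left₀ hpq hp0.le (by omega)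
  nlinarith

/-- The set where a continuous function is nonzero is open and a finite set has empty interior; this
excludes degenerate cuts. -/
lemma not_support_subset_finite (hc : Continuous ρ) (hm : ∫ x, ρ x = 1) {s : Set ℝ} (hs : s.Finite) :
    ¬ Function.support ρ ⊆ s := by
  intro h
  have h1 : Function.support ρ ⊆ interior s := interior_maximal h hc.isOpen_support
  have h2 : interior s = ∅ := interior_eq_empty_iff_dense_compl.2 (hs.countable.dense_compl ℝ)
  rw [h2, subset_empty_iff, Function.support_eq_empty_iff] at h1
  simp [h1] at hm

/-- A non-negative solution is a single-cut or a two-cut solution. -/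
theorem IsSaddleDensity.cases {n : ℕ} (hn : 2 ≤ n) {v T μ : ℝ} (hv : 0 < v) (hT : 0 < T)
    (h : IsSaddleDensity (potential n v) T μ ρ) :
    (∃ a, IsSingleCut (potential n v) T a μ ρ) ∨
      ∃ a b, IsTwoCut (potential n v) T a b μ ρ := by
  have hn0 : (0 : ℝ) < n := by exact_mod_cast (by omega : 0 < n)
  have hγ : 0 < n * v / T := by positivity
  obtain ⟨h, hpos⟩ := h
  have hc := h.hol.continuous
  set S := tsupport ρ with hS
  have hScl : IsClosed S := isClosed_tsupport ρ
  have hScpt : IsCompact S := h.compact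
  have hsub : Function.support ρ ⊆ S := subset_tsupport ρ
  have hneg : ∀ x ∈ S, -x ∈ S := by
    have : S ⊆ (fun x => -x) ⁻¹' S := closure_minimal (fun x hx => hsub (by
      rwa [Function.mem_support, h.even])) (hScl.preimage continuous_neg)
    exact this
  have habs : ∀ x ∈ S, |x| ∈ S := fun x hx => by
    rcases abs_choice x with h' | h' <;> rw [h']
    exacts [hx, hneg x hx]
  have hne : ∃ x, x ∈ S := by
    by_contra hcon
    push Not at hcon
    exact not_support_subset_finite hc h.mass finite_empty fun x hx => (hcon x (hsub hx)).elim
  have hSp : IsCompact (S ∩ Ici 0) := hScpt.inter_right isClosed_Ici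
  have hSne : (S ∩ Ici 0).Nonempty := hne.imp' (fun x => |x|) fun x hx => ⟨habs x hx, abs_nonneg x⟩
  obtain ⟨a, ⟨haS, ha0⟩, ha⟩ := hSp.exists_isLeast hSne
  obtain ⟨b, ⟨hbS, hb0⟩, hb⟩ := hSp.exists_isGreatest hSne
  have ha0 : 0 ≤ a := ha0
  have hab : a ≤ b := ha ⟨hbS, hb0⟩
  have hmem : ∀ x ∈ S, |x| ∈ Icc a b := fun x hx =>
    ⟨ha ⟨habs x hx, abs_nonneg x⟩, hb ⟨habs x hx, abs_nonneg x⟩⟩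
  have hfull : ∀ z ∈ Icc a b, z ∈ S := by
    intro z hz
    by_contra hzS
    obtain ⟨p, ⟨⟨hpS, hp0⟩, hpz⟩, hp⟩ := (hSp.inter_right (isClosed_Iic (a := z))).exists_isGreatest
      ⟨a, ⟨haS, ha0⟩, hz.1⟩
    obtain ⟨q, ⟨⟨hqS, hq0⟩, hqz⟩, hq⟩ := (hSp.inter_right (isClosed_Ici (a := z))).exists_isLeast
      ⟨b, ⟨hbS, hb0⟩, hz.2⟩
    have hp0 : 0 ≤ p := hp0
    have hpz' : p < z := lt_of_le_of_ne hpz fun h => hzS (h ▸ hpS)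
    have hqz' : z < q := lt_of_le_of_ne hqz fun h => hzS (h ▸ hqS)
    have hgap : ∀ x ∈ Ioo p q, x ∉ S := by
      intro x hx hxS
      rcases le_total x z with hxz | hxz
      · exact absurd (hp ⟨⟨hxS, hp0.trans hx.1.le⟩, hxz⟩) (not_le.2 hx.1)
      · exact absurd (hq ⟨⟨hxS, hp0.trans hx.1.le⟩, hxz⟩) (not_le.2 hx.2)
    rcases hp0.lt_or_eq with hp' | hp'
    · exact no_gap hn hγ h.hol h.even hpos (fun x hx => h.hil_eq hx) hp' (hpz'.trans hqz') hpS hqS hgap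
    -- A gap starting at the origin is not covered by `no_gap`. The origin would then be an isolated
    -- point of the support, which is the closure of an open set.
    · have hq' : 0 < q := by linarith
      have hsub0 : Function.support ρ ∩ Ioo (-q) q ⊆ {0} := by
        rintro x ⟨hx, hxq⟩
        by_contra hx0
        refine hgap |x| ⟨?_, abs_lt.2 hxq⟩ (habs x (hsub hx))
        rw [← hp']
        exact abs_pos.2 hx0
      have hopen : Function.support ρ ∩ Ioo (-q) q ⊆ interior {0} :=
        interior_maximal hsub0 (hc.isOpen_support.inter isOpen_Ioo)
      rw [interior_singleton, subset_empty_iff] at hopen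
      obtain ⟨y, hy1, hy2⟩ := mem_closure_iff.1 (show (0 : ℝ) ∈ closure (Function.support ρ) by
        rw [hp']; exact hpS) _ isOpen_Ioo (show (0 : ℝ) ∈ Ioo (-q) q from ⟨by linarith, hq'⟩)
      exact (hopen ▸ ⟨hy2, hy1⟩ : y ∈ (∅ : Set ℝ))
  have hiff : ∀ x, x ∈ S ↔ |x| ∈ Icc a b := by
    refine fun x => ⟨hmem x, fun hx => ?_⟩
    have h1 := hfull _ hx
    rcases abs_choice x with h' | h' <;> rw [h'] at h1
    · exact h1
    · simpa using hneg _ h1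
  rcases ha0.lt_or_eq with ha' | ha'
  · right
    refine ⟨a, b, ha', lt_of_le_of_ne hab ?_, ?_, h⟩
    · rintro rfl
      refine not_support_subset_finite hc h.mass (toFinite {a, -a}) fun x hx => ?_
      have h1 := (hiff x).1 (hsub hx)
      rw [Icc_self, mem_singleton_iff] at h1
      rcases abs_choice x with h' | h' <;> rw [h'] at h1
      · left; exact h1
      · right; rw [mem_singleton_iff, ← h1, neg_neg]
    · ext x
      rw [← hS, hiff]
      rcases le_total 0 x with hx | hx
      · rw [abs_of_nonneg hx]
        exact ⟨Or.inr, by rintro (h | h); exacts [⟨by linarith [h.2], by linarith [h.2]⟩, h]⟩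
      · rw [abs_of_nonpos hx]
        refine ⟨fun h => Or.inl ⟨by linarith [h.2], by linarith [h.1]⟩, ?_⟩
        rintro (h | h)
        exacts [⟨by linarith [h.2], by linarith [h.1]⟩, ⟨by linarith [h.1], by linarith [h.1]⟩]
  · left
    refine ⟨b, lt_of_le_of_ne hb0 fun hb' => ?_, ?_, h⟩
    · refine not_support_subset_finite hc h.mass (toFinite {0}) fun x hx => ?_
      have h1 := (hiff x).1 (hsub hx)
      rw [← ha', ← hb', Icc_self, mem_singleton_iff] at h1
      exact abs_eq_zero.1 h1
    · ext x
      rw [← hS, hiff, ← ha', mem_Icc, mem_Icc, ← abs_le]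
      exact ⟨fun h => h.2, fun h => ⟨abs_nonneg x, h⟩⟩

end SphericalMatrix

/-! ### Monotonicity of the temperature along the two-cut branch. -/

namespace SphericalMatrix

lemma mom_rec' (u : ℝ) (k : ℕ) : (k + 1) * mom 1 u (k + 1) =
    (2 * k + 1) * mom 1 u k - k * (1 - u ^ 2) * mom 1 u (k - 1) := by
  rcases k with _ | k
  · simp [mom_zero, mom_one]
  · have := mom_rec 1 u k
    rw [Nat.add_sub_cancel]
    push_cast
    linear_combination this

/-- Formally, the integrand has derivative `k cos θ (1 + u cos θ)^(k-1)` and `u cos θ` is `(1 + u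
cos θ) - 1`. Induction along the recurrence replaces differentiation under the integral. -/
lemma hasDerivAt_mom {u : ℝ} (hu : u ≠ 0) (k : ℕ) :
    HasDerivAt (fun u => mom 1 u k) (k * (mom 1 u k - mom 1 u (k - 1)) / u) u := by
  induction k using Nat.twoStepInduction with
  | zero => simpa [mom_zero] using hasDerivAt_const u (1 : ℝ)
  | one => simpa [mom_zero, mom_one] using hasDerivAt_const u (1 : ℝ)
  | more k h0 h1 =>
    have e : (fun u => mom 1 u (k + 2)) = fun u => ((2 * k + 3) * mom 1 u (k + 1)
        - (k + 1) * ((1 - u ^ 2) * mom 1 u k)) / (k + 2) := by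
      ext u
      rw [eq_div_iff (by positivity)]
      have := mom_rec 1 u k
      linear_combination this
    have hd : HasDerivAt (fun u : ℝ => 1 - u ^ 2) (-(2 * u)) u := by
      simpa using (hasDerivAt_pow 2 u).const_sub 1
    have h2 := ((h1.const_mul (2 * (k : ℝ) + 3)).sub ((hd.mul h0).const_mul ((k : ℝ) + 1))).div_const
      ((k : ℝ) + 2)
    rw [e]
    refine h2.congr_deriv ?_
    have r1 := mom_rec' u k
    have r2 := mom_rec' u (k + 1)
    simp only [Nat.add_sub_cancel, show k + 2 - 1 = k + 1 by omega] at *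
    push_cast at *
    rw [show k + 1 + 1 = k + 2 by rfl] at r2
    have hk : (k : ℝ) + 2 ≠ 0 := by positivity
    rw [div_eq_iff hk]
    field_simp
    linear_combination (k + 1 : ℝ) * r1 - (k + 2 : ℝ) * r2

lemma continuous_mom (k : ℕ) : Continuous fun u => mom 1 u k := by
  induction k using Nat.twoStepInduction with
  | zero => simpa [mom_zero] using continuous_const
  | one => simpa [mom_one] using continuous_const
  | more k h0 h1 =>
    have e : (fun u => mom 1 u (k + 2)) = fun u => ((2 * k + 3) * mom 1 u (k + 1)
        - (k + 1) * ((1 - u ^ 2) * mom 1 u k)) / (k + 2) := by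
      ext u
      rw [eq_div_iff (by positivity)]
      have := mom_rec 1 u k
      linear_combination this
    rw [e]
    fun_prop

lemma mom_mono {u : ℝ} (h0 : 0 < u) (h1 : u ≤ 1) (k : ℕ) : mom 1 u k ≤ mom 1 u (k + 1) := by
  induction k with
  | zero => simp [mom_zero, mom_one]
  | succ k ih =>
    have h := mom_rec 1 u k
    have hp := mom_pos h0 h1 k
    have hk : (0 : ℝ) < k + 2 := by positivity
    have h3 : 0 ≤ ((k : ℝ) + 1) * (mom 1 u (k + 1) - mom 1 u k + u ^ 2 * mom 1 u k) := by
      have : 0 ≤ u ^ 2 * mom 1 u k := by positivity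
      have : 0 ≤ mom 1 u (k + 1) - mom 1 u k := by linarith
      positivity
    have h4 : ((k : ℝ) + 2) * mom 1 u (k + 1) ≤ (k + 2) * mom 1 u (k + 2) := by nlinarith
    exact le_of_mul_le_mul_left h4 hk

lemma mom_succ_lt {u : ℝ} (h0 : 0 < u) (h1 : u ≤ 1) (k : ℕ) :
    mom 1 u (k + 1) < (1 + u) * mom 1 u k := by
  have h := integral_arcsine_combination (c := 1) (r := u) (1 + u) (-1) 0 k (k + 1) 0
  have hpos : 0 < ∫ θ in (0 : ℝ)..Real.pi, ((1 + u) * (1 + u * Real.cos θ) ^ k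
      + (-1) * (1 + u * Real.cos θ) ^ (k + 1) + 0 * (1 + u * Real.cos θ) ^ 0) := by
    refine intervalIntegral.intervalIntegral_pos_of_pos_on
      (Continuous.intervalIntegrable (by fun_prop) _ _) (fun θ hθ => ?_) Real.pi_pos
    have c1 : -1 < Real.cos θ := by
      rw [← Real.cos_pi]
      exact Real.cos_lt_cos_of_nonneg_of_le_pi hθ.1.le le_rfl hθ.2
    have c2 : Real.cos θ < 1 := by
      rw [← Real.cos_zero]
      exact Real.cos_lt_cos_of_nonneg_of_le_pi le_rfl hθ.2.le hθ.1
    have hY : 0 < 1 + u * Real.cos θ := by nlinarith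
    have e : (1 + u) * (1 + u * Real.cos θ) ^ k + (-1) * (1 + u * Real.cos θ) ^ (k + 1)
        + 0 * (1 + u * Real.cos θ) ^ 0 = (1 + u * Real.cos θ) ^ k * (u * (1 - Real.cos θ)) := by ring
    rw [e]
    have : 0 < 1 - Real.cos θ := by linarith
    positivity
  rw [h] at hpos
  have := pos_of_mul_pos_right hpos Real.pi_pos.le
  linarith

variable {n : ℕ} {u : ℝ}

/-- Two adjacent moments, called `P` and `Q` below, generate everything: the quantities `D`, `G` and
the discriminant are polynomials in `P`, `Q` and `u`, which makes the derivative formulas rational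
identities. -/
def pP (n : ℕ) (u : ℝ) : ℝ := mom 1 u (n - 1)

def pQ (n : ℕ) (u : ℝ) : ℝ := mom 1 u (n - 2)

/-- `n / (n - 1)` times the difference of the moments of order `n` and `n - 1`. -/
def pD (n : ℕ) (u : ℝ) : ℝ := pP n u - (1 - u ^ 2) * pQ n u

def pG (n : ℕ) (u : ℝ) : ℝ := 2 * pD n u + u ^ 2 * pP n u

/-- The discriminant that governs the monotonicity of the temperature. -/
def pDelta (n : ℕ) (u : ℝ) : ℝ := u ^ 2 * pQ n u ^ 2 - (pP n u - pQ n u) ^ 2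

/-- The center of the cut of the two-cut solution with radius to center ratio `u`. -/
def cen (n : ℕ) (u : ℝ) : ℝ := (n + 1) / n * (2 * pD n u / pG n u)

/-- The temperature divided by `n v` of the two-cut solution. -/
def tauTwo (n : ℕ) (u : ℝ) : ℝ := cen n u ^ n * ((n - 1) / n * pD n u)

lemma pD_eq (hn : 2 ≤ n) (u : ℝ) : ((n : ℝ) - 1) * pD n u = n * (mom 1 u n - pP n u) := by
  obtain ⟨m, rfl⟩ : ∃ m, n = m + 2 := ⟨n - 2, by omega⟩
  have := mom_rec 1 u m
  simp only [pD, pP, pQ, Nat.add_sub_cancel, show m + 2 - 1 = m + 1 by omega]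
  push_cast
  linear_combination -this

lemma pP_pos (h0 : 0 < u) (h1 : u ≤ 1) : 0 < pP n u := mom_pos h0 h1 _

lemma pQ_pos (h0 : 0 < u) (h1 : u ≤ 1) : 0 < pQ n u := mom_pos h0 h1 _

lemma pQ_le_pP (hn : 2 ≤ n) (h0 : 0 < u) (h1 : u ≤ 1) : pQ n u ≤ pP n u := by
  obtain ⟨m, rfl⟩ : ∃ m, n = m + 2 := ⟨n - 2, by omega⟩
  exact mom_mono h0 h1 m

lemma pP_lt (hn : 2 ≤ n) (h0 : 0 < u) (h1 : u ≤ 1) : pP n u < (1 + u) * pQ n u := by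
  obtain ⟨m, rfl⟩ : ∃ m, n = m + 2 := ⟨n - 2, by omega⟩
  exact mom_succ_lt h0 h1 m

lemma pD_pos (hn : 2 ≤ n) (h0 : 0 < u) (h1 : u ≤ 1) : 0 < pD n u := by
  have h2 := pQ_le_pP hn h0 h1
  have h3 := pQ_pos (n := n) h0 h1
  have : 0 < u ^ 2 * pQ n u := by positivity
  unfold pD
  linarith

lemma pG_pos (hn : 2 ≤ n) (h0 : 0 < u) (h1 : u ≤ 1) : 0 < pG n u := by
  have := pD_pos hn h0 h1
  have := pP_pos (n := n) h0 h1
  unfold pG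
  positivity

/-- A difference of squares; the bounds `Q ≤ P < (1 + u) Q` on consecutive moments say exactly that
`0 ≤ P - Q < u Q`. -/
lemma pDelta_pos (hn : 2 ≤ n) (h0 : 0 < u) (h1 : u ≤ 1) : 0 < pDelta n u := by
  have h2 := pQ_le_pP hn h0 h1
  have h3 := pQ_pos (n := n) h0 h1
  have h4 := pP_lt hn h0 h1
  have e : pDelta n u = (u * pQ n u - (pP n u - pQ n u)) * (u * pQ n u + (pP n u - pQ n u)) := by
    unfold pDelta; ring
  rw [e]
  have : 0 < u * pQ n u := by positivity
  apply mul_pos <;> linarith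

lemma cen_pos (hn : 2 ≤ n) (h0 : 0 < u) (h1 : u ≤ 1) : 0 < cen n u := by
  have := pD_pos hn h0 h1
  have := pG_pos hn h0 h1
  have : (0 : ℝ) < n := by exact_mod_cast (by omega : 0 < n)
  unfold cen
  positivity

lemma one_lt_cast (hn : 2 ≤ n) : (1 : ℝ) < n := by exact_mod_cast (by omega : 1 < n)

lemma tauTwo_pos (hn : 2 ≤ n) (h0 : 0 < u) (h1 : u ≤ 1) : 0 < tauTwo n u := by
  have := pD_pos hn h0 h1
  have := cen_pos hn h0 h1
  have hn1 := one_lt_cast hn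
  have : (0 : ℝ) < n - 1 := by linarith
  have : (0 : ℝ) < n := by linarith
  unfold tauTwo
  positivity

lemma hasDerivAt_pP (hn : 2 ≤ n) (hu : u ≠ 0) :
    HasDerivAt (pP n) ((n - 1) * (pP n u - pQ n u) / u) u := by
  obtain ⟨m, rfl⟩ : ∃ m, n = m + 2 := ⟨n - 2, by omega⟩
  have := hasDerivAt_mom hu (m + 1)
  refine this.congr_deriv ?_
  simp only [pP, pQ, Nat.add_sub_cancel, show m + 2 - 1 = m + 1 by omega]
  push_cast
  ring

lemma hasDerivAt_pD (hn : 2 ≤ n) (hu : u ≠ 0) : HasDerivAt (pD n) (n * u * pQ n u) u := by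
  have hn1 := one_lt_cast hn
  have hn0 : (n : ℝ) - 1 ≠ 0 := by linarith
  have e : pD n = fun u => n * (mom 1 u n - pP n u) / (n - 1) := by
    ext u
    rw [eq_div_iff hn0, ← pD_eq hn]
    ring
  have h := (((hasDerivAt_mom hu n).sub (hasDerivAt_pP hn hu)).const_mul (n : ℝ)).div_const
    ((n : ℝ) - 1)
  rw [e]
  refine h.congr_deriv ?_
  have h2 := pD_eq hn u
  have h3 : mom 1 u n - mom 1 u (n - 1) = ((n : ℝ) - 1) * (pP n u - (1 - u ^ 2) * pQ n u) / n := by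
    rw [eq_div_iff (by linarith)]
    rw [pD, pP] at h2
    rw [pP]
    linarith
  rw [h3]
  have : (n : ℝ) ≠ 0 := by linarith
  field_simp
  ring

lemma hasDerivAt_pG (hn : 2 ≤ n) (hu : u ≠ 0) :
    HasDerivAt (pG n) ((n + 1) * u * (pP n u + pQ n u)) u := by
  have h := ((hasDerivAt_pD hn hu).const_mul 2).add ((hasDerivAt_pow 2 u).mul (hasDerivAt_pP hn hu))
  refine h.congr_deriv ?_
  field_simp
  ring

/-- The derivative of `cen`. -/
def cenDeriv (n : ℕ) (u : ℝ) : ℝ :=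
  (n + 1) / n * (2 * u * (pD n u * ((n - 1) * pQ n u - (n + 1) * pP n u)
    + n * u ^ 2 * pP n u * pQ n u) / pG n u ^ 2)

/-- The derivative of `tauTwo`. -/
def tauTwoDeriv (n : ℕ) (u : ℝ) : ℝ :=
  cen n u ^ (n - 1) * ((n - 1) * ((n + 1) ^ 2 / n) * (2 * pD n u * u / pG n u ^ 2) * pDelta n u)

lemma hasDerivAt_cen (hn : 2 ≤ n) (h0 : 0 < u) (h1 : u ≤ 1) :
    HasDerivAt (cen n) (cenDeriv n u) u := by
  have hG := pG_pos hn h0 h1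
  have h := ((((hasDerivAt_pD hn h0.ne').const_mul 2).div (hasDerivAt_pG hn h0.ne') hG.ne')).const_mul
    (((n : ℝ) + 1) / n)
  refine h.congr_deriv ?_
  rw [cenDeriv]
  congr 2
  rw [pG]
  ring

lemma hasDerivAt_tauTwo (hn : 2 ≤ n) (h0 : 0 < u) (h1 : u ≤ 1) :
    HasDerivAt (tauTwo n) (tauTwoDeriv n u) u := by
  have hG := pG_pos hn h0 h1
  have hn1 := one_lt_cast hn
  have hn0 : (n : ℝ) ≠ 0 := by linarith
  have h := ((hasDerivAt_cen hn h0 h1).pow n).mul ((hasDerivAt_pD hn h0.ne').const_mul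
    (((n : ℝ) - 1) / n))
  refine h.congr_deriv ?_
  have hp : cen n u ^ n = cen n u ^ (n - 1) * cen n u := by
    rw [← pow_succ]; congr 1; omega
  simp only [Pi.pow_apply]
  rw [hp, tauTwoDeriv]
  -- The power of the center is a common factor; what remains is a polynomial identity in `P`, `Q`
  -- and `u` once `G` and `D` are expanded.
  generalize cen n u ^ (n - 1) = z
  rw [cenDeriv, cen]
  have e1 : pG n u = 2 * pD n u + u ^ 2 * pP n u := rfl
  have e2 : pD n u = pP n u - (1 - u ^ 2) * pQ n u := rfl
  field_simp
  rw [pDelta, e1, e2]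
  ring

lemma tauTwoDeriv_pos (hn : 2 ≤ n) (h0 : 0 < u) (h1 : u ≤ 1) : 0 < tauTwoDeriv n u := by
  have := pD_pos hn h0 h1
  have := cen_pos hn h0 h1
  have := pG_pos hn h0 h1
  have := pDelta_pos hn h0 h1
  have hn1 := one_lt_cast hn
  have : (0 : ℝ) < n - 1 := by linarith
  have : (0 : ℝ) < n := by linarith
  unfold tauTwoDeriv
  positivity

end SphericalMatrix

/-! ### Temperature parametrizations of the two branches. -/

namespace SphericalMatrix

variable {n : ℕ} {u c y γ μ : ℝ}

/-- A function with positive derivative on an interval has a differentiable inverse. -/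
lemma exists_inverse {φ φ' : ℝ → ℝ} {l h : ℝ} {I : Set ℝ} (hI : IsOpen I)
    (hd : ∀ x ∈ Ioo l h, HasDerivAt φ (φ' x) x) (hpos : ∀ x ∈ Ioo l h, 0 < φ' x)
    (himg : φ '' Ioo l h = I) :
    ∃ ψ : ℝ → ℝ, ∀ t ∈ I, ψ t ∈ Ioo l h ∧ φ (ψ t) = t ∧ (∀ x ∈ Ioo l h, φ x = t → x = ψ t) ∧
      HasDerivAt ψ (φ' (ψ t))⁻¹ t := by
  have hmono : StrictMonoOn φ (Ioo l h) := by
    refine strictMonoOn_of_deriv_pos (convex_Ioo l h)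
      (fun x hx => (hd x hx).continuousAt.continuousWithinAt) fun x hx => ?_
    rw [interior_Ioo] at hx
    rw [(hd x hx).deriv]
    exact hpos x hx
  have hex : ∀ t ∈ I, ∃ x, x ∈ Ioo l h ∧ φ x = t := fun t ht => by
    rw [← himg] at ht
    exact ht
  choose! ψ hψ1 hψ2 using hex
  have huniq : ∀ t ∈ I, ∀ x ∈ Ioo l h, φ x = t → x = ψ t := fun t ht x hx e =>
    hmono.injOn hx (hψ1 t ht) (e.trans (hψ2 t ht).symm)
  have hψm : StrictMonoOn ψ I := fun s hs t ht hst => by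
    by_contra hle
    have := hmono.monotoneOn (hψ1 t ht) (hψ1 s hs) (not_lt.1 hle)
    rw [hψ2 t ht, hψ2 s hs] at this
    linarith
  refine ⟨ψ, fun t ht => ⟨hψ1 t ht, hψ2 t ht, huniq t ht, ?_⟩⟩
  refine HasDerivAt.of_local_left_inverse ?_ (hd _ (hψ1 t ht)) (hpos _ (hψ1 t ht)).ne' ?_
  · refine hψm.continuousAt_of_image_mem_nhds (hI.mem_nhds ht) ?_
    refine mem_of_superset (Ioo_mem_nhds (hψ1 t ht).1 (hψ1 t ht).2) fun x hx => ?_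
    have hx' : φ x ∈ I := himg ▸ mem_image_of_mem φ hx
    exact ⟨φ x, hx', (huniq _ hx' x hx rfl).symm⟩
  · exact mem_of_superset (hI.mem_nhds ht) fun s hs => hψ2 s hs

lemma invFunOn_spec {φ φ' : ℝ → ℝ} {l h : ℝ} {I : Set ℝ} (hI : IsOpen I)
    (hd : ∀ x ∈ Ioo l h, HasDerivAt φ (φ' x) x) (hpos : ∀ x ∈ Ioo l h, 0 < φ' x)
    (himg : φ '' Ioo l h = I) {t : ℝ} (ht : t ∈ I) :
    Function.invFunOn φ (Ioo l h) t ∈ Ioo l h ∧ φ (Function.invFunOn φ (Ioo l h) t) = t ∧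
      (∀ x ∈ Ioo l h, φ x = t → x = Function.invFunOn φ (Ioo l h) t) ∧
      HasDerivAt (Function.invFunOn φ (Ioo l h)) (φ' (Function.invFunOn φ (Ioo l h) t))⁻¹ t := by
  obtain ⟨ψ, hψ⟩ := exists_inverse hI hd hpos himg
  have e : ∀ s ∈ I, Function.invFunOn φ (Ioo l h) s = ψ s := fun s hs => by
    have hex : ∃ x ∈ Ioo l h, φ x = s := by rw [← himg] at hs; exact hs
    exact (hψ s hs).2.2.1 _ (Function.invFunOn_mem hex) (Function.invFunOn_eq hex)
  rw [e t ht]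
  refine ⟨(hψ t ht).1, (hψ t ht).2.1, (hψ t ht).2.2.1, (hψ t ht).2.2.2.congr_of_eventuallyEq ?_⟩
  exact mem_of_superset (hI.mem_nhds ht) e

/-- By homogeneity in the center, the first moment is the mass times `c / cen n u`. With unit mass
the sphere condition fixes the center, and the mass condition then fixes the temperature. -/
lemma twoCutCond_iff (hn : 2 ≤ n) (h0 : 0 < u) (h1 : u ≤ 1) (hγ : 0 < γ) (hc : 0 < c) :
    TwoCutCond n γ c (c * u) μ ↔
      c = cen n u ∧ γ * tauTwo n u = 1 ∧ μ = -(γ * (c ^ (n - 1) * pP n u)) := by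
  have hn1 := one_lt_cast hn
  have hD := pD_pos hn h0 h1
  have hG := pG_pos hn h0 h1
  have hcp : c ^ n = c * c ^ (n - 1) := by
    rw [← pow_succ']; congr 1; omega
  have e1 := pD_eq hn u
  have e2 := mom_rec' u n
  have hn0 : (n : ℝ) ≠ 0 := by linarith
  have hnp : (n : ℝ) + 1 ≠ 0 := by linarith
  have hnm : (n : ℝ) - 1 ≠ 0 := by linarith
  have f1 : mom 1 u n = pP n u + (n - 1) / n * pD n u := by
    field_simp
    linarith
  have f2 : mom 1 u (n + 1) = mom 1 u n + u ^ 2 / 2 * pP n u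
      + (n - 1) * pG n u / (2 * (n + 1)) := by
    rw [f1] at e2 ⊢
    have e3 : pP n u = mom 1 u (n - 1) := rfl
    rw [← e3] at e2
    have : mom 1 u (n + 1) = ((2 * n + 1) * (pP n u + (n - 1) / n * pD n u)
        - n * (1 - u ^ 2) * pP n u) / (n + 1) := by
      rw [eq_div_iff hnp]; linarith
    rw [this, pG]
    field_simp
    ring
  have g1 : γ * (mom c (c * u) n - c * mom c (c * u) (n - 1)) =
      γ * (c ^ n * ((n - 1) / n * pD n u)) := by
    rw [mom_scale, mom_scale, f1, hcp, pP]
    ring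
  have g2 : γ * (mom c (c * u) (n + 1) - c * mom c (c * u) n
      - (c * u) ^ 2 / 2 * mom c (c * u) (n - 1)) =
      γ * (c ^ n * ((n - 1) / n * pD n u)) * (c / cen n u) := by
    rw [mom_scale, mom_scale, mom_scale, f2, pow_succ, hcp, pP, cen]
    field_simp
    ring
  have g3 : γ * mom c (c * u) (n - 1) = γ * (c ^ (n - 1) * pP n u) := by
    rw [mom_scale, pP]
  rw [TwoCutCond, g1, g2, g3]
  have hcen := cen_pos hn h0 h1
  constructor
  · rintro ⟨a1, a2, a3⟩
    rw [a2, one_mul, div_eq_one_iff_eq hcen.ne'] at a3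
    refine ⟨a3, ?_, a1⟩
    rw [tauTwo, ← a3, a2]
  · rintro ⟨a1, a2, a3⟩
    rw [tauTwo, ← a1] at a2
    refine ⟨a3, a2, ?_⟩
    rw [a2, one_mul, ← a1, div_self hc.ne']

/-- The critical temperature divided by `n v`. -/
def tauC (n : ℕ) : ℝ := cb n * (4 * (n + 1) / (3 * n)) ^ n * ((n - 1) / (2 * n - 1))

/-- The temperature divided by `n v` of the single-cut solution on `[-√y, √y]`. -/
def tauOne (n : ℕ) (y : ℝ) : ℝ := cb n * y ^ (n + 1) * (n - 1) / ((n + 1) * (4 - y))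

def tauOneDeriv (n : ℕ) (y : ℝ) : ℝ := tauOne n y * (4 * n + 4 - n * y) / (y * (4 - y))

/-- The squared half-width of the single cut at the critical temperature. -/
def yC (n : ℕ) : ℝ := 4 * (n + 1) / (3 * n)

lemma tauC_pos (hn : 2 ≤ n) : 0 < tauC n := by
  have hn1 := one_lt_cast hn
  have := cb_pos n
  have : (0 : ℝ) < n - 1 := by linarith
  have : (0 : ℝ) < 2 * n - 1 := by linarith
  unfold tauC
  positivity

lemma yC_mem (hn : 2 ≤ n) : yC n ∈ Ioo 0 4 := by
  have hn1 := one_lt_cast hn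
  constructor
  · unfold yC; positivity
  · rw [yC, div_lt_iff₀ (by linarith)]; linarith

lemma tauOne_yC (hn : 2 ≤ n) : tauOne n (yC n) = tauC n := by
  have hn1 := one_lt_cast hn
  have h4 : (4 : ℝ) - yC n = 4 * (2 * n - 1) / (3 * n) := by
    rw [yC]; field_simp; ring
  have : (2 : ℝ) * n - 1 ≠ 0 := by linarith
  have : (n : ℝ) + 1 ≠ 0 := by linarith
  have : (n : ℝ) ≠ 0 := by linarith
  rw [tauOne, h4, tauC, pow_succ, ← yC]
  generalize yC n ^ n = z
  rw [yC]
  field_simp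

lemma tauOne_pos (hn : 2 ≤ n) (hy : y ∈ Ioo 0 4) : 0 < tauOne n y := by
  have hn1 := one_lt_cast hn
  have := cb_pos n
  have : (0 : ℝ) < n - 1 := by linarith
  have : (0 : ℝ) < 4 - y := by linarith [hy.2]
  have := hy.1
  unfold tauOne
  positivity

lemma tauOneDeriv_pos (hn : 2 ≤ n) (hy : y ∈ Ioo 0 4) : 0 < tauOneDeriv n y := by
  have hn1 := one_lt_cast hn
  have := tauOne_pos hn hy
  have : (0 : ℝ) < 4 - y := by linarith [hy.2]
  have := hy.1
  have : (0 : ℝ) < 4 * n + 4 - n * y := by nlinarith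
  unfold tauOneDeriv
  positivity

lemma hasDerivAt_tauOne (hy : y ∈ Ioo 0 4) :
    HasDerivAt (tauOne n) (tauOneDeriv n y) y := by
  have h4 : (4 : ℝ) - y ≠ 0 := by linarith [hy.2]
  have hy0 := hy.1.ne'
  have hnp : (n : ℝ) + 1 ≠ 0 := by positivity
  have hd : HasDerivAt (fun y : ℝ => 4 - y) (-1) y := by
    simpa using (hasDerivAt_id y).const_sub 4
  have h := (((hasDerivAt_pow (n + 1) y).const_mul (cb n)).mul_const ((n : ℝ) - 1)).div
    (hd.const_mul ((n : ℝ) + 1)) (mul_ne_zero hnp h4)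
  refine h.congr_deriv ?_
  rw [tauOneDeriv, tauOne, Nat.add_sub_cancel, pow_succ]
  generalize y ^ n = z
  push_cast
  field_simp
  ring

lemma image_tauOne (hn : 2 ≤ n) : tauOne n '' Ioo 0 4 = Ioi 0 := by
  have hn1 := one_lt_cast hn
  have hcb := cb_pos n
  ext t
  constructor
  · rintro ⟨y, hy, rfl⟩
    exact tauOne_pos hn hy
  · intro ht
    rw [mem_Ioi] at ht
    -- The denominator `4 - y` is cleared first, so that the intermediate value theorem applies on
    -- all of `[0, 4]` despite the pole.
    have hc : Continuous fun y : ℝ => cb n * y ^ (n + 1) * (n - 1) - t * ((n + 1) * (4 - y)) := by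
      fun_prop
    have h := intermediate_value_Ioo (show (0 : ℝ) ≤ 4 by norm_num) hc.continuousOn
    have h0 : (0 : ℝ) ∈ Ioo (cb n * (0 : ℝ) ^ (n + 1) * (n - 1) - t * ((n + 1) * (4 - 0)))
        (cb n * (4 : ℝ) ^ (n + 1) * (n - 1) - t * ((n + 1) * (4 - 4))) := by
      have h2 : (0 : ℝ) < n - 1 := by linarith
      constructor
      · have : 0 < t * ((n + 1) * (4 - 0)) := by positivity
        simp only [ne_eq, Nat.add_eq_zero_iff, one_ne_zero, and_false, not_false_eq_true, zero_pow,
          mul_zero, zero_mul]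
        linarith
      · have : 0 < cb n * (4 : ℝ) ^ (n + 1) * (n - 1) := by positivity
        simpa using this
    obtain ⟨y, hy, he⟩ := h h0
    refine ⟨y, hy, ?_⟩
    have h4 : (0 : ℝ) < 4 - y := by linarith [hy.2]
    have he' : cb n * y ^ (n + 1) * (n - 1) - t * ((n + 1) * (4 - y)) = 0 := he
    rw [tauOne, div_eq_iff (by positivity)]
    linarith

/-- The bound `y < 4` is forced, since the first condition writes `4 - y` as a product of positive
factors; solving it for `γ` gives the temperature as a function of `y`. -/
lemma singleCutCond_iff (hn : 2 ≤ n) (hγ : 0 < γ) (hy : 0 < y) :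
    SingleCutCond n γ y μ ↔ y < 4 ∧ γ * tauOne n y = 1 ∧
      μ = (2 - 2 * ((4 - y) * (n + 1) / (y * (n - 1)))) / y := by
  have hn1 := one_lt_cast hn
  have hcb := cb_pos n
  have hn2 : (0 : ℝ) < n - 1 := by linarith
  have key : γ * cb n * y ^ n * ((n - 1) / (n + 1)) * y = 4 - y →
      γ * cb n * y ^ n = (4 - y) * (n + 1) / (y * (n - 1)) := fun h => by
    rw [eq_div_iff (by positivity)]
    field_simp at h
    linarith
  rw [SingleCutCond]
  constructor
  · rintro ⟨h1, h2⟩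
    have h3 : γ * cb n * y ^ n * ((n - 1) / (n + 1)) * y = 4 - y := by linarith
    have h4 : 0 < 4 - y := by rw [← h3]; positivity
    refine ⟨by linarith, ?_, ?_⟩
    · rw [tauOne, ← mul_div_assoc, div_eq_one_iff_eq (by positivity)]
      field_simp at h3
      rw [pow_succ]
      linarith
    · rw [eq_div_iff hy.ne', h2, key h3]
  · rintro ⟨h1, h2, h3⟩
    have h4 : 0 < 4 - y := by linarith
    have h5 : γ * cb n * y ^ n * ((n - 1) / (n + 1)) * y = 4 - y := by
      rw [tauOne, ← mul_div_assoc, div_eq_one_iff_eq (by positivity), pow_succ] at h2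
      field_simp
      linarith
    refine ⟨by linarith, ?_⟩
    rw [key h5, h3]
    field_simp

lemma cen_one (hn : 2 ≤ n) : cen n 1 = 2 * (n + 1) / (3 * n) := by
  have hP := pP_pos (n := n) one_pos le_rfl
  have hn1 := one_lt_cast hn
  have hD : pD n 1 = pP n 1 := by simp [pD]
  rw [cen, pG, hD]
  field_simp
  norm_num

/-- At `u = 1` the interval of squares reaches the origin and the moments become central binomial
weights, so the two-cut branch ends at the critical value of the single-cut branch. -/
lemma tauTwo_one (hn : 2 ≤ n) : tauTwo n 1 = tauC n := by
  have hn1 := one_lt_cast hn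
  have hD : pD n 1 = cb (n - 1) * 2 ^ (n - 1) := by
    have := mom_half_half 2 (n - 1)
    rw [div_self two_ne_zero] at this
    simp [pD, pP, this]
  have h2 : (2 : ℝ) ^ n = 2 * 2 ^ (n - 1) := by
    rw [← pow_succ']; congr 1; omega
  have h3 := cb_succ (n - 1)
  have h4 : ((n - 1 : ℕ) : ℝ) = n - 1 := by push_cast [show 1 ≤ n by omega]; ring
  rw [Nat.sub_add_cancel (by omega), h4] at h3
  have h5 : cb n = (2 * n - 1) * cb (n - 1) / (2 * n) := by
    rw [eq_div_iff (by linarith)]; linarith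
  rw [tauTwo, cen_one hn, hD, tauC, h5,
    show (4 : ℝ) * (n + 1) / (3 * n) = 2 * (2 * (n + 1) / (3 * n)) by ring, mul_pow, h2]
  generalize (2 * ((n : ℝ) + 1) / (3 * n)) ^ n = z
  have : (n : ℝ) * 2 - 1 ≠ 0 := by linarith
  have : (n : ℝ) ≠ 0 := by linarith
  field_simp

lemma strictMonoOn_tauTwo (hn : 2 ≤ n) : StrictMonoOn (tauTwo n) (Ioc 0 1) := by
  refine strictMonoOn_of_deriv_pos (convex_Ioc 0 1)
    (fun x hx => (hasDerivAt_tauTwo hn hx.1 hx.2).continuousAt.continuousWithinAt) fun x hx => ?_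
  rw [interior_Ioc] at hx
  rw [(hasDerivAt_tauTwo hn hx.1 hx.2.le).deriv]
  exact tauTwoDeriv_pos hn hx.1 hx.2.le

lemma cen_le (hn : 2 ≤ n) (h0 : 0 < u) (h1 : u ≤ 1) : cen n u ≤ (n + 1) / n := by
  have hn1 := one_lt_cast hn
  have h : 2 * pD n u / pG n u ≤ 1 := by
    rw [div_le_one (pG_pos hn h0 h1), pG]
    have := pP_pos (n := n) h0 h1
    have : 0 < u ^ 2 * pP n u := by positivity
    linarith
  rw [cen]
  exact mul_le_of_le_one_right (by positivity) h

/-- The center stays below `(n + 1) / n`, while `D` tends to zero because all moments equal one at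
`u = 0`. -/
lemma tendsto_tauTwo (hn : 2 ≤ n) : Tendsto (tauTwo n) (𝓝[>] 0) (𝓝 0) := by
  have hn1 := one_lt_cast hn
  have hc : Continuous fun u => ((n + 1 : ℝ) / n) ^ n * ((n - 1) / n * pD n u) := by
    have := continuous_mom (n - 1)
    have := continuous_mom (n - 2)
    unfold pD pP pQ
    fun_prop
  have h0 : pD n 0 = 0 := by
    have h : ∀ k, mom 1 0 k = 1 := fun k => by
      simp [mom, Real.pi_ne_zero]
    simp [pD, pP, pQ, h]
  have hlim : Tendsto (fun u => ((n + 1 : ℝ) / n) ^ n * ((n - 1) / n * pD n u)) (𝓝[>] 0) (𝓝 0) := by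
    have := (hc.tendsto 0).mono_left (nhdsWithin_le_nhds (s := Ioi 0))
    simpa [h0] using this
  have hev : ∀ᶠ u : ℝ in 𝓝[>] 0, u ∈ Ioo 0 1 := Ioo_mem_nhdsGT one_pos
  refine tendsto_of_tendsto_of_tendsto_of_le_of_le' tendsto_const_nhds hlim ?_ ?_
  · filter_upwards [hev] with u hu
    exact (tauTwo_pos hn hu.1 hu.2.le).le
  · filter_upwards [hev] with u hu
    have hD := pD_pos hn hu.1 hu.2.le
    have : (0 : ℝ) < n - 1 := by linarith
    rw [tauTwo]
    have h1 := pow_le_pow_left₀ (cen_pos hn hu.1 hu.2.le).le (cen_le hn hu.1 hu.2.le) n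
    exact mul_le_mul_of_nonneg_right h1 (by positivity)

lemma image_tauTwo (hn : 2 ≤ n) : tauTwo n '' Ioo 0 1 = Ioo 0 (tauC n) := by
  ext t
  constructor
  · rintro ⟨u, hu, rfl⟩
    refine ⟨tauTwo_pos hn hu.1 hu.2.le, ?_⟩
    rw [← tauTwo_one hn]
    exact strictMonoOn_tauTwo hn ⟨hu.1, hu.2.le⟩ ⟨one_pos, le_rfl⟩ hu.2
  · intro ht
    have h1 := (tendsto_tauTwo hn).eventually (Iio_mem_nhds ht.1)
    have hev : ∀ᶠ u : ℝ in 𝓝[>] 0, u ∈ Ioo 0 1 := Ioo_mem_nhdsGT one_pos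
    obtain ⟨w, hw, hw2⟩ := (h1.and hev).exists
    have hc : ContinuousOn (tauTwo n) (Icc w 1) := fun x hx =>
      (hasDerivAt_tauTwo hn (hw2.1.trans_le hx.1) hx.2).continuousAt.continuousWithinAt
    have hm : t ∈ Ioo (tauTwo n w) (tauTwo n 1) := ⟨hw, by rw [tauTwo_one hn]; exact ht.2⟩
    obtain ⟨x, hx, he⟩ := intermediate_value_Ioo hw2.2.le hc hm
    exact ⟨x, ⟨hw2.1.trans hx.1, hx.2⟩, he⟩

lemma strictMonoOn_tauOne (hn : 2 ≤ n) : StrictMonoOn (tauOne n) (Ioo 0 4) := by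
  refine strictMonoOn_of_deriv_pos (convex_Ioo 0 4)
    (fun x hx => (hasDerivAt_tauOne hx).continuousAt.continuousWithinAt) fun x hx => ?_
  rw [interior_Ioo] at hx
  rw [(hasDerivAt_tauOne hx).deriv]
  exact tauOneDeriv_pos hn hx

end SphericalMatrix

/-! ### The saddle point solutions as functions of the temperature. -/

namespace SphericalMatrix

variable {n : ℕ} {v T a b μ y u τ : ℝ} {ρ : ℝ → ℝ}

/-- The squared half-width of the single-cut solution as a function of `T / (n v)`. -/
def ySol (n : ℕ) (τ : ℝ) : ℝ := Function.invFunOn (tauOne n) (Ioo 0 4) τ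

/-- The radius to center ratio of the two-cut solution as a function of `T / (n v)`. -/
def uSol (n : ℕ) (τ : ℝ) : ℝ := Function.invFunOn (tauTwo n) (Ioo 0 1) τ

lemma ySol_mem (hn : 2 ≤ n) (hτ : 0 < τ) : ySol n τ ∈ Ioo 0 4 :=
  (invFunOn_spec isOpen_Ioi (fun _ hx => hasDerivAt_tauOne hx) (fun _ hx => tauOneDeriv_pos hn hx)
    (image_tauOne hn) hτ).1

lemma tauOne_ySol (hn : 2 ≤ n) (hτ : 0 < τ) : tauOne n (ySol n τ) = τ :=
  (invFunOn_spec isOpen_Ioi (fun _ hx => hasDerivAt_tauOne hx) (fun _ hx => tauOneDeriv_pos hn hx)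
    (image_tauOne hn) hτ).2.1

lemma eq_ySol (hn : 2 ≤ n) (hy : y ∈ Ioo 0 4) : ySol n (tauOne n y) = y :=
  ((strictMonoOn_tauOne hn).injOn hy (ySol_mem hn (tauOne_pos hn hy))
    (tauOne_ySol hn (tauOne_pos hn hy)).symm).symm

lemma hasDerivAt_ySol (hn : 2 ≤ n) (hτ : 0 < τ) :
    HasDerivAt (ySol n) (tauOneDeriv n (ySol n τ))⁻¹ τ :=
  (invFunOn_spec isOpen_Ioi (fun _ hx => hasDerivAt_tauOne hx) (fun _ hx => tauOneDeriv_pos hn hx)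
    (image_tauOne hn) hτ).2.2.2

lemma uSol_spec (hn : 2 ≤ n) (hτ : τ ∈ Ioo 0 (tauC n)) :
    uSol n τ ∈ Ioo 0 1 ∧ tauTwo n (uSol n τ) = τ ∧
      HasDerivAt (uSol n) (tauTwoDeriv n (uSol n τ))⁻¹ τ := by
  have h := invFunOn_spec isOpen_Ioo (fun _ hx => hasDerivAt_tauTwo hn hx.1 hx.2.le)
    (fun _ hx => tauTwoDeriv_pos hn hx.1 hx.2.le) (image_tauTwo hn) hτ
  exact ⟨h.1, h.2.1, h.2.2.2⟩

lemma eq_uSol (hn : 2 ≤ n) (hu : u ∈ Ioo 0 1) : uSol n (tauTwo n u) = u := by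
  have ht : tauTwo n u ∈ Ioo 0 (tauC n) := image_tauTwo hn ▸ mem_image_of_mem _ hu
  have h := uSol_spec hn ht
  exact (strictMonoOn_tauTwo hn).injOn (Ioo_subset_Ioc_self h.1) (Ioo_subset_Ioc_self hu) h.2.1

lemma yC_lt_ySol_iff (hn : 2 ≤ n) (hτ : 0 < τ) : yC n < ySol n τ ↔ tauC n < τ := by
  rw [← tauOne_yC hn]
  nth_rw 2 [← tauOne_ySol hn hτ]
  exact ((strictMonoOn_tauOne hn).lt_iff_lt (yC_mem hn) (ySol_mem hn hτ)).symm

lemma ySol_lt_yC_iff (hn : 2 ≤ n) (hτ : 0 < τ) : ySol n τ < yC n ↔ τ < tauC n := by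
  rw [← tauOne_yC hn]
  nth_rw 2 [← tauOne_ySol hn hτ]
  exact ((strictMonoOn_tauOne hn).lt_iff_lt (ySol_mem hn hτ) (yC_mem hn)).symm

lemma ySol_tauC (hn : 2 ≤ n) : ySol n (tauC n) = yC n := by
  rw [← tauOne_yC hn, eq_ySol hn (yC_mem hn)]

/-- The multiplier of the single-cut solution on `[-√y, √y]`. -/
def muOne (n : ℕ) (y : ℝ) : ℝ := (2 - 2 * ((4 - y) * (n + 1) / (y * (n - 1)))) / y

/-- The multiplier of the two-cut solution with radius to center ratio `u`. -/
def muTwo (n : ℕ) (u : ℝ) : ℝ := -(cen n u ^ (n - 1) * pP n u / tauTwo n u)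

def rhoOne (n : ℕ) (τ : ℝ) : ℝ → ℝ :=
  cutDensity 0 √(ySol n τ) (muOne n (ySol n τ)) τ⁻¹ 1 (2 * n - 1)

def rhoTwo (n : ℕ) (τ : ℝ) (x : ℝ) : ℝ :=
  |x| * cutDensity (cen n (uSol n τ)) (cen n (uSol n τ) * uSol n τ) (muTwo n (uSol n τ)) τ⁻¹ 0
    (n - 1) (x ^ 2)

lemma isSingleCut_iff_sol (hn : 2 ≤ n) (hv : 0 < v) (hT : 0 < T) (hτ : τ = T / (n * v)) :
    IsSingleCut (potential n v) T a μ ρ ↔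
      a = √(ySol n τ) ∧ μ = muOne n (ySol n τ) ∧ ρ = rhoOne n τ := by
  have hn1 := one_lt_cast hn
  have hτ0 : 0 < τ := by rw [hτ]; positivity
  have hγ : n * v / T = τ⁻¹ := by rw [hτ, inv_div]
  have hy := ySol_mem hn hτ0
  rw [isSingleCut_iff hn hv hT, hγ]
  constructor
  · rintro ⟨ha, hc, rfl⟩
    rw [singleCutCond_iff hn (inv_pos.2 hτ0) (by positivity)] at hc
    obtain ⟨h4, h1, h2⟩ := hc
    have hy' : ySol n τ = a ^ 2 := by
      rw [inv_mul_eq_div, div_eq_one_iff_eq hτ0.ne'] at h1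
      rw [← h1, eq_ySol hn ⟨by positivity, h4⟩]
    have ha' : a = √(ySol n τ) := by rw [hy', Real.sqrt_sq ha.le]
    have hμ : μ = muOne n (ySol n τ) := by rw [h2, hy', muOne]
    refine ⟨ha', hμ, ?_⟩
    rw [rhoOne, ← ha', ← hμ]
  · rintro ⟨rfl, rfl, rfl⟩
    refine ⟨Real.sqrt_pos.2 hy.1, ?_, rfl⟩
    rw [Real.sq_sqrt hy.1.le, singleCutCond_iff hn (inv_pos.2 hτ0) hy.1, tauOne_ySol hn hτ0]
    exact ⟨hy.2, inv_mul_cancel₀ hτ0.ne', rfl⟩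

/-- Once `μ` and `τ` are eliminated, the value at the origin of the polynomial factor is a positive
multiple of `y - yC n`. Since `tauOne` is increasing, its sign compares the temperature with the
critical one. -/
lemma single_origin (hn : 2 ≤ n) (hy : y ∈ Ioo 0 4) :
    muOne n y + (tauOne n y)⁻¹ * (cb (n - 1) * y ^ (n - 1)) =
      6 * n / (y ^ 2 * (2 * n - 1)) * (y - yC n) := by
  have hn1 := one_lt_cast hn
  have hcb := cb_pos (n - 1)
  have hy0 := hy.1
  have h3 := cb_succ (n - 1)
  have h4 : ((n - 1 : ℕ) : ℝ) = n - 1 := by push_cast [show 1 ≤ n by omega]; ring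
  rw [Nat.sub_add_cancel (by omega), h4] at h3
  have h5 : cb n = (2 * n - 1) * cb (n - 1) / (2 * n) := by
    rw [eq_div_iff (by linarith)]; linarith
  have h6 : y ^ (n + 1) = y ^ (n - 1) * y ^ 2 := by
    rw [← pow_add]; congr 1; omega
  have e1 : (2 : ℝ) * n - 1 ≠ 0 := by linarith
  have e2 : (n : ℝ) ≠ 0 := by linarith
  have e3 : (n : ℝ) - 1 ≠ 0 := by linarith
  have e4 : (4 : ℝ) - y ≠ 0 := by linarith [hy.2]
  have e5 : y ^ (n - 1) ≠ 0 := by positivity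
  rw [muOne, tauOne, yC, h5, h6]
  generalize y ^ (n - 1) = z at *
  field_simp
  ring

lemma rhoOne_apply (hn : 2 ≤ n) (hτ : 0 < τ) (x : ℝ) :
    rhoOne n τ x = Real.pi⁻¹ * (6 * n / (ySol n τ ^ 2 * (2 * n - 1)) * (ySol n τ - yC n)
      + τ⁻¹ * x ^ 2 * (secPoly 0 √(ySol n τ) (2 * (n - 2) + 1)).eval x) * semi 0 √(ySol n τ) x := by
  have hy := ySol_mem hn hτ
  have h := single_origin hn hy
  rw [tauOne_ySol hn hτ] at h
  rw [rhoOne, cutDensity_single hn, Real.sq_sqrt hy.1.le, h]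

lemma rhoOne_pos (hn : 2 ≤ n) (hτ : 0 < τ) (h : tauC n ≤ τ) {x : ℝ}
    (hx : x ∈ Ioo (-√(ySol n τ)) √(ySol n τ)) (hx0 : tauC n < τ ∨ x ≠ 0) : 0 < rhoOne n τ x := by
  have hn1 := one_lt_cast hn
  have hy := ySol_mem hn hτ
  have hs := Real.sqrt_pos.2 hy.1
  have h1 := semi_pos (c := 0) (x := x) (by simpa using hx)
  have h2 := eval_secPoly_odd_pos hs x (n - 2)
  have h3 : (0 : ℝ) < 6 * n / (ySol n τ ^ 2 * (2 * n - 1)) := by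
    have := hy.1
    have : (0 : ℝ) < 2 * n - 1 := by linarith
    positivity
  rw [rhoOne_apply hn hτ]
  refine mul_pos (mul_pos (by positivity) ?_) h1
  rcases hx0 with h' | h'
  · have := (yC_lt_ySol_iff hn hτ).2 h'
    have : 0 < ySol n τ - yC n := by linarith
    positivity
  · have : 0 ≤ ySol n τ - yC n := by
      have := mt (ySol_lt_yC_iff hn hτ).1 (not_lt.2 h)
      linarith
    positivity

lemma rhoOne_tauC_zero (hn : 2 ≤ n) : rhoOne n (tauC n) 0 = 0 := by
  rw [rhoOne_apply hn (tauC_pos hn), ySol_tauC hn]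
  simp

lemma rhoOne_zero_neg (hn : 2 ≤ n) (hτ : 0 < τ) (h : τ < tauC n) : rhoOne n τ 0 < 0 := by
  have hn1 := one_lt_cast hn
  have hy := ySol_mem hn hτ
  have hs := Real.sqrt_pos.2 hy.1
  have h1 := semi_pos (c := 0) (x := 0) (r := √(ySol n τ)) (by simpa using hs)
  have h2 := (ySol_lt_yC_iff hn hτ).2 h
  have h3 : (0 : ℝ) < 6 * n / (ySol n τ ^ 2 * (2 * n - 1)) := by
    have := hy.1
    have : (0 : ℝ) < 2 * n - 1 := by linarith
    positivity
  rw [rhoOne_apply hn hτ]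
  refine mul_neg_of_neg_of_pos (mul_neg_of_pos_of_neg (by positivity) ?_) h1
  have : 6 * n / (ySol n τ ^ 2 * (2 * n - 1)) * (ySol n τ - yC n) < 0 :=
    mul_neg_of_pos_of_neg h3 (by linarith)
  simpa using this

lemma twoCutCond_sol (hn : 2 ≤ n) (hτ : τ ∈ Ioo 0 (tauC n)) :
    TwoCutCond n τ⁻¹ (cen n (uSol n τ)) (cen n (uSol n τ) * uSol n τ) (muTwo n (uSol n τ)) := by
  obtain ⟨hu, ht, -⟩ := uSol_spec hn hτ
  rw [twoCutCond_iff hn hu.1 hu.2.le (inv_pos.2 hτ.1) (cen_pos hn hu.1 hu.2.le), ht, muTwo, ht]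
  exact ⟨rfl, inv_mul_cancel₀ hτ.1.ne', by ring⟩

lemma IsTwoCut.eq_sol (hn : 2 ≤ n) (hv : 0 < v) (hT : 0 < T) (hτ : τ = T / (n * v))
    (h : IsTwoCut (potential n v) T a b μ ρ) :
    τ < tauC n ∧ μ = muTwo n (uSol n τ) ∧ ρ = rhoTwo n τ := by
  have hn1 := one_lt_cast hn
  have hτ0 : 0 < τ := by rw [hτ]; positivity
  have hγ : n * v / T = τ⁻¹ := by rw [hτ, inv_div]
  rw [isTwoCut_iff hn hv hT, hγ] at h
  obtain ⟨ha, hab, hc, rfl⟩ := h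
  set c := (a ^ 2 + b ^ 2) / 2 with hcdef
  set r := (b ^ 2 - a ^ 2) / 2 with hrdef
  have hc0 : 0 < c := by positivity
  have hr0 : 0 < r := by rw [hrdef]; nlinarith
  have hrc : r < c := by rw [hrdef, hcdef]; nlinarith
  -- The ratio is strictly below one because `a > 0`; this is why two-cut solutions exist only below
  -- the critical temperature.
  obtain ⟨u, hu⟩ : ∃ u, r = c * u := ⟨r / c, by field_simp⟩
  have hu0 : u ∈ Ioo 0 1 := by
    rw [hu] at hr0 hrc
    exact ⟨pos_of_mul_pos_right hr0 hc0.le, by nlinarith⟩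
  rw [hu, twoCutCond_iff hn hu0.1 hu0.2.le (inv_pos.2 hτ0) hc0] at hc
  obtain ⟨h1, h2, h3⟩ := hc
  rw [inv_mul_eq_div, div_eq_one_iff_eq hτ0.ne'] at h2
  have hus : uSol n τ = u := by rw [← h2, eq_uSol hn hu0]
  have hμ : μ = muTwo n (uSol n τ) := by
    rw [hus, muTwo, h2, h3, h1]
    ring
  refine ⟨?_, hμ, ?_⟩
  · have : tauTwo n u ∈ Ioo 0 (tauC n) := image_tauTwo hn ▸ mem_image_of_mem _ hu0
    rw [← h2]
    exact this.2
  · ext x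
    rw [rhoTwo, ← hμ, hus, ← h1, hu]

lemma isTwoCut_rhoTwo (hn : 2 ≤ n) (hv : 0 < v) (hT : 0 < T) (hτ : τ = T / (n * v))
    (h : τ < tauC n) :
    ∃ a b, IsTwoCut (potential n v) T a b (muTwo n (uSol n τ)) (rhoTwo n τ) ∧
      (∀ x ∈ Ioo a b, 0 < rhoTwo n τ x) ∧ ∀ x, 0 ≤ rhoTwo n τ x := by
  have hn1 := one_lt_cast hn
  have hτ0 : 0 < τ := by rw [hτ]; positivity
  have hγ : n * v / T = τ⁻¹ := by rw [hτ, inv_div]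
  have hc := twoCutCond_sol hn ⟨hτ0, h⟩
  obtain ⟨hu, ht, -⟩ := uSol_spec hn ⟨hτ0, h⟩
  have hcen := cen_pos hn hu.1 hu.2.le
  set u := uSol n τ with hudef
  set c := cen n u with hcdef
  have hl : 0 < c * (1 - u) := mul_pos hcen (by linarith [hu.2])
  have hh : c * (1 - u) < c * (1 + u) := mul_lt_mul_of_pos_left (by linarith [hu.1]) hcen
  have hcu : 0 < c * u := mul_pos hcen hu.1
  have e1 : √(c * (1 - u)) ^ 2 = c * (1 - u) := Real.sq_sqrt hl.le
  have e2 : √(c * (1 + u)) ^ 2 = c * (1 + u) := Real.sq_sqrt (hl.trans hh).le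
  have e3 : (c * (1 - u) + c * (1 + u)) / 2 = c := by ring
  have e4 : (c * (1 + u) - c * (1 - u)) / 2 = c * u := by ring
  have hnn : ∀ t, 0 ≤ t → 0 ≤ cutDensity c (c * u) (muTwo n u) τ⁻¹ 0 (n - 1) t ∧
      (t ∈ Ioo (c * (1 - u)) (c * (1 + u)) →
        0 < cutDensity c (c * u) (muTwo n u) τ⁻¹ 0 (n - 1) t) := by
    intro t ht
    have h2 := eval_secPoly_pos hcu (mul_le_of_le_one_right hcen.le hu.2.le) ht (n - 2)
    rw [show n - 2 + 1 = n - 1 by omega] at h2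
    rw [cutDensity_two]
    refine ⟨?_, fun h' => ?_⟩
    · have : 0 ≤ semi c (c * u) t := Real.sqrt_nonneg _
      positivity
    · have h1 := semi_pos (c := c) (r := c * u) (x := t) (by
        rw [show c - c * u = c * (1 - u) by ring, show c + c * u = c * (1 + u) by ring]
        exact h')
      positivity
  refine ⟨√(c * (1 - u)), √(c * (1 + u)), ?_, fun x hx => ?_, fun x => ?_⟩
  · rw [isTwoCut_iff hn hv hT, hγ, e1, e2, e3, e4]
    exact ⟨Real.sqrt_pos.2 hl, Real.sqrt_lt_sqrt hl.le hh, hc, rfl⟩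
  · have hx0 : 0 < x := (Real.sqrt_pos.2 hl).trans hx.1
    refine mul_pos (abs_pos.2 hx0.ne') ((hnn _ (sq_nonneg x)).2 ⟨?_, ?_⟩)
    · exact (Real.sqrt_lt' hx0).1 hx.1
    · exact (Real.lt_sqrt hx0.le).1 hx.2
  · exact mul_nonneg (abs_nonneg x) (hnn _ (sq_nonneg x)).1

lemma isSingleCut_rhoOne (hn : 2 ≤ n) (hv : 0 < v) (hT : 0 < T) (hτ : τ = T / (n * v)) :
    IsSingleCut (potential n v) T √(ySol n τ) (muOne n (ySol n τ)) (rhoOne n τ) :=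
  (isSingleCut_iff_sol hn hv hT hτ).2 ⟨rfl, rfl, rfl⟩

lemma rhoOne_nonneg (hn : 2 ≤ n) (h : tauC n ≤ τ) (x : ℝ) :
    0 ≤ rhoOne n τ x := by
  have hτ : 0 < τ := (tauC_pos hn).trans_le h
  by_cases hx : x ∈ Ioo (-√(ySol n τ)) √(ySol n τ)
  · by_cases h0 : tauC n < τ ∨ x ≠ 0
    · exact (rhoOne_pos hn hτ h hx h0).le
    · push Not at h0
      rw [h0.2, le_antisymm h0.1 h, rhoOne_tauC_zero hn]
  · rw [rhoOne_apply hn hτ, semi_eq_zero (Real.sqrt_pos.2 (ySol_mem hn hτ).1) (by simpa using hx),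
      mul_zero]

lemma isSaddleDensity_iff_single (hn : 2 ≤ n) (hv : 0 < v) (hT : 0 < T) (hτ : τ = T / (n * v))
    (h : tauC n ≤ τ) :
    IsSaddleDensity (potential n v) T μ ρ ↔ μ = muOne n (ySol n τ) ∧ ρ = rhoOne n τ := by
  constructor
  · intro hs
    rcases hs.cases hn hv hT with ⟨a, ha⟩ | ⟨a, b, hab⟩
    · exact ((isSingleCut_iff_sol hn hv hT hτ).1 ha).2
    · exact absurd (hab.eq_sol hn hv hT hτ).1 (not_lt.2 h)
  · rintro ⟨rfl, rfl⟩
    exact ⟨(isSingleCut_rhoOne hn hv hT hτ).2.2, rhoOne_nonneg hn h⟩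

/-- By `IsSaddleDensity.cases` only two candidates exist, and below the critical temperature the
single-cut one is negative at the origin. -/
lemma isSaddleDensity_iff_two (hn : 2 ≤ n) (hv : 0 < v) (hT : 0 < T) (hτ : τ = T / (n * v))
    (h : τ < tauC n) :
    IsSaddleDensity (potential n v) T μ ρ ↔ μ = muTwo n (uSol n τ) ∧ ρ = rhoTwo n τ := by
  have hn1 := one_lt_cast hn
  have hτ0 : 0 < τ := by rw [hτ]; positivity
  constructor
  · intro hs
    rcases hs.cases hn hv hT with ⟨a, ha⟩ | ⟨a, b, hab⟩
    · have h1 := ((isSingleCut_iff_sol hn hv hT hτ).1 ha).2.2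
      have h2 := hs.2 0
      rw [h1] at h2
      exact absurd (rhoOne_zero_neg hn hτ0 h) (not_lt.2 h2)
    · exact (hab.eq_sol hn hv hT hτ).2
  · rintro ⟨rfl, rfl⟩
    obtain ⟨a, b, h1, -, h3⟩ := isTwoCut_rhoTwo hn hv hT hτ h
    exact ⟨h1.2.2.2, h3⟩

end SphericalMatrix

/-! ### Arcsine averages of the logarithmic potential. -/

namespace SphericalMatrix

variable {f : ℝ → ℝ} {c r : ℝ}

/-- For `z = e^(iθ)` the product of `z - e^(iφ)` and `z - e^(-iφ)` is `2 z (cos θ - cos φ)`. The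
logarithm of a difference of cosines thus reduces to circle averages of `log ‖z - a‖` with `‖a‖ =
1`, which vanish. -/
lemma norm_circleMap_sub_mul (θ φ : ℝ) :
    ‖circleMap 0 1 θ - Complex.exp (φ * Complex.I)‖ *
      ‖circleMap 0 1 θ - Complex.exp ((-φ : ℝ) * Complex.I)‖ = 2 * |Real.cos θ - Real.cos φ| := by
  have h : (circleMap 0 1 θ - Complex.exp (φ * Complex.I)) *
      (circleMap 0 1 θ - Complex.exp ((-φ : ℝ) * Complex.I)) =
      circleMap 0 1 θ * ((2 * (Real.cos θ - Real.cos φ) : ℝ) : ℂ) := by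
    have h1 : circleMap 0 1 θ = Complex.cos θ + Complex.sin θ * Complex.I := by
      simp [circleMap, Complex.exp_mul_I]
    rw [h1, Complex.exp_mul_I, Complex.exp_mul_I]
    push_cast
    rw [Complex.cos_neg, Complex.sin_neg]
    have e1 := Complex.sin_sq_add_cos_sq (θ : ℂ)
    have e2 := Complex.sin_sq_add_cos_sq (φ : ℂ)
    have e3 := Complex.I_sq
    linear_combination (Complex.sin θ ^ 2 - Complex.sin φ ^ 2) * e3 + e2 - e1
  rw [← norm_mul, h, norm_mul, norm_circleMap_zero, abs_one, one_mul, Complex.norm_real,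
    Real.norm_eq_abs, abs_mul, abs_two]

lemma ae_cos_ne (φ : ℝ) : ∀ᵐ θ : ℝ, Real.cos θ - Real.cos φ ≠ 0 := by
  have hc : ({θ : ℝ | Real.cos θ = Real.cos φ}).Countable := by
    refine ((countable_range fun k : ℤ => φ - 2 * k * Real.pi).union
      (countable_range fun k : ℤ => 2 * k * Real.pi - φ)).mono fun θ hθ => ?_
    obtain ⟨k, hk | hk⟩ := Real.cos_eq_cos_iff.1 (mem_ofPred_eq ▸ hθ)
    · exact Or.inl ⟨k, by simp only; linarith⟩
    · exact Or.inr ⟨k, by simp only; linarith⟩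
  filter_upwards [hc.ae_notMem volume] with θ hθ h
  exact hθ (sub_eq_zero.1 h)

lemma log_abs_cos_sub (φ : ℝ) :
    IntervalIntegrable (fun θ => Real.log |Real.cos θ - Real.cos φ|) volume 0 (2 * Real.pi) ∧
      ∫ θ in (0 : ℝ)..2 * Real.pi, Real.log |Real.cos θ - Real.cos φ|
        = -(2 * Real.pi * Real.log 2) := by
  have hn : ∀ φ : ℝ, ‖Complex.exp (φ * Complex.I)‖ = 1 := Complex.norm_exp_ofReal_mul_I
  have hi : ∀ φ : ℝ, IntervalIntegrable
      (fun θ => Real.log ‖circleMap 0 1 θ - Complex.exp (φ * Complex.I)‖) volume 0 (2 * Real.pi) :=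
    fun φ => circleIntegrable_log_norm_sub_const 1
  have hv : ∀ φ : ℝ, ∫ θ in (0 : ℝ)..2 * Real.pi,
      Real.log ‖circleMap 0 1 θ - Complex.exp (φ * Complex.I)‖ = 0 := fun φ => by
    have h := circleAverage_log_norm_sub_const_eq_posLog (a := Complex.exp (φ * Complex.I))
    rw [hn, Real.circleAverage_def, smul_eq_mul] at h
    have h0 : Real.posLog 1 = 0 := by simp [Real.posLog]
    rw [h0, mul_eq_zero] at h
    exact h.resolve_left (by positivity)
  have hae : ∀ᵐ θ : ℝ, Real.log ‖circleMap 0 1 θ - Complex.exp (φ * Complex.I)‖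
      + Real.log ‖circleMap 0 1 θ - Complex.exp ((-φ : ℝ) * Complex.I)‖ - Real.log 2
      = Real.log |Real.cos θ - Real.cos φ| := by
    filter_upwards [ae_cos_ne φ] with θ hθ
    have h := norm_circleMap_sub_mul θ φ
    have h1 : 0 < 2 * |Real.cos θ - Real.cos φ| := by positivity
    rw [← h] at h1
    rw [← Real.log_mul (left_ne_zero_of_mul h1.ne') (right_ne_zero_of_mul h1.ne'), h,
      Real.log_mul two_ne_zero (abs_ne_zero.2 hθ)]
    ring
  have hint := ((hi φ).add (hi (-φ))).sub (intervalIntegrable_const (c := Real.log 2))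
  constructor
  · exact hint.congr_ae (ae_restrict_of_ae hae)
  · rw [← intervalIntegral.integral_congr_ae (hae.mono fun θ h _ => h),
      intervalIntegral.integral_sub ((hi φ).add (hi (-φ))) intervalIntegrable_const,
      intervalIntegral.integral_add (hi φ) (hi (-φ)), hv, hv]
    simp

/-- The arcsine law is the equilibrium measure of the interval, whose logarithmic capacity is `r /
2`: its potential is constant on the interval. -/
lemma integral_log_arcsine (hr : 0 < r) {y : ℝ} (hy : y ∈ Icc (c - r) (c + r)) :
    IntervalIntegrable (fun θ => Real.log |c + r * Real.cos θ - y|) volume 0 Real.pi ∧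
      ∫ θ in (0 : ℝ)..Real.pi, Real.log |c + r * Real.cos θ - y| = Real.pi * Real.log (r / 2) := by
  obtain ⟨φ, hφ⟩ : ∃ φ, y = c + r * Real.cos φ := by
    refine ⟨Real.arccos ((y - c) / r), ?_⟩
    rw [Real.cos_arccos]
    · field_simp; ring
    · rw [le_div_iff₀ hr]; linarith [hy.1]
    · rw [div_le_iff₀ hr]; linarith [hy.2]
  obtain ⟨h1, h2⟩ := log_abs_cos_sub φ
  have hpi := Real.pi_pos
  set g : ℝ → ℝ := fun θ => Real.log |Real.cos θ - Real.cos φ| with hg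
  have i1 : IntervalIntegrable g volume 0 Real.pi := h1.mono_set (by
    rw [uIcc_of_le hpi.le, uIcc_of_le (by linarith)]
    exact Icc_subset_Icc_right (by linarith))
  have i2 : IntervalIntegrable g volume Real.pi (2 * Real.pi) := h1.mono_set (by
    rw [uIcc_of_le (by linarith), uIcc_of_le (by linarith)]
    exact Icc_subset_Icc_left hpi.le)
  have h3 : ∫ θ in Real.pi..2 * Real.pi, g θ = ∫ θ in (0 : ℝ)..Real.pi, g θ := by
    have h := intervalIntegral.integral_comp_sub_left (a := 0) (b := Real.pi) g (2 * Real.pi)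
    rw [sub_zero, show 2 * Real.pi - Real.pi = Real.pi by ring] at h
    rw [← h]
    simp [hg, Real.cos_two_pi_sub]
  have h4 : ∫ θ in (0 : ℝ)..Real.pi, g θ = -(Real.pi * Real.log 2) := by
    rw [← intervalIntegral.integral_add_adjacent_intervals i1 i2, h3] at h2
    linarith
  have hae : ∀ᵐ θ : ℝ, Real.log r + g θ = Real.log |c + r * Real.cos θ - y| := by
    filter_upwards [ae_cos_ne φ] with θ hθ
    rw [hφ, show c + r * Real.cos θ - (c + r * Real.cos φ) = r * (Real.cos θ - Real.cos φ) by ring,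
      abs_mul, abs_of_pos hr, Real.log_mul hr.ne' (abs_ne_zero.2 hθ)]
  constructor
  · exact (intervalIntegrable_const.add i1).congr_ae (ae_restrict_of_ae hae)
  · rw [← intervalIntegral.integral_congr_ae (hae.mono fun θ h _ => h),
      intervalIntegral.integral_add intervalIntegrable_const i1, h4, Real.log_div hr.ne' two_ne_zero]
    simp
    ring

/-- The arcsine average of the logarithmic potential is constant on densities supported in the
interval. -/
theorem Hol.integral_logPot_arcsine (hf : Hol f) (hr : 0 < r)
    (h0 : ∀ x ∉ Ioo (c - r) (c + r), f x = 0) :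
    ∫ θ in (0 : ℝ)..Real.pi, logPot f (c + r * Real.cos θ)
      = Real.pi * Real.log (r / 2) * ∫ x, f x := by
  have hpi := Real.pi_pos
  set μ : Measure ℝ := volume.restrict (Ioc 0 Real.pi) with hμ
  set M : ℝ := Real.posLog (2 * r) with hM
  have hmeas : Measurable fun p : ℝ × ℝ => f p.2 * Real.log |c + r * Real.cos p.1 - p.2| :=
    (hf.continuous.measurable.comp measurable_snd).mul
      (Real.measurable_log.comp (Continuous.measurable (by fun_prop)))
  -- As `|log z| = 2 log⁺ z - log z`, the known integral of the logarithm bounds that of its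
  -- absolute value uniformly in `y`, as Fubini requires.
  have habs : ∀ y ∈ Ioo (c - r) (c + r), ∀ θ, |(Real.log |c + r * Real.cos θ - y|)|
      ≤ 2 * M - Real.log |c + r * Real.cos θ - y| := by
    intro y hy θ
    have h1 := Real.half_mul_log_add_log_abs (x := |c + r * Real.cos θ - y|)
    have h2 : Real.posLog |c + r * Real.cos θ - y| ≤ M := by
      refine Real.monotoneOn_posLog (mem_Ici.2 (abs_nonneg _)) (mem_Ici.2 (by positivity)) ?_
      have := Real.neg_one_le_cos θ
      have := Real.cos_le_one θ
      rw [abs_le]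
      constructor <;> nlinarith [hy.1, hy.2]
    linarith
  have hsec : ∀ y, Integrable (fun θ => f y * Real.log |c + r * Real.cos θ - y|) μ := by
    intro y
    by_cases hy : y ∈ Ioo (c - r) (c + r)
    · exact ((intervalIntegrable_iff_integrableOn_Ioc_of_le hpi.le).1
        (integral_log_arcsine hr (Ioo_subset_Icc_self hy)).1).const_mul _
    · simp [h0 y hy]
  have hint : Integrable (fun p : ℝ × ℝ => f p.2 * Real.log |c + r * Real.cos p.1 - p.2|)
      (μ.prod volume) := by
    refine (integrable_prod_iff' hmeas.aestronglyMeasurable).2 ⟨Eventually.of_forall hsec, ?_⟩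
    refine Integrable.mono' (hf.integrable.norm.mul_const
      (Real.pi * (2 * M) - Real.pi * Real.log (r / 2))) ?_ (Eventually.of_forall fun y => ?_)
    · exact (hmeas.norm.comp measurable_swap).aestronglyMeasurable.integral_prod_right'
    · rw [Real.norm_of_nonneg (integral_nonneg fun θ => norm_nonneg _)]
      by_cases hy : y ∈ Ioo (c - r) (c + r)
      · obtain ⟨g1, g2⟩ := integral_log_arcsine hr (Ioo_subset_Icc_self hy)
        rw [intervalIntegrable_iff_integrableOn_Ioc_of_le hpi.le] at g1
        rw [intervalIntegral.integral_of_le hpi.le] at g2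
        have hb : ∫ θ, |(Real.log |c + r * Real.cos θ - y|)| ∂μ
            ≤ ∫ θ, (2 * M - Real.log |c + r * Real.cos θ - y|) ∂μ :=
          integral_mono g1.abs ((integrable_const _).sub g1) (habs y hy)
        rw [integral_sub (integrable_const _) g1, g2, integral_const] at hb
        simp only [norm_mul]
        rw [integral_const_mul]
        refine mul_le_mul_of_nonneg_left (hb.trans_eq ?_) (norm_nonneg _)
        simp [hpi.le]
      · simp [h0 y hy]
  have hswap := integral_integral_swap (f := fun θ y => f y * Real.log |c + r * Real.cos θ - y|) hint
  rw [intervalIntegral.integral_of_le hpi.le]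
  refine hswap.trans ?_
  rw [← integral_const_mul]
  congr 1
  ext y
  by_cases hy : y ∈ Ioo (c - r) (c + r)
  · have g2 := (integral_log_arcsine hr (Ioo_subset_Icc_self hy)).2
    rw [intervalIntegral.integral_of_le hpi.le] at g2
    rw [integral_const_mul, g2]
    ring
  · simp [h0 y hy]

end SphericalMatrix

/-! ### The virial identity and the value of the action. -/

namespace SphericalMatrix

variable {n : ℕ} {v T μ γ τ c r a ℓ : ℝ} {ρ f : ℝ → ℝ}

lemma IsSaddleSolution.mul_hil_eq (h : IsSaddleSolution (potential n v) T μ ρ) (hn : 2 ≤ n)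
    (x : ℝ) : x * ρ x * Hil ρ x = μ * (x ^ 2 * ρ x) + n * v / T * (x ^ (2 * n) * ρ x) := by
  by_cases hx : x ∈ tsupport ρ
  · rw [h.hil_eq hx, show x ^ (2 * n) = x * x ^ (2 * n - 1) by
      rw [← pow_succ']; congr 1; omega]
    ring
  · simp [image_eq_zero_of_notMem_tsupport hx]

lemma energy_potential (ρ : ℝ → ℝ) : energy (potential n v) ρ = v * ∫ x, x ^ (2 * n) * ρ x := by
  rw [energy, ← integral_const_mul]
  congr 1
  ext x
  rw [potential]
  ring

/-- The virial identity. -/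
lemma IsSaddleSolution.virial (h : IsSaddleSolution (potential n v) T μ ρ) (hn : 2 ≤ n) :
    μ + n * energy (potential n v) ρ / T = 1 / 2 := by
  have hρ := h.hol
  have i2 := (hρ.integrable_pow_mul 2).const_mul μ
  have i3 := (hρ.integrable_pow_mul (2 * n)).const_mul (n * v / T)
  have key : ∫ x, x * ρ x * Hil ρ x = μ + n * energy (potential n v) ρ / T := by
    simp_rw [h.mul_hil_eq hn]
    rw [integral_add i2 i3, integral_const_mul, integral_const_mul, energy_potential]
    have : ∫ x, x ^ 2 * ρ x = 1 := by simp_rw [mul_comm _ (ρ _)]; exact h.sphere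
    rw [this]
    ring
  have hint : Integrable fun x => x * ρ x * Hil ρ x := by
    refine (i2.add i3).congr (Eventually.of_forall fun x => ?_)
    exact (h.mul_hil_eq hn x).symm
  -- Antisymmetry for `ρ` and `x ρ` reproduces the integral with opposite sign, plus the unit mass
  -- from `hil_id_mul`; hence the value `1/2`.
  have h1 := hρ.integral_mul_hil hρ.id_mul
  simp_rw [hil_id_mul hρ, h.mass] at h1
  have h2 : ∀ x, ρ x * (x * Hil ρ x - 1) = x * ρ x * Hil ρ x - ρ x := fun x => by ring
  simp_rw [h2] at h1
  rw [integral_sub hint hρ.integrable, h.mass] at h1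
  rw [← key]
  linarith

lemma IsSaddleSolution.energy_eq (h : IsSaddleSolution (potential n v) T μ ρ) (hn : 2 ≤ n)
    (hT : 0 < T) : energy (potential n v) ρ = T / n * (1 / 2 - μ) := by
  have := h.virial hn
  have hn1 := one_lt_cast hn
  field_simp at this ⊢
  linarith

/-- Integrating the equilibrium condition `hℓ` against `ρ` evaluates the double logarithmic
integral, and the virial identity removes the energy; only `μ` and `ℓ` remain. -/
lemma IsSaddleSolution.action_eq (h : IsSaddleSolution (potential n v) T μ ρ) (hn : 2 ≤ n)
    (hT : 0 < T)
    (hℓ : ∀ x ∈ tsupport ρ, 2 * logPot ρ x = μ * x ^ 2 + v / T * x ^ (2 * n) + ℓ) :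
    action (potential n v) T⁻¹ ρ = 1 / 2 * ((1 / 2 - μ) / n - μ - ℓ) := by
  have hρ := h.hol
  have hn1 := one_lt_cast hn
  have e : ∀ x, ρ x * ∫ y, ρ y * Real.log |x ^ 2 - y ^ 2| =
      μ * (x ^ 2 * ρ x) + v / T * (x ^ (2 * n) * ρ x) + ℓ * ρ x := by
    intro x
    rw [← two_mul_logPot hρ h.even]
    by_cases hx : x ∈ tsupport ρ
    · rw [hℓ x hx]; ring
    · simp [image_eq_zero_of_notMem_tsupport hx]
  have i2 := (hρ.integrable_pow_mul 2).const_mul μ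
  have i3 := (hρ.integrable_pow_mul (2 * n)).const_mul (v / T)
  have hs : ∫ x, x ^ 2 * ρ x = 1 := by simp_rw [mul_comm _ (ρ _)]; exact h.sphere
  have hE := h.energy_eq hn hT
  have hE2 := energy_potential (n := n) (v := v) ρ
  have hV : v / T * ∫ x, x ^ (2 * n) * ρ x = (1 / 2 - μ) / n := by
    rw [div_mul_eq_mul_div, ← hE2, hE]
    field_simp
  rw [action]
  simp_rw [e]
  have i23 : Integrable fun x => μ * (x ^ 2 * ρ x) + v / T * (x ^ (2 * n) * ρ x) := i2.add i3
  rw [integral_add i23 (hρ.integrable.const_mul ℓ), integral_add i2 i3, integral_const_mul,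
    integral_const_mul, integral_const_mul, hs, h.mass, hV, hE]
  field_simp
  ring

/-- The logarithmic potential on the cut of a density with a two-term Hilbert transform. -/
lemma Hol.logPot_eq (hf : Hol f) (hr : 0 < r) (h0 : ∀ x ∉ Ioo (c - r) (c + r), f x = 0)
    (hm : ∫ x, f x = 1) {i k : ℕ} (hH : ∀ x ∈ Ioo (c - r) (c + r), Hil f x = μ * x ^ i + γ * x ^ k)
    {x : ℝ} (hx : x ∈ Icc (c - r) (c + r)) :
    logPot f x = μ / (i + 1) * x ^ (i + 1) + γ / (k + 1) * x ^ (k + 1) + (Real.log (r / 2)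
      - μ / (i + 1) * mom c r (i + 1) - γ / (k + 1) * mom c r (k + 1)) := by
  have hHc : ∀ x ∈ Icc (c - r) (c + r), Hil f x = μ * x ^ i + γ * x ^ k := by
    have hcl : closure (Ioo (c - r) (c + r)) ⊆ {x | Hil f x = μ * x ^ i + γ * x ^ k} :=
      closure_minimal hH (isClosed_eq hf.continuous_hil (by fun_prop))
    rwa [closure_Ioo (by linarith)] at hcl
  have hcm : c ∈ Icc (c - r) (c + r) := ⟨by linarith, by linarith⟩
  set A : ℝ → ℝ := fun x => μ / (i + 1) * x ^ (i + 1) + γ / (k + 1) * x ^ (k + 1) with hA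
  -- Integrating the transform determines the potential up to a constant, which the arcsine average
  -- then fixes.
  have h1 : ∀ x ∈ Icc (c - r) (c + r), logPot f x = A x + (logPot f c - A c) := by
    intro x hx
    have h2 := hf.integral_hil c x
    have hcongr : ∫ x in c..x, Hil f x = ∫ x in c..x, (μ * x ^ i + γ * x ^ k) :=
      intervalIntegral.integral_congr fun z hz => hHc z (uIcc_subset_Icc hcm hx hz)
    rw [hcongr, intervalIntegral.integral_add (Continuous.intervalIntegrable (by fun_prop) _ _)
      (Continuous.intervalIntegrable (by fun_prop) _ _), intervalIntegral.integral_const_mul,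
      intervalIntegral.integral_const_mul, integral_pow, integral_pow] at h2
    simp only [hA]
    linear_combination -h2
  have h3 := hf.integral_logPot_arcsine hr h0
  have h4 : ∫ θ in (0 : ℝ)..Real.pi, logPot f (c + r * Real.cos θ) =
      ∫ θ in (0 : ℝ)..Real.pi, (μ / (i + 1) * (c + r * Real.cos θ) ^ (i + 1)
        + γ / (k + 1) * (c + r * Real.cos θ) ^ (k + 1)
        + (logPot f c - A c) * (c + r * Real.cos θ) ^ 0) := by
    refine intervalIntegral.integral_congr fun θ _ => ?_
    have := Real.neg_one_le_cos θ
    have := Real.cos_le_one θ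
    simp only [pow_zero, mul_one]
    exact h1 _ ⟨by nlinarith, by nlinarith⟩
  rw [h4, integral_arcsine_combination, hm, mom_zero, mul_assoc] at h3
  have h5 := mul_left_cancel₀ Real.pi_ne_zero h3
  rw [h1 x hx]
  simp only [hA] at h5 ⊢
  linear_combination h5

/-- The ratio of the potential and Lagrange multiplier contributions to a single cut. -/
def sOne (n : ℕ) (y : ℝ) : ℝ := (4 - y) * (n + 1) / (y * (n - 1))

/-- The action of the single-cut solution on `[-√y, √y]`. -/
def actOne (n : ℕ) (y : ℝ) : ℝ := 1 / 2 * ((1 / 2 - muOne n y) / n - muOne n y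
  - (Real.log (y / 4) - 1 + sOne n y - sOne n y / n))

/-- The action of the two-cut solution with radius to center ratio `u`. -/
def actTwo (n : ℕ) (u : ℝ) : ℝ := 1 / 2 * ((1 / 2 - muTwo n u) / n - muTwo n u
  - (Real.log (cen n u * u / 2) - muTwo n u * cen n u - (1 - cen n u * muTwo n u) / n))

lemma action_rhoOne (hn : 2 ≤ n) (hv : 0 < v) (hT : 0 < T) (hτ : τ = T / (n * v)) :
    action (potential n v) T⁻¹ (rhoOne n τ) = actOne n (ySol n τ) := by
  have hn1 := one_lt_cast hn
  have hτ0 : 0 < τ := by rw [hτ]; positivity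
  have hy := ySol_mem hn hτ0
  have hs := Real.sqrt_pos.2 hy.1
  obtain ⟨ha, hsupp, h⟩ := isSingleCut_rhoOne hn hv hT hτ
  have hγ : n * v / T = τ⁻¹ := by rw [hτ, inv_div]
  have hcond := (isSingleCut_iff hn hv hT).1 (isSingleCut_rhoOne hn hv hT hτ)
  have hc := hcond.2.1
  rw [Real.sq_sqrt hy.1.le, hγ] at hc
  have hsy : τ⁻¹ * cb n * ySol n τ ^ n = sOne n (ySol n τ) := by
    have h1 := hc.2
    have h2 : muOne n (ySol n τ) * ySol n τ = 2 - 2 * sOne n (ySol n τ) := by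
      rw [muOne, ← sOne, div_mul_cancel₀ _ hy.1.ne']
    rw [h2] at h1
    linarith
  have hmy : muOne n (ySol n τ) * ySol n τ = 2 - 2 * sOne n (ySol n τ) := by rw [hc.2, hsy]
  refine h.action_eq hn hT fun x hx => ?_
  rw [hsupp] at hx
  have hz := h.hol.eq_zero_of_notMem_Ioo hsupp.subset
  have hl := h.hol.logPot_eq (c := 0) (r := √(ySol n τ)) hs (by simpa using hz) h.mass
    (fun x hx => h.hil_eq (by
      rw [hsupp]; rw [zero_sub, zero_add] at hx; exact Ioo_subset_Icc_self hx)) (by simpa using hx)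
  have e : 2 * n - 1 + 1 = 2 * n := by omega
  have e' : ((2 * n - 1 : ℕ) : ℝ) + 1 = 2 * n := by
    rw [← Nat.cast_add_one, e]; push_cast; ring
  rw [hl, e, e', show 1 + 1 = 2 * 1 by rfl, mom_even, mom_even, Real.sq_sqrt hy.1.le, hγ]
  have hcb1 : cb 1 = 1 / 2 := by
    have := cb_succ 0
    rw [cb_zero] at this
    norm_num at this
    linarith
  have hlog : Real.log (ySol n τ / 4) = 2 * Real.log (√(ySol n τ) / 2) := by
    rw [← Real.log_rpow (by positivity)]
    congr 1
    norm_num [div_pow, Real.sq_sqrt hy.1.le]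
  have hvT : v / T = τ⁻¹ / n := by rw [← hγ]; field_simp
  rw [hlog, hcb1, ← hsy, hvT]
  rw [← hsy] at hmy
  push_cast
  field_simp
  field_simp at hmy
  linear_combination (-(n : ℝ)) * hmy

lemma action_rhoTwo (hn : 2 ≤ n) (hv : 0 < v) (hT : 0 < T) (hτ : τ = T / (n * v))
    (hlt : τ < tauC n) :
    action (potential n v) T⁻¹ (rhoTwo n τ) = actTwo n (uSol n τ) := by
  have hn1 := one_lt_cast hn
  have hτ0 : 0 < τ := by rw [hτ]; positivity
  have hγ : n * v / T = τ⁻¹ := by rw [hτ, inv_div]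
  obtain ⟨hu, ht, -⟩ := uSol_spec hn ⟨hτ0, hlt⟩
  have hcen := cen_pos hn hu.1 hu.2.le
  have hcond := twoCutCond_sol hn ⟨hτ0, hlt⟩
  obtain ⟨a, b, hab, -, -⟩ := isTwoCut_rhoTwo hn hv hT hτ hlt
  have h := hab.2.2.2
  rw [actTwo]
  have hdef : rhoTwo n τ = fun x => |x| * cutDensity (cen n (uSol n τ)) (cen n (uSol n τ) * uSol n τ)
    (muTwo n (uSol n τ)) τ⁻¹ 0 (n - 1) (x ^ 2) := by ext x; rfl
  set c := cen n (uSol n τ) with hc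
  set u := uSol n τ with hudef
  have hr : 0 < c * u := mul_pos hcen hu.1
  have hrc : c * u < c := mul_lt_of_lt_one_right hcen hu.2
  set σ : ℝ → ℝ := cutDensity c (c * u) (muTwo n u) τ⁻¹ 0 (n - 1) with hσ
  have hσ0 : ∀ t ∉ Ioo (c - c * u) (c + c * u), σ t = 0 := fun t ht => cutDensity_eq_zero hr ht
  have hsq : SquareDensity (rhoTwo n τ) σ := by
    rw [hdef]
    exact SquareDensity.of_abs_mul fun t ht => hσ0 t fun h => by linarith [h.1]
  have hm : ∫ t, σ t = 1 := by
    have := hsq.integral fun _ => 1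
    simp only [mul_one] at this
    rw [← this, h.mass]
  have hH : ∀ x ∈ Ioo (c - c * u) (c + c * u), Hil σ x = muTwo n u * x ^ 0 + τ⁻¹ * x ^ (n - 1) := by
    intro x hx
    rw [hσ, hil_cutDensity hr hx, mom_zero, hcond.1]
    ring
  refine h.action_eq hn hT fun x hx => ?_
  have hx2 : x ^ 2 ∈ Icc (c - c * u) (c + c * u) := by
    have hcl : tsupport (rhoTwo n τ) ⊆ {x | x ^ 2 ∈ Icc (c - c * u) (c + c * u)} := by
      refine closure_minimal (fun x hx => ?_) (isClosed_Icc.preimage (continuous_pow 2))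
      by_contra h'
      refine hx ?_
      rw [hdef]
      simp only
      rw [hσ0 _ fun h'' => h' (Ioo_subset_Icc_self h''), mul_zero]
    exact hcl hx
  have hl := (hol_cutDensity hr : Hol σ).logPot_eq hr hσ0 hm hH hx2
  rw [hsq.logPot_eq h.hol, hl, Nat.sub_add_cancel (by omega)]
  have e' : ((n - 1 : ℕ) : ℝ) + 1 = n := by
    rw [← Nat.cast_add_one, Nat.sub_add_cancel (by omega)]
  have hvT : v / T = τ⁻¹ / n := by rw [← hγ]; field_simp
  have hmn : τ⁻¹ * mom c (c * u) n = 1 - c * muTwo n u := by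
    have h1 := hcond.2.1
    have h2 := hcond.1
    linear_combination h1 + c * h2
  rw [e', hvT, zero_add, mom_one, pow_one, pow_mul, ← hmn]
  push_cast
  ring

end SphericalMatrix

/-! ### Gluing the two branches at the critical point. -/

namespace SphericalMatrix

variable {n : ℕ} {y u τ : ℝ} {p q : ℝ → ℝ} {p' q' : ℝ}

/-- A function of `T / (n v)` given in terms of the two-cut parameter below the critical value and
of the single-cut parameter above it. -/
def glue (n : ℕ) (p q : ℝ → ℝ) (τ : ℝ) : ℝ := if τ < tauC n then p (uSol n τ) else q (ySol n τ)

lemma glue_of_lt (h : τ < tauC n) : glue n p q τ = p (uSol n τ) := if_pos h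

lemma glue_of_le (h : tauC n ≤ τ) : glue n p q τ = q (ySol n τ) := if_neg (not_lt.2 h)

lemma glue_eventuallyEq_lt (h : τ < tauC n) : glue n p q =ᶠ[𝓝 τ] fun τ => p (uSol n τ) := by
  filter_upwards [Iio_mem_nhds h] with t ht using glue_of_lt ht

lemma glue_eventuallyEq_gt (h : tauC n < τ) : glue n p q =ᶠ[𝓝 τ] fun τ => q (ySol n τ) := by
  filter_upwards [Ioi_mem_nhds h] with t ht using glue_of_le (le_of_lt ht)

/-- The inverse is taken over the open interval, so its value at `tauC n` carries no information.
Strict monotonicity of `tauTwo` up to and including `u = 1` yields the one-sided limit. -/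
lemma tendsto_uSol (hn : 2 ≤ n) : Tendsto (uSol n) (𝓝[<] tauC n) (𝓝 1) := by
  have hT := tauC_pos hn
  refine tendsto_order.2 ⟨fun a ha => ?_, fun a ha => ?_⟩
  · set b := max a (1 / 2) with hb
    have hb1 : b ∈ Ioo 0 1 := ⟨by positivity, by rw [hb]; exact max_lt ha (by norm_num)⟩
    have hlt : tauTwo n b < tauC n := by
      rw [← tauTwo_one hn]
      exact strictMonoOn_tauTwo hn (Ioo_subset_Ioc_self hb1) ⟨one_pos, le_rfl⟩ hb1.2
    filter_upwards [Ioo_mem_nhdsLT hlt] with τ hτ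
    have hs := uSol_spec hn ⟨(tauTwo_pos hn hb1.1 hb1.2.le).trans hτ.1, hτ.2⟩
    have h1 : tauTwo n b < tauTwo n (uSol n τ) := by rw [hs.2.1]; exact hτ.1
    exact (le_max_left _ _).trans_lt (((strictMonoOn_tauTwo hn).lt_iff_lt (Ioo_subset_Ioc_self hb1)
      (Ioo_subset_Ioc_self hs.1)).1 h1)
  · filter_upwards [Ioo_mem_nhdsLT hT] with τ hτ
    exact (uSol_spec hn hτ).1.2.trans ha

lemma tendsto_glue_left (hn : 2 ≤ n) (hp : ContinuousAt p 1) :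
    Tendsto (glue n p q) (𝓝[<] tauC n) (𝓝 (p 1)) := by
  refine (hp.tendsto.comp (tendsto_uSol hn)).congr' ?_
  filter_upwards [self_mem_nhdsWithin] with τ hτ
  exact (glue_of_lt hτ).symm

lemma tendsto_glue_right (hn : 2 ≤ n) (hq : ContinuousAt q (yC n)) :
    Tendsto (glue n p q) (𝓝[>] tauC n) (𝓝 (q (yC n))) := by
  have hy := (hasDerivAt_ySol hn (tauC_pos hn)).continuousAt
  have h1 : Tendsto (ySol n) (𝓝[>] tauC n) (𝓝 (yC n)) := by
    rw [← ySol_tauC hn]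
    exact hy.tendsto.mono_left nhdsWithin_le_nhds
  refine (hq.tendsto.comp h1).congr' ?_
  filter_upwards [self_mem_nhdsWithin] with τ hτ
  exact (glue_of_le (le_of_lt hτ)).symm

lemma continuousAt_glue_tauC (hn : 2 ≤ n) (hp : ContinuousAt p 1) (hq : ContinuousAt q (yC n))
    (h : p 1 = q (yC n)) : ContinuousAt (glue n p q) (tauC n) := by
  have e : glue n p q (tauC n) = q (yC n) := by rw [glue_of_le le_rfl, ySol_tauC hn]
  rw [continuousAt_iff_continuous_left'_right', ContinuousWithinAt, ContinuousWithinAt, e]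
  exact ⟨h ▸ tendsto_glue_left hn hp, tendsto_glue_right hn hq⟩

lemma hasDerivAt_glue_lt (hn : 2 ≤ n) (hτ : τ ∈ Ioo 0 (tauC n)) (hp : HasDerivAt p p' (uSol n τ)) :
    HasDerivAt (glue n p q) (p' * (tauTwoDeriv n (uSol n τ))⁻¹) τ :=
  (hp.comp τ (uSol_spec hn hτ).2.2).congr_of_eventuallyEq (glue_eventuallyEq_lt hτ.2)

lemma hasDerivAt_glue_gt (hn : 2 ≤ n) (hτ : tauC n < τ) (hq : HasDerivAt q q' (ySol n τ)) :
    HasDerivAt (glue n p q) (q' * (tauOneDeriv n (ySol n τ))⁻¹) τ :=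
  (hq.comp τ (hasDerivAt_ySol hn ((tauC_pos hn).trans hτ))).congr_of_eventuallyEq
    (glue_eventuallyEq_gt hτ)

lemma continuousAt_glue_lt (hn : 2 ≤ n) (hτ : τ ∈ Ioo 0 (tauC n))
    (hp : ContinuousAt p (uSol n τ)) : ContinuousAt (glue n p q) τ :=
  (ContinuousAt.comp (f := uSol n) hp (uSol_spec hn hτ).2.2.continuousAt).congr
    (glue_eventuallyEq_lt hτ.2).symm

lemma continuousAt_glue_gt (hn : 2 ≤ n) (hτ : tauC n < τ)
    (hq : ContinuousAt q (ySol n τ)) : ContinuousAt (glue n p q) τ :=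
  (ContinuousAt.comp (f := ySol n) hq
    (hasDerivAt_ySol hn ((tauC_pos hn).trans hτ)).continuousAt).congr
    (glue_eventuallyEq_gt hτ).symm

/-! ### The single-cut branch -/

/-- The derivative of the energy along the single-cut branch. -/
def capOne (y : ℝ) : ℝ := 1 / 2 + 8 / y ^ 2 - 4 / y

def capOneDeriv (y : ℝ) : ℝ := 4 / y ^ 2 - 16 / y ^ 3

def muOneDeriv (n : ℕ) (y : ℝ) : ℝ :=
  -(2 / y ^ 2) - 2 * ((n + 1) / (n - 1)) * (1 / y ^ 2 - 8 / y ^ 3)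

lemma hasDerivAt_muOne (hn : 2 ≤ n) (hy : y ≠ 0) :
    HasDerivAt (muOne n) (muOneDeriv n y) y := by
  have hn1 := one_lt_cast hn
  have hn0 : (n : ℝ) - 1 ≠ 0 := by linarith
  have hd : HasDerivAt (fun y : ℝ => 4 - y) (-1) y := by
    simpa using (hasDerivAt_id y).const_sub 4
  have h := (((((hd.mul_const ((n : ℝ) + 1)).div ((hasDerivAt_id y).mul_const ((n : ℝ) - 1))
    (mul_ne_zero hy hn0))).const_mul 2).const_sub 2).div (hasDerivAt_id y) hy
  refine h.congr_deriv ?_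
  rw [muOneDeriv]
  simp only [id, Pi.div_apply]
  field_simp
  ring

lemma hasDerivAt_capOne (hy : y ≠ 0) : HasDerivAt capOne (capOneDeriv y) y := by
  have h := (((hasDerivAt_pow 2 y).fun_inv (pow_ne_zero 2 hy)).const_mul 8).sub
    ((hasDerivAt_inv hy).const_mul 4)
  have h2 := h.const_add (1 / 2)
  have e : capOne = fun x => 1 / 2 + (8 * (x ^ 2)⁻¹ - 4 * x⁻¹) := by
    ext x; rw [capOne]; ring
  rw [e]
  refine h2.congr_deriv ?_
  rw [capOneDeriv]
  push_cast
  field_simp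
  ring

/-- The left side is the `τ`-derivative of `τ (1/2 - μ)` along the branch, by the inverse function
rule. The result no longer involves `n`. -/
lemma energy_deriv_single (hn : 2 ≤ n) (hy : y ∈ Ioo 0 4) :
    (1 / 2 - muOne n y) + tauOne n y * -(muOneDeriv n y * (tauOneDeriv n y)⁻¹) = capOne y := by
  have hn1 := one_lt_cast hn
  have ht := tauOne_pos hn hy
  have e1 : (n : ℝ) - 1 ≠ 0 := by linarith
  have e2 : (4 : ℝ) - y ≠ 0 := by linarith [hy.2]
  have e3 : (4 : ℝ) * n + 4 - n * y ≠ 0 := by nlinarith [hy.2]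
  have e4 := hy.1.ne'
  rw [tauOneDeriv, muOneDeriv, muOne, capOne]
  obtain ⟨w, hw⟩ : ∃ w, w = (4 : ℝ) * n + 4 - n * y := ⟨_, rfl⟩
  rw [← hw] at e3 ⊢
  field_simp
  rw [hw]
  ring

/-- This is `F' = E` in the branch parameter: division by `tauOneDeriv` gives `dF/dτ = -(1/2 - μ) /
(n τ)`. -/
lemma hasDerivAt_actOne (hn : 2 ≤ n) (hy : y ∈ Ioo 0 4) :
    HasDerivAt (actOne n) (-((1 / 2 - muOne n y) / (n * tauOne n y)) * tauOneDeriv n y) y := by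
  have hn1 := one_lt_cast hn
  have ht := (tauOne_pos hn hy).ne'
  have e1 : (n : ℝ) - 1 ≠ 0 := by linarith
  have e2 : (4 : ℝ) - y ≠ 0 := by linarith [hy.2]
  have e4 := hy.1.ne'
  have hd : HasDerivAt (fun y : ℝ => 4 - y) (-1) y := by
    simpa using (hasDerivAt_id y).const_sub 4
  have hs : HasDerivAt (sOne n) _ y := (hd.mul_const ((n : ℝ) + 1)).div
    ((hasDerivAt_id y).mul_const ((n : ℝ) - 1)) (mul_ne_zero e4 e1)
  have hl := ((hasDerivAt_id y).div_const 4).log (div_ne_zero e4 four_ne_zero)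
  have hm := hasDerivAt_muOne hn e4
  have h := ((((hm.const_sub (1 / 2)).div_const (n : ℝ)).sub hm).sub
    (((hl.sub_const 1).add hs).sub (hs.div_const (n : ℝ)))).const_mul (1 / 2)
  refine h.congr_deriv ?_
  rw [muOneDeriv, muOne, tauOneDeriv]
  simp only [id]
  field_simp
  ring

/-! ### The two-cut branch -/

/-- The derivative of the energy along the two-cut branch. -/
def capTwo (n : ℕ) (u : ℝ) : ℝ := 1 / 2 + 2 * (1 - cen n u) / (cen n u * u) ^ 2

def capTwoDeriv (n : ℕ) (u : ℝ) : ℝ :=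
  (2 * -cenDeriv n u * (cen n u * u) ^ 2
    - 2 * (1 - cen n u) * (2 * (cen n u * u) * (cenDeriv n u * u + cen n u)))
    / ((cen n u * u) ^ 2) ^ 2

lemma hasDerivAt_capTwo (hn : 2 ≤ n) (h0 : 0 < u) (h1 : u ≤ 1) :
    HasDerivAt (capTwo n) (capTwoDeriv n u) u := by
  have hc := cen_pos hn h0 h1
  have hd := hasDerivAt_cen hn h0 h1
  have hcu := (hd.mul (hasDerivAt_id u)).pow 2
  have h := (((hd.const_sub 1).const_mul 2).div hcu (by simp; exact ⟨hc.ne', h0.ne'⟩)).const_add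
    (1 / 2)
  refine h.congr_deriv ?_
  rw [capTwoDeriv]
  simp

/-- A form of `muTwo` without powers. -/
lemma muTwo_eq (hn : 2 ≤ n) (h0 : 0 < u) (h1 : u ≤ 1) :
    muTwo n u = -(n / (n - 1) * (pP n u / (cen n u * pD n u))) := by
  have hn1 := one_lt_cast hn
  have hc := cen_pos hn h0 h1
  have hD := pD_pos hn h0 h1
  have hp : cen n u ^ n = cen n u ^ (n - 1) * cen n u := by
    rw [← pow_succ]; congr 1; omega
  have e1 : (n : ℝ) - 1 ≠ 0 := by linarith
  rw [muTwo, tauTwo, hp]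
  field_simp

def muTwoDeriv (n : ℕ) (u : ℝ) : ℝ :=
  -(n / (n - 1) * (((n - 1) * (pP n u - pQ n u) / u * (cen n u * pD n u)
    - pP n u * (cenDeriv n u * pD n u + cen n u * (n * u * pQ n u))) / (cen n u * pD n u) ^ 2))

lemma hasDerivAt_muTwo (hn : 2 ≤ n) (h0 : 0 < u) (h1 : u ≤ 1) :
    HasDerivAt (muTwo n) (muTwoDeriv n u) u := by
  have hn1 := one_lt_cast hn
  have hc := (cen_pos hn h0 h1).ne'
  have hD := (pD_pos hn h0 h1).ne'
  have ht := (tauTwo_pos hn h0 h1).ne'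
  -- All powers of the center are written through the exponent `n - 2`, the lowest one produced by
  -- differentiation, and then cancelled.
  have hp : cen n u ^ (n - 1) = cen n u ^ (n - 2) * cen n u := by
    rw [← pow_succ]; congr 1; omega
  have hp2 : cen n u ^ n = cen n u ^ (n - 2) * cen n u ^ 2 := by
    rw [← pow_add]; congr 1; omega
  have e1 : (n : ℝ) - 1 ≠ 0 := by linarith
  have hn2 : ((n - 1 : ℕ) : ℝ) = n - 1 := by push_cast [show 1 ≤ n by omega]; ring
  have hτ : HasDerivAt (tauTwo n) _ u := ((hasDerivAt_cen hn h0 h1).pow n).mul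
    ((hasDerivAt_pD hn h0.ne').const_mul (((n : ℝ) - 1) / n))
  have h := ((((hasDerivAt_cen hn h0 h1).pow (n - 1)).mul (hasDerivAt_pP hn h0.ne')).div hτ ht).neg
  refine h.congr_deriv ?_
  simp only [Pi.pow_apply, Pi.mul_apply]
  rw [show n - 1 - 1 = n - 2 by omega, hn2, muTwoDeriv, tauTwo, hp, hp2]
  have hz : cen n u ^ (n - 2) ≠ 0 := pow_ne_zero _ hc
  generalize cen n u ^ (n - 2) = z at *
  field_simp
  ring

/-- The counterpart of `energy_deriv_single`. The derivative formulas have absorbed the moment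
recurrence, so a polynomial identity in `P`, `Q` and `u` remains. -/
lemma energy_deriv_two (hn : 2 ≤ n) (h0 : 0 < u) (h1 : u ≤ 1) :
    (1 / 2 - muTwo n u) + tauTwo n u * -(muTwoDeriv n u * (tauTwoDeriv n u)⁻¹) = capTwo n u := by
  have hn1 := one_lt_cast hn
  have hc := (cen_pos hn h0 h1).ne'
  have hD := (pD_pos hn h0 h1).ne'
  have hG := (pG_pos hn h0 h1).ne'
  have hΔ := (pDelta_pos hn h0 h1).ne'
  have e1 : (n : ℝ) - 1 ≠ 0 := by linarith
  have hp : cen n u ^ n = cen n u ^ (n - 1) * cen n u := by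
    rw [← pow_succ]; congr 1; omega
  have hz : cen n u ^ (n - 1) ≠ 0 := pow_ne_zero _ hc
  rw [muTwo_eq hn h0 h1, muTwoDeriv, tauTwoDeriv, tauTwo, capTwo, hp]
  generalize cen n u ^ (n - 1) = z at *
  rw [cenDeriv, cen] at *
  have d1 : pG n u = 2 * pD n u + u ^ 2 * pP n u := rfl
  have d2 : pD n u = pP n u - (1 - u ^ 2) * pQ n u := rfl
  have d3 : pDelta n u = u ^ 2 * pQ n u ^ 2 - (pP n u - pQ n u) ^ 2 := rfl
  have hu := h0.ne'
  field_simp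
  rw [d3, d1, d2]
  ring

lemma hasDerivAt_actTwo (hn : 2 ≤ n) (h0 : 0 < u) (h1 : u ≤ 1) :
    HasDerivAt (actTwo n) (-((1 / 2 - muTwo n u) / (n * tauTwo n u)) * tauTwoDeriv n u) u := by
  have hn1 := one_lt_cast hn
  have hc := (cen_pos hn h0 h1).ne'
  have hD := (pD_pos hn h0 h1).ne'
  have hG := (pG_pos hn h0 h1).ne'
  have hu := h0.ne'
  have hm := hasDerivAt_muTwo hn h0 h1
  have hcd := hasDerivAt_cen hn h0 h1
  have hl := ((hcd.mul (hasDerivAt_id u)).div_const 2).log (by simp; exact ⟨hc, hu⟩)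
  have h := ((((hm.const_sub (1 / 2)).div_const (n : ℝ)).sub hm).sub
    ((hl.sub (hm.mul hcd)).sub (((hcd.mul hm).const_sub 1).div_const (n : ℝ)))).const_mul (1 / 2)
  refine h.congr_deriv ?_
  have e1 : (n : ℝ) - 1 ≠ 0 := by linarith
  have hp : cen n u ^ n = cen n u ^ (n - 1) * cen n u := by
    rw [← pow_succ]; congr 1; omega
  have hz : cen n u ^ (n - 1) ≠ 0 := pow_ne_zero _ hc
  simp only [Pi.mul_apply, id]
  rw [muTwo_eq hn h0 h1, muTwoDeriv, tauTwoDeriv, tauTwo, hp]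
  generalize cen n u ^ (n - 1) = z at *
  rw [cenDeriv, cen] at *
  have d1 : pG n u = 2 * pD n u + u ^ 2 * pP n u := rfl
  have d2 : pD n u = pP n u - (1 - u ^ 2) * pQ n u := rfl
  have d3 : pDelta n u = u ^ 2 * pQ n u ^ 2 - (pP n u - pQ n u) ^ 2 := rfl
  field_simp
  rw [d3, d1, d2]
  ring

end SphericalMatrix

namespace SphericalMatrix

/-! ### Regularity from explicit derivatives -/

section Calculus

variable {E F f f' g g₂ : ℝ → ℝ} {s : Set ℝ} {Tc Lp Lm x : ℝ}

lemma contDiffOn_succ_of_hasDerivAt (hs : IsOpen s) (h : ∀ x ∈ s, HasDerivAt f (f' x) x) {k : ℕ}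
    (hf' : ContDiffOn ℝ k f' s) : ContDiffOn ℝ (k + 1 : ℕ) f s := by
  rw [Nat.cast_add_one, contDiffOn_succ_iff_deriv_of_isOpen hs]
  refine ⟨fun x hx => (h x hx).differentiableAt.differentiableWithinAt, by simp, ?_⟩
  exact hf'.congr fun x hx => (h x hx).deriv

lemma contDiffOn_one_of_hasDerivAt (hs : IsOpen s) (h : ∀ x ∈ s, HasDerivAt f (f' x) x)
    (hf' : ∀ x ∈ s, ContinuousAt f' x) : ContDiffOn ℝ (1 : ℕ) f s :=
  contDiffOn_succ_of_hasDerivAt (k := 0) hs h (by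
    rw [Nat.cast_zero, contDiffOn_zero]
    exact fun x hx => (hf' x hx).continuousWithinAt)

/-- A derivative known off a point and extending continuously to it is attained there; this carries
the formulas across the critical point. -/
lemma hasDerivAt_of_eventually_ne (h : ∀ᶠ y in 𝓝[≠] x, HasDerivAt f (g y) y)
    (hf : ContinuousAt f x) (hg : ContinuousAt g x) : HasDerivAt f (g x) x := by
  set s : Set ℝ := {y | HasDerivAt f (g y) y} with hs
  have hd : DifferentiableOn ℝ f s := fun y hy =>
    (HasDerivAt.differentiableAt hy).differentiableWithinAt
  have hr : s ∈ 𝓝[>] x := nhdsWithin_mono x (fun y (hy : x < y) => hy.ne') h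
  have hl : s ∈ 𝓝[<] x := nhdsWithin_mono x (fun y (hy : y < x) => hy.ne) h
  have A : HasDerivWithinAt f (g x) (Ici x) x :=
    hasDerivWithinAt_Ici_of_tendsto_deriv hd hf.continuousWithinAt hr
      ((hg.tendsto.mono_left nhdsWithin_le_nhds).congr' (by
        filter_upwards [hr] with y hy using (HasDerivAt.deriv hy).symm))
  have B : HasDerivWithinAt f (g x) (Iic x) x :=
    hasDerivWithinAt_Iic_of_tendsto_deriv hd hf.continuousWithinAt hl
      ((hg.tendsto.mono_left nhdsWithin_le_nhds).congr' (by
        filter_upwards [hl] with y hy using (HasDerivAt.deriv hy).symm))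
  simpa using B.union A

/-- A `C¹` function on the half-line whose second derivative has a jump. -/
lemma jump_second_deriv (hTc : 0 < Tc) (h1 : ∀ T, 0 < T → HasDerivAt E (g T) T)
    (hg : ∀ T, 0 < T → ContinuousAt g T) (h2 : ∀ T, 0 < T → T ≠ Tc → HasDerivAt g (g₂ T) T)
    (hg2 : ∀ T, 0 < T → T ≠ Tc → ContinuousAt g₂ T) (hp : Tendsto g₂ (𝓝[>] Tc) (𝓝 Lp))
    (hm : Tendsto g₂ (𝓝[<] Tc) (𝓝 Lm)) :
    ContDiffOn ℝ (1 : ℕ) E (Ioi 0) ∧ ContDiffOn ℝ (2 : ℕ) E (Ioo 0 Tc) ∧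
      ContDiffOn ℝ (2 : ℕ) E (Ioi Tc) ∧ Tendsto (iteratedDeriv 2 E) (𝓝[>] Tc) (𝓝 Lp) ∧
      Tendsto (iteratedDeriv 2 E) (𝓝[<] Tc) (𝓝 Lm) := by
  have hE : ∀ T, 0 < T → deriv E =ᶠ[𝓝 T] g := fun T hT => by
    filter_upwards [Ioi_mem_nhds hT] with x hx using (h1 x hx).deriv
  have hE2 : ∀ T, 0 < T → T ≠ Tc → iteratedDeriv 2 E T = g₂ T := fun T hT hne => by
    rw [iteratedDeriv_succ', iteratedDeriv_one, (hE T hT).deriv_eq, (h2 T hT hne).deriv]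
  refine ⟨contDiffOn_one_of_hasDerivAt isOpen_Ioi h1 hg, ?_, ?_, ?_, ?_⟩
  · exact contDiffOn_succ_of_hasDerivAt isOpen_Ioo (fun x hx => h1 x hx.1)
      (contDiffOn_one_of_hasDerivAt isOpen_Ioo (fun x hx => h2 x hx.1 hx.2.ne)
        fun x hx => hg2 x hx.1 hx.2.ne)
  · exact contDiffOn_succ_of_hasDerivAt isOpen_Ioi (fun x hx => h1 x (hTc.trans hx))
      (contDiffOn_one_of_hasDerivAt isOpen_Ioi (fun x hx => h2 x (hTc.trans hx) (ne_of_gt hx))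
        fun x hx => hg2 x (hTc.trans hx) (ne_of_gt hx))
  · refine hp.congr' ?_
    filter_upwards [self_mem_nhdsWithin] with x hx using (hE2 x (hTc.trans hx) (ne_of_gt hx)).symm
  · refine hm.congr' ?_
    filter_upwards [Ioo_mem_nhdsLT hTc] with x hx using (hE2 x hx.1 hx.2.ne).symm

/-- The free energy as a function of the inverse temperature inherits the jump, one order up. -/
lemma jump_third_deriv (hTc : 0 < Tc) (hF : ∀ β, 0 < β → HasDerivAt F (E β⁻¹) β)
    (h1 : ∀ T, 0 < T → HasDerivAt E (g T) T)
    (hg : ∀ T, 0 < T → ContinuousAt g T) (h2 : ∀ T, 0 < T → T ≠ Tc → HasDerivAt g (g₂ T) T)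
    (hg2 : ∀ T, 0 < T → T ≠ Tc → ContinuousAt g₂ T) (hp : Tendsto g₂ (𝓝[>] Tc) (𝓝 Lp))
    (hm : Tendsto g₂ (𝓝[<] Tc) (𝓝 Lm)) (hne : Lp ≠ Lm) :
    ContDiffOn ℝ (2 : ℕ) F (Ioi 0) ∧ ContDiffOn ℝ (3 : ℕ) F (Ioo 0 Tc⁻¹) ∧
      ContDiffOn ℝ (3 : ℕ) F (Ioi Tc⁻¹) ∧ ∃ Mp Mm : ℝ,
      Tendsto (iteratedDeriv 3 F) (𝓝[>] Tc⁻¹) (𝓝 Mp) ∧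
      Tendsto (iteratedDeriv 3 F) (𝓝[<] Tc⁻¹) (𝓝 Mm) ∧ Mp ≠ Mm := by
  have hβ := inv_pos.2 hTc
  have hinv : ∀ β : ℝ, 0 < β → HasDerivAt (fun x : ℝ => x⁻¹) (-(β ^ 2)⁻¹) β := fun β hβ =>
    hasDerivAt_inv hβ.ne'
  have d1 : ∀ β, 0 < β → HasDerivAt (fun β => E β⁻¹) (g β⁻¹ * -(β ^ 2)⁻¹) β := fun β hβ =>
    (h1 _ (inv_pos.2 hβ)).comp β (hinv β hβ)
  have hci : ∀ β : ℝ, 0 < β → ContinuousAt (fun β : ℝ => β⁻¹) β := fun β hβ =>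
    continuousAt_inv₀ hβ.ne'
  have c1 : ∀ β, 0 < β → ContinuousAt (fun β => g β⁻¹ * -(β ^ 2)⁻¹) β := fun β hβ =>
    (ContinuousAt.comp (f := fun β : ℝ => β⁻¹) (hg _ (inv_pos.2 hβ)) (hci β hβ)).mul
      ((continuousAt_id.pow 2).inv₀ (pow_ne_zero 2 hβ.ne')).neg
  have hne' : ∀ β : ℝ, β ≠ Tc⁻¹ → β⁻¹ ≠ Tc := fun β h h' => h (by rw [← h', inv_inv])
  have d2 : ∀ β, 0 < β → β ≠ Tc⁻¹ → HasDerivAt (fun β => g β⁻¹ * -(β ^ 2)⁻¹)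
      (g₂ β⁻¹ * (β ^ 4)⁻¹ + 2 * g β⁻¹ * (β ^ 3)⁻¹) β := fun β hβ hb => by
    have h := ((h2 _ (inv_pos.2 hβ) (hne' β hb)).comp β (hinv β hβ)).mul
      (((hasDerivAt_pow 2 β).fun_inv (pow_ne_zero 2 hβ.ne')).neg)
    refine h.congr_deriv ?_
    simp only [Function.comp, Pi.neg_apply]
    push_cast
    field_simp
  have hpc : ∀ k : ℕ, ∀ β : ℝ, 0 < β → ContinuousAt (fun β : ℝ => (β ^ k)⁻¹) β := fun k β hβ =>
    (continuousAt_id.pow k).inv₀ (pow_ne_zero k hβ.ne')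
  have c2 : ∀ β, 0 < β → β ≠ Tc⁻¹ → ContinuousAt
      (fun β => g₂ β⁻¹ * (β ^ 4)⁻¹ + 2 * g β⁻¹ * (β ^ 3)⁻¹) β := fun β hβ hb =>
    ((ContinuousAt.comp (f := fun β : ℝ => β⁻¹) (hg2 _ (inv_pos.2 hβ) (hne' β hb)) (hci β hβ)).mul
      (hpc 4 β hβ)).add ((continuousAt_const.mul (ContinuousAt.comp (f := fun β : ℝ => β⁻¹)
        (hg _ (inv_pos.2 hβ)) (hci β hβ))).mul (hpc 3 β hβ))
  have hlim : ∀ (l : Filter ℝ) (L : ℝ), l ≤ 𝓝 Tc⁻¹ → Tendsto (fun β => g₂ β⁻¹) l (𝓝 L) →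
      Tendsto (fun β => g₂ β⁻¹ * (β ^ 4)⁻¹ + 2 * g β⁻¹ * (β ^ 3)⁻¹) l
        (𝓝 (L * (Tc⁻¹ ^ 4)⁻¹ + 2 * g Tc * (Tc⁻¹ ^ 3)⁻¹)) := fun l L hl h => by
    have h3 : Tendsto (fun β => g β⁻¹) l (𝓝 (g Tc)) := by
      have : ContinuousAt (fun β => g β⁻¹) Tc⁻¹ :=
        ContinuousAt.comp (f := fun β : ℝ => β⁻¹) (hg _ (inv_pos.2 hβ)) (hci _ hβ)
      have := this.tendsto.mono_left hl
      simpa using this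
    exact (h.mul ((hpc 4 _ hβ).tendsto.mono_left hl)).add
      ((h3.const_mul 2).mul ((hpc 3 _ hβ).tendsto.mono_left hl))
  -- Inversion exchanges the sides: `β` above `Tc⁻¹` corresponds to `T` below `Tc`.
  have ip : Tendsto (fun β : ℝ => β⁻¹) (𝓝[>] Tc⁻¹) (𝓝[<] Tc) := by
    refine tendsto_nhdsWithin_iff.2 ⟨?_, ?_⟩
    · have := (hci _ hβ).tendsto.mono_left (nhdsWithin_le_nhds (s := Ioi Tc⁻¹))
      simpa using this
    · filter_upwards [self_mem_nhdsWithin] with β hb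
      exact inv_lt_of_inv_lt₀ hTc hb
  have im : Tendsto (fun β : ℝ => β⁻¹) (𝓝[<] Tc⁻¹) (𝓝[>] Tc) := by
    refine tendsto_nhdsWithin_iff.2 ⟨?_, ?_⟩
    · have := (hci _ hβ).tendsto.mono_left (nhdsWithin_le_nhds (s := Iio Tc⁻¹))
      simpa using this
    · filter_upwards [Ioo_mem_nhdsLT hβ] with β hb
      exact (lt_inv_comm₀ hb.1 hTc).1 hb.2
  obtain ⟨r1, r2, r3, r4, r5⟩ := jump_second_deriv hβ d1 c1 d2 c2
    (hlim _ _ nhdsWithin_le_nhds (hm.comp ip)) (hlim _ _ nhdsWithin_le_nhds (hp.comp im))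
  have hiter : ∀ β, 0 < β → iteratedDeriv 2 (fun β => E β⁻¹) β = iteratedDeriv 3 F β := by
    intro β hβ
    rw [iteratedDeriv_succ' (n := 2)]
    refine (Filter.EventuallyEq.iteratedDeriv_eq 2 ?_).symm
    filter_upwards [Ioi_mem_nhds hβ] with x hx using (hF x hx).deriv
  refine ⟨contDiffOn_succ_of_hasDerivAt isOpen_Ioi hF r1,
    contDiffOn_succ_of_hasDerivAt isOpen_Ioo (fun x hx => hF x hx.1) r2,
    contDiffOn_succ_of_hasDerivAt isOpen_Ioi (fun x hx => hF x (hβ.trans hx)) r3, _, _,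
    r4.congr' ?_, r5.congr' ?_, fun h => hne ?_⟩
  · filter_upwards [self_mem_nhdsWithin] with x hx using hiter x (hβ.trans hx)
  · filter_upwards [Ioo_mem_nhdsLT hβ] with x hx using hiter x hx.1
  -- The limits of `F'''` are `Tc ^ 4` times those of `g₂`, plus the same continuous term.
  · have h4 : (Tc⁻¹ ^ 4)⁻¹ ≠ 0 := by positivity
    exact (mul_right_cancel₀ h4 (add_right_cancel h)).symm

end Calculus

/-! ### The thermodynamic functions in terms of `T / (n v)` -/

variable {n : ℕ} {y u τ : ℝ}

def multTau (n : ℕ) : ℝ → ℝ := glue n (muTwo n) (muOne n)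

/-- The energy divided by `v`. -/
def enTau (n : ℕ) (τ : ℝ) : ℝ := τ * (1 / 2 - multTau n τ)

def capTau (n : ℕ) : ℝ → ℝ := glue n (capTwo n) capOne

def capTauDeriv (n : ℕ) : ℝ → ℝ := glue n (fun u => capTwoDeriv n u * (tauTwoDeriv n u)⁻¹)
  (fun y => capOneDeriv y * (tauOneDeriv n y)⁻¹)

def actTau (n : ℕ) : ℝ → ℝ := glue n (actTwo n) (actOne n)

lemma yC_eq (hn : 2 ≤ n) : yC n = 2 * cen n 1 := by
  rw [cen_one hn, yC]; ring

lemma pD_one : pD n 1 = pP n 1 := by simp [pD]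

lemma muTwo_one (hn : 2 ≤ n) : muTwo n 1 = -(3 * n ^ 2 / (2 * (n - 1) * (n + 1))) := by
  have hn1 := one_lt_cast hn
  have hP := (pP_pos (n := n) one_pos le_rfl).ne'
  have e1 : (n : ℝ) - 1 ≠ 0 := by linarith
  rw [muTwo_eq hn one_pos le_rfl, cen_one hn, pD_one]
  field_simp

lemma muOne_yC (hn : 2 ≤ n) : muOne n (yC n) = -(3 * n ^ 2 / (2 * (n - 1) * (n + 1))) := by
  have hn1 := one_lt_cast hn
  have e1 : (n : ℝ) - 1 ≠ 0 := by linarith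
  rw [muOne, yC]
  field_simp
  ring

lemma muTwo_one_eq (hn : 2 ≤ n) : muTwo n 1 = muOne n (yC n) := by
  rw [muTwo_one hn, muOne_yC hn]

/-- Agreement of the energy derivatives where the branches meet: this makes the energy `C¹` there
and postpones the discontinuity to the next order. -/
lemma capTwo_one_eq (hn : 2 ≤ n) : capTwo n 1 = capOne (yC n) := by
  have hc := cen_pos hn one_pos le_rfl
  rw [capTwo, capOne, yC_eq hn]
  field_simp
  ring

lemma actTwo_one_eq (hn : 2 ≤ n) : actTwo n 1 = actOne n (yC n) := by
  have hn1 := one_lt_cast hn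
  have e1 : (n : ℝ) - 1 ≠ 0 := by linarith
  have hlog : Real.log (cen n 1 * 1 / 2) = Real.log (yC n / 4) := by
    rw [yC_eq hn]; congr 1; ring
  rw [actTwo, actOne, hlog, muTwo_one hn, muOne_yC hn, cen_one hn, sOne, yC]
  field_simp
  ring

lemma eventually_off_tauC (hn : 2 ≤ n) {Q : ℝ → Prop} (h : ∀ τ, 0 < τ → τ ≠ tauC n → Q τ) :
    ∀ᶠ τ in 𝓝[≠] tauC n, Q τ := by
  filter_upwards [self_mem_nhdsWithin, nhdsWithin_le_nhds (Ioi_mem_nhds (tauC_pos hn))] with τ h1 h2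
  exact h τ h2 h1

lemma continuousAt_glue (hn : 2 ≤ n) {p q p' q' : ℝ → ℝ}
    (hp : ∀ u, 0 < u → u ≤ 1 → HasDerivAt p (p' u) u)
    (hq : ∀ y ∈ Ioo (0 : ℝ) 4, HasDerivAt q (q' y) y)
    (h : p 1 = q (yC n)) (hτ : 0 < τ) : ContinuousAt (glue n p q) τ := by
  rcases lt_trichotomy τ (tauC n) with hlt | rfl | hgt
  · have hu := (uSol_spec hn ⟨hτ, hlt⟩).1
    exact continuousAt_glue_lt hn ⟨hτ, hlt⟩ (hp _ hu.1 hu.2.le).continuousAt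
  · exact continuousAt_glue_tauC hn (hp 1 one_pos le_rfl).continuousAt
      (hq _ (yC_mem hn)).continuousAt h
  · exact continuousAt_glue_gt hn hgt (hq _ (ySol_mem hn hτ)).continuousAt

lemma continuousAt_multTau (hn : 2 ≤ n) (hτ : 0 < τ) : ContinuousAt (multTau n) τ :=
  continuousAt_glue hn (fun _ h0 h1 => hasDerivAt_muTwo hn h0 h1)
    (fun _ hy => hasDerivAt_muOne hn hy.1.ne') (muTwo_one_eq hn) hτ

lemma continuousAt_capTau (hn : 2 ≤ n) (hτ : 0 < τ) : ContinuousAt (capTau n) τ :=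
  continuousAt_glue hn (fun _ h0 h1 => hasDerivAt_capTwo hn h0 h1)
    (fun _ hy => hasDerivAt_capOne hy.1.ne') (capTwo_one_eq hn) hτ

lemma continuousAt_actTau (hn : 2 ≤ n) (hτ : 0 < τ) : ContinuousAt (actTau n) τ :=
  continuousAt_glue hn (fun _ h0 h1 => hasDerivAt_actTwo hn h0 h1)
    (fun _ hy => hasDerivAt_actOne hn hy) (actTwo_one_eq hn) hτ

lemma hasDerivAt_capTau (hn : 2 ≤ n) (hτ : 0 < τ) (hne : τ ≠ tauC n) :
    HasDerivAt (capTau n) (capTauDeriv n τ) τ := by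
  rcases hne.lt_or_gt with hlt | hgt
  · have hu := (uSol_spec hn ⟨hτ, hlt⟩).1
    rw [capTauDeriv, glue_of_lt hlt]
    exact hasDerivAt_glue_lt hn ⟨hτ, hlt⟩ (hasDerivAt_capTwo hn hu.1 hu.2.le)
  · rw [capTauDeriv, glue_of_le (le_of_lt hgt)]
    exact hasDerivAt_glue_gt hn hgt (hasDerivAt_capOne (ySol_mem hn hτ).1.ne')

lemma hasDerivAt_enTau (hn : 2 ≤ n) (hτ : 0 < τ) : HasDerivAt (enTau n) (capTau n τ) τ := by
  have key : ∀ τ, 0 < τ → τ ≠ tauC n → HasDerivAt (enTau n) (capTau n τ) τ := by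
    intro τ hτ hne
    rcases hne.lt_or_gt with hlt | hgt
    · obtain ⟨hu, ht, -⟩ := uSol_spec hn ⟨hτ, hlt⟩
      have h := (hasDerivAt_id τ).mul ((hasDerivAt_glue_lt (q := muOne n) hn ⟨hτ, hlt⟩
        (hasDerivAt_muTwo hn hu.1 hu.2.le)).const_sub (1 / 2))
      refine h.congr_deriv ?_
      rw [capTau, glue_of_lt hlt, glue_of_lt hlt, ← energy_deriv_two hn hu.1 hu.2.le, ht]
      simp
    · have hy := ySol_mem hn hτ
      have h := (hasDerivAt_id τ).mul ((hasDerivAt_glue_gt (p := muTwo n) hn hgt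
        (hasDerivAt_muOne hn hy.1.ne')).const_sub (1 / 2))
      refine h.congr_deriv ?_
      rw [capTau, glue_of_le (le_of_lt hgt), glue_of_le (le_of_lt hgt), ← energy_deriv_single hn hy,
        tauOne_ySol hn hτ]
      simp
  by_cases hne : τ = tauC n
  · subst hne
    exact hasDerivAt_of_eventually_ne (eventually_off_tauC hn key)
      (continuousAt_id.mul (continuousAt_const.sub (continuousAt_multTau hn hτ)))
      (continuousAt_capTau hn hτ)
  · exact key τ hτ hne

lemma hasDerivAt_actTau (hn : 2 ≤ n) (hτ : 0 < τ) :
    HasDerivAt (actTau n) (-((1 / 2 - multTau n τ) / (n * τ))) τ := by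
  have hn1 := one_lt_cast hn
  have key : ∀ τ, 0 < τ → τ ≠ tauC n →
      HasDerivAt (actTau n) (-((1 / 2 - multTau n τ) / (n * τ))) τ := by
    intro τ hτ hne
    rcases hne.lt_or_gt with hlt | hgt
    · obtain ⟨hu, ht, -⟩ := uSol_spec hn ⟨hτ, hlt⟩
      refine (hasDerivAt_glue_lt hn ⟨hτ, hlt⟩ (hasDerivAt_actTwo hn hu.1 hu.2.le)).congr_deriv ?_
      rw [mul_inv_cancel_right₀ (tauTwoDeriv_pos hn hu.1 hu.2.le).ne', ht, multTau, glue_of_lt hlt]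
    · have hy := ySol_mem hn hτ
      refine (hasDerivAt_glue_gt hn hgt (hasDerivAt_actOne hn hy)).congr_deriv ?_
      rw [mul_inv_cancel_right₀ (tauOneDeriv_pos hn hy).ne', tauOne_ySol hn hτ, multTau,
        glue_of_le (le_of_lt hgt)]
  by_cases hne : τ = tauC n
  · subst hne
    refine hasDerivAt_of_eventually_ne (g := fun τ => -((1 / 2 - multTau n τ) / (n * τ)))
      (eventually_off_tauC hn key) (continuousAt_actTau hn hτ) ?_
    exact ((continuousAt_const.sub (continuousAt_multTau hn hτ)).div
      (continuousAt_const.mul continuousAt_id) (mul_pos (by linarith) hτ).ne').neg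
  · exact key τ hτ hne

lemma continuousAt_capTwoDeriv_div (hn : 2 ≤ n) (h0 : 0 < u) (h1 : u ≤ 1) :
    ContinuousAt (fun u => capTwoDeriv n u * (tauTwoDeriv n u)⁻¹) u := by
  have hG := (pG_pos hn h0 h1).ne'
  have hc := (cen_pos hn h0 h1).ne'
  have kP : ContinuousAt (pP n) u := (hasDerivAt_pP hn h0.ne').continuousAt
  have kD : ContinuousAt (pD n) u := (hasDerivAt_pD hn h0.ne').continuousAt
  have kG : ContinuousAt (pG n) u := (hasDerivAt_pG hn h0.ne').continuousAt
  have kc : ContinuousAt (cen n) u := (hasDerivAt_cen hn h0 h1).continuousAt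
  have kQ : ContinuousAt (pQ n) u := (continuous_mom (n - 2)).continuousAt
  have ku : ContinuousAt (fun u : ℝ => u) u := continuousAt_id
  have kG2 : ContinuousAt (fun u => (pG n u ^ 2)⁻¹) u := (kG.pow 2).inv₀ (pow_ne_zero 2 hG)
  have kcd : ContinuousAt (cenDeriv n) u := by
    unfold cenDeriv
    simp only [div_eq_mul_inv]
    fun_prop
  have kΔ : ContinuousAt (pDelta n) u := by
    unfold pDelta
    fun_prop
  have kt : ContinuousAt (tauTwoDeriv n) u := by
    unfold tauTwoDeriv
    simp only [div_eq_mul_inv]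
    fun_prop
  have kcu : ContinuousAt (fun u => (((cen n u * u) ^ 2) ^ 2)⁻¹) u :=
    (((kc.mul ku).pow 2).pow 2).inv₀
      (pow_ne_zero 2 (pow_ne_zero 2 (mul_ne_zero hc h0.ne')))
  have kcap : ContinuousAt (capTwoDeriv n) u := by
    unfold capTwoDeriv
    simp only [div_eq_mul_inv]
    fun_prop
  exact kcap.mul (kt.inv₀ (tauTwoDeriv_pos hn h0 h1).ne')

lemma continuousAt_capOneDeriv_div (hn : 2 ≤ n) (hy : y ∈ Ioo 0 4) :
    ContinuousAt (fun y => capOneDeriv y * (tauOneDeriv n y)⁻¹) y := by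
  have hy0 := hy.1.ne'
  have e2 : (4 : ℝ) - y ≠ 0 := by linarith [hy.2]
  have kt : ContinuousAt (tauOneDeriv n) y := by
    unfold tauOneDeriv
    have k1 : ContinuousAt (tauOne n) y := (hasDerivAt_tauOne hy).continuousAt
    exact (k1.mul (by fun_prop)).div (by fun_prop) (mul_ne_zero hy0 e2)
  have kc : ContinuousAt capOneDeriv y := by
    unfold capOneDeriv
    exact (continuousAt_const.div (continuousAt_id.pow 2) (pow_ne_zero 2 hy0)).sub
      (continuousAt_const.div (continuousAt_id.pow 3) (pow_ne_zero 3 hy0))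
  exact kc.mul (kt.inv₀ (tauOneDeriv_pos hn hy).ne')

lemma continuousAt_capTauDeriv (hn : 2 ≤ n) (hτ : 0 < τ) (hne : τ ≠ tauC n) :
    ContinuousAt (capTauDeriv n) τ := by
  rcases hne.lt_or_gt with hlt | hgt
  · have hu := (uSol_spec hn ⟨hτ, hlt⟩).1
    exact continuousAt_glue_lt hn ⟨hτ, hlt⟩ (continuousAt_capTwoDeriv_div hn hu.1 hu.2.le)
  · exact continuousAt_glue_gt hn hgt (continuousAt_capOneDeriv_div hn (ySol_mem hn hτ))

/-- At `u = 1` the recurrence loses a term and gives `P = (2n - 3) / (n - 1) Q`. Multiplication by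
`tauC n` cancels the power of the center and the scale of `Q`, leaving a rational function of `n`.
-/
lemma capTauDeriv_left (hn : 2 ≤ n) : tauC n * (capTwoDeriv n 1 * (tauTwoDeriv n 1)⁻¹) =
    3 * (n - 2) * (7 - 2 * n) / (n + 1) ^ 3 := by
  have hn1 := one_lt_cast hn
  have e1 : (n : ℝ) - 1 ≠ 0 := by linarith
  have e3 : (2 : ℝ) * n - 3 ≠ 0 := by
    have : (2 : ℝ) ≤ n := by exact_mod_cast hn
    linarith
  have hQ := (pQ_pos (n := n) one_pos le_rfl).ne'
  have hPQ : pP n 1 = (2 * n - 3) / (n - 1) * pQ n 1 := by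
    obtain ⟨m, rfl⟩ : ∃ m, n = m + 2 := ⟨n - 2, by omega⟩
    have h := mom_rec' 1 m
    rw [pP, pQ, show m + 2 - 1 = m + 1 by omega, Nat.add_sub_cancel]
    push_cast at e1 ⊢
    field_simp
    linear_combination h
  have hp : cen n 1 ^ n = cen n 1 ^ (n - 1) * cen n 1 := by
    rw [← pow_succ]; congr 1; omega
  have hz : cen n 1 ^ (n - 1) ≠ 0 := pow_ne_zero _ (cen_pos hn one_pos le_rfl).ne'
  have hG : pG n 1 = 3 * pP n 1 := by rw [pG, pD_one]; ring
  have hΔ : pDelta n 1 = pQ n 1 ^ 2 * ((2 * n - 3) / (n - 1) ^ 2) := by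
    rw [pDelta, hPQ]
    field_simp
    ring
  rw [← tauTwo_one hn, tauTwo, hp, tauTwoDeriv, capTwoDeriv, hΔ]
  generalize cen n 1 ^ (n - 1) = z at *
  rw [cenDeriv, hG, pD_one, cen_one hn, hPQ]
  generalize pQ n 1 = q at *
  field_simp
  ring

lemma capTauDeriv_right (hn : 2 ≤ n) : tauC n * (capOneDeriv (yC n) * (tauOneDeriv n (yC n))⁻¹) =
    -(3 * (2 * n - 1) ^ 2 / (2 * (n + 1) ^ 3)) := by
  have hn1 := one_lt_cast hn
  have ht := (tauC_pos hn).ne'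
  have e1 : (2 : ℝ) * n - 1 ≠ 0 := by linarith
  have h4 : (4 : ℝ) - yC n = 4 * (2 * n - 1) / (3 * n) := by
    rw [yC]; field_simp; ring
  have h5 : (4 : ℝ) * n + 4 - n * yC n = 8 * (n + 1) / 3 := by
    rw [yC]; field_simp; ring
  rw [tauOneDeriv, tauOne_yC hn, h4, h5, capOneDeriv, yC]
  field_simp
  ring

lemma tendsto_capTauDeriv_left (hn : 2 ≤ n) : Tendsto (capTauDeriv n) (𝓝[<] tauC n)
    (𝓝 (3 * (n - 2) * (7 - 2 * n) / (n + 1) ^ 3 / tauC n)) := by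
  rw [← capTauDeriv_left hn, mul_div_cancel_left₀ _ (tauC_pos hn).ne']
  exact tendsto_glue_left hn (continuousAt_capTwoDeriv_div hn one_pos le_rfl)

lemma tendsto_capTauDeriv_right (hn : 2 ≤ n) : Tendsto (capTauDeriv n) (𝓝[>] tauC n)
    (𝓝 (-(3 * (2 * n - 1) ^ 2 / (2 * (n + 1) ^ 3)) / tauC n)) := by
  rw [← capTauDeriv_right hn, mul_div_cancel_left₀ _ (tauC_pos hn).ne']
  exact tendsto_glue_right hn (continuousAt_capOneDeriv_div hn (yC_mem hn))

end SphericalMatrix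

/-! ### The critical temperature as a function of `n`. -/

namespace SphericalMatrix

variable {n : ℕ}

lemma Gamma_add_half (m : ℕ) : Real.Gamma (m + 1 / 2) = √Real.pi * m.factorial * cb m := by
  induction m with
  | zero => rw [Nat.cast_zero, zero_add, Real.Gamma_one_half_eq, cb_zero]; simp
  | succ m ih =>
    have h := cb_succ m
    rw [Nat.factorial_succ, show ((m + 1 : ℕ) : ℝ) + 1 / 2 = (m + 1 / 2) + 1 by push_cast; ring,
      Real.Gamma_add_one (by positivity), ih]
    push_cast
    linear_combination (-(√Real.pi * m.factorial / 2)) * h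

lemma criticalTemp_eq (hn : 2 ≤ n) (v : ℝ) : criticalTemp n v = n * v * tauC n := by
  obtain ⟨m, rfl⟩ : ∃ m, n = m + 2 := ⟨n - 2, by omega⟩
  have h1 := Gamma_add_half (m + 1)
  have h2 := cb_succ (m + 1)
  have e1 : ((m + 2 : ℕ) : ℝ) - 1 / 2 = ((m + 1 : ℕ) : ℝ) + 1 / 2 := by push_cast; ring
  have e2 : ((m + 2 : ℕ) : ℝ) - 1 = m + 1 := by push_cast; ring
  have e3 : (4 : ℝ) / 3 * (1 + 1 / ((m + 2 : ℕ) : ℝ)) =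
      4 * (((m + 2 : ℕ) : ℝ) + 1) / (3 * ((m + 2 : ℕ) : ℝ)) := by
    push_cast; field_simp
  have hcb : cb (m + 2) = (2 * m + 3) * cb (m + 1) / (2 * (m + 2)) := by
    rw [eq_div_iff (by positivity)]
    push_cast at h2
    linear_combination h2
  rw [criticalTemp, tauC, e1, h1, e2, Real.Gamma_nat_eq_factorial, e3, Nat.factorial_succ, hcb]
  generalize (4 * (((m + 2 : ℕ) : ℝ) + 1) / (3 * ((m + 2 : ℕ) : ℝ))) ^ (m + 2) = z
  have hf : (m.factorial : ℝ) ≠ 0 := by positivity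
  have hpi : √Real.pi ≠ 0 := by positivity
  push_cast
  have e4 : (2 : ℝ) * (m + 2) - 1 = 2 * m + 3 := by ring
  rw [e4]
  have e5 : (2 : ℝ) * m + 3 ≠ 0 := by positivity
  field_simp

lemma criticalTemp_pos (hn : 2 ≤ n) {v : ℝ} (hv : 0 < v) : 0 < criticalTemp n v := by
  have hn1 := one_lt_cast hn
  have := tauC_pos hn
  rw [criticalTemp_eq hn]
  positivity

lemma criticalTemp_two (v : ℝ) : criticalTemp 2 v = v := by
  have h0 := cb_succ 0
  have h1 := cb_succ 1
  rw [cb_zero] at h0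
  norm_num at h0 h1
  have : cb 2 = 3 / 8 := by linarith
  rw [criticalTemp_eq le_rfl, tauC, this]
  norm_num
  ring

/-- From `n` to `n + 1` the rational factor rises from `(n - 1) / (2n - 1)` to `1/2`, with `n cb n`
common to both. The powers compare by Bernoulli's inequality, because `w / x = 1 - 1 / (n + 1)²`. -/
lemma mul_tauC_lt_succ (hn : 2 ≤ n) : n * tauC n < (n + 1 : ℕ) * tauC (n + 1) := by
  have hn1 := one_lt_cast hn
  have hn0 : (0 : ℝ) < n := by linarith
  have hcb := cb_pos n
  have h := cb_succ n
  have hcb' : cb (n + 1) = (2 * n + 1) * cb n / (2 * (n + 1)) := by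
    rw [eq_div_iff (by positivity)]; linarith
  set x : ℝ := 4 * (n + 1) / (3 * n) with hx
  set w : ℝ := 4 * ((n + 1 : ℕ) + 1) / (3 * (n + 1 : ℕ)) with hw
  have hx0 : 0 < x := by positivity
  have hw0 : 0 < w := by positivity
  have hb : 1 - n * (1 / ((n : ℝ) + 1) ^ 2) ≤ (w / x) ^ n := by
    have hwx : w / x = 1 + -(1 / ((n : ℝ) + 1) ^ 2) := by
      rw [hw, hx]
      push_cast
      field_simp
      ring
    have h2 : (-2 : ℝ) ≤ -(1 / ((n : ℝ) + 1) ^ 2) := by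
      have : 1 / ((n : ℝ) + 1) ^ 2 ≤ 1 := by
        rw [div_le_one (by positivity)]
        nlinarith
      linarith
    have := one_add_mul_le_pow h2 n
    rw [hwx]
    linarith
  have hge : x ^ n ≤ w ^ (n + 1) := by
    have h3 : 1 ≤ w * (w / x) ^ n := by
      refine le_trans ?_ (mul_le_mul_of_nonneg_left hb hw0.le)
      rw [hw]
      push_cast
      have e : 4 * ((n : ℝ) + 1 + 1) / (3 * (n + 1)) * (1 - n * (1 / ((n : ℝ) + 1) ^ 2)) =
          4 * (n + 2) * (n ^ 2 + n + 1) / (3 * (n + 1) ^ 3) := by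
        field_simp
        ring
      rw [e, one_le_div (by positivity)]
      nlinarith [pow_pos hn0 2, pow_pos hn0 3]
    rw [div_pow, ← mul_div_assoc, one_le_div (by positivity)] at h3
    rw [pow_succ']
    exact h3
  have e1 : (0 : ℝ) < 2 * n - 1 := by linarith
  have e2 : (0 : ℝ) < n - 1 := by linarith
  have f1 : n * tauC n = cb n * n * ((n - 1) / (2 * n - 1)) * x ^ n := by
    rw [tauC, ← hx]; ring
  have f2 : (n + 1 : ℕ) * tauC (n + 1) = cb n * n * (1 / 2) * w ^ (n + 1) := by
    rw [tauC, ← hw, hcb']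
    push_cast
    have : (2 : ℝ) * (n + 1) - 1 = 2 * n + 1 := by ring
    rw [this]
    field_simp
    ring
  rw [f1, f2]
  refine mul_lt_mul (mul_lt_mul_of_pos_left ?_ (by positivity)) hge (by positivity) (by positivity)
  rw [div_lt_iff₀ e1]
  linarith

lemma strictMonoOn_criticalTemp {v : ℕ → ℝ} (hv : ∀ n, 2 ≤ n → 0 < v n) :
    StrictMonoOn (fun n : ℕ => criticalTemp n (v n) / v n) (Ici 2) := by
  have e : ∀ n, 2 ≤ n → criticalTemp n (v n) / v n = n * tauC n := fun n hn => by
    have := (hv n hn).ne'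
    rw [criticalTemp_eq hn]
    field_simp
  have h : StrictMono fun m : ℕ => ((m + 2 : ℕ) : ℝ) * tauC (m + 2) :=
    strictMono_nat_of_lt_succ fun m => mul_tauC_lt_succ (n := m + 2) (by omega)
  intro a ha b hb hab
  simp only [mem_Ici] at ha hb
  simp only
  rw [e a ha, e b hb]
  have := h (show a - 2 < b - 2 by omega)
  simpa only [Nat.sub_add_cancel ha, Nat.sub_add_cancel hb] using this

/-- The sequence is the reciprocal of Wallis' product. -/
lemma tendsto_cb : Tendsto (fun n : ℕ => cb n ^ 2 * (2 * n + 1)) atTop (𝓝 (2 / Real.pi)) := by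
  have h : ∀ n : ℕ, cb n ^ 2 * (2 * n + 1) = (Real.Wallis.W n)⁻¹ := by
    intro n
    induction n with
    | zero => simp [cb_zero, Real.Wallis.W]
    | succ n ih =>
      have h := cb_succ n
      have hcb' : cb (n + 1) = (2 * n + 1) * cb n / (2 * (n + 1)) := by
        rw [eq_div_iff (by positivity)]; linarith
      rw [Real.Wallis.W_succ, mul_inv, ← ih, hcb']
      push_cast
      field_simp
      ring
  simp_rw [h]
  have := Real.Wallis.tendsto_W_nhds_pi_div_two.inv₀ (by positivity)
  rwa [inv_div] at this

lemma isEquivalent_criticalTemp {v : ℕ → ℝ} (hv : ∀ n, 2 ≤ n → 0 < v n) :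
    (fun n : ℕ => criticalTemp n (v n)) ~[atTop]
      (fun n : ℕ => v n * Real.sqrt (n * Real.exp 1 ^ 2 / (4 * Real.pi)) * (4 / 3) ^ n) := by
  refine isEquivalent_of_tendsto_one ?_
  have hx : Tendsto (fun n : ℕ => 1 / (n : ℝ)) atTop (𝓝 0) := tendsto_one_div_atTop_nhds_zero_nat
  have hexp := Real.tendsto_one_add_div_pow_exp 1
  have hrat : Tendsto (fun n : ℕ => (1 - 1 / (n : ℝ)) ^ 2 /
      ((2 - 1 / (n : ℝ)) ^ 2 * (2 + 1 / (n : ℝ)))) atTop (𝓝 (1 / 8)) := by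
    have := ((hx.const_sub 1).pow 2).div (((hx.const_sub 2).pow 2).mul (hx.const_add 2))
      (by norm_num)
    have h8 : ((1 - 0) ^ 2 / ((2 - 0) ^ 2 * (2 + 0)) : ℝ) = 1 / 8 := by norm_num
    rw [← h8]
    exact this
  -- For `n ≥ 2` the quotient of the two sequences is the square root of three factors: the square
  -- of `(1 + 1/n)^n / e`, the Wallis factor, and a rational function of `1/n`.
  have hsq := (((hexp.div_const (Real.exp 1)).pow 2).mul (tendsto_cb.mul
    (hrat.const_mul (4 * Real.pi)))).sqrt
  have hone : √((Real.exp 1 / Real.exp 1) ^ 2 * (2 / Real.pi * (4 * Real.pi * (1 / 8)))) = 1 := by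
    rw [div_self (Real.exp_ne_zero 1)]
    have : (2 / Real.pi * (4 * Real.pi * (1 / 8))) = 1 := by field_simp; norm_num
    rw [this]
    norm_num
  rw [hone] at hsq
  refine hsq.congr' ?_
  filter_upwards [eventually_ge_atTop 2] with n hn
  have hn1 := one_lt_cast hn
  have hn0 : (0 : ℝ) < n := by linarith
  have hvn := (hv n hn).ne'
  have hcb := cb_pos n
  have e1 : (0 : ℝ) < 2 * n - 1 := by linarith
  have e2 : (0 : ℝ) < n - 1 := by linarith
  set z : ℝ := (1 + 1 / (n : ℝ)) ^ n with hz
  have hz0 : 0 < z := by positivity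
  have hx : (4 * ((n : ℝ) + 1) / (3 * n)) ^ n = (4 / 3) ^ n * z := by
    rw [hz, ← mul_pow]
    congr 1
    field_simp
  have hs : √(n * Real.exp 1 ^ 2 / (4 * Real.pi)) ≠ 0 := by positivity
  rw [Pi.div_apply, criticalTemp_eq hn, tauC, hx]
  have e4 : n * v n * (cb n * ((4 / 3) ^ n * z) * ((n - 1) / (2 * n - 1))) /
      (v n * √(n * Real.exp 1 ^ 2 / (4 * Real.pi)) * (4 / 3) ^ n) =
      n * cb n * z * ((n - 1) / (2 * n - 1)) / √(n * Real.exp 1 ^ 2 / (4 * Real.pi)) := by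
    field_simp
  rw [e4, Real.sqrt_eq_iff_mul_self_eq_of_pos (by positivity), ← sq, div_pow,
    Real.sq_sqrt (by positivity)]
  have e5 : (2 : ℝ) - 1 / n = (2 * n - 1) / n := by field_simp
  rw [e5]
  field_simp

end SphericalMatrix

/-! ### Return to the physical temperature. -/

namespace SphericalMatrix

variable {n : ℕ} {v T τ μ : ℝ} {ρ : ℝ → ℝ}

/-- The non-negative saddle point density as a function of `T / (n v)`. -/
def rhoTau (n : ℕ) (τ : ℝ) : ℝ → ℝ := if τ < tauC n then rhoTwo n τ else rhoOne n τ

lemma isSaddleDensity_iff (hn : 2 ≤ n) (hv : 0 < v) (hT : 0 < T) (hτ : τ = T / (n * v)) :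
    IsSaddleDensity (potential n v) T μ ρ ↔ μ = multTau n τ ∧ ρ = rhoTau n τ := by
  rcases lt_or_ge τ (tauC n) with h | h
  · rw [isSaddleDensity_iff_two hn hv hT hτ h, multTau, glue_of_lt h, rhoTau, if_pos h]
  · rw [isSaddleDensity_iff_single hn hv hT hτ h, multTau, glue_of_le h, rhoTau,
      if_neg (not_lt.2 h)]

lemma energy_rhoTau (hn : 2 ≤ n) (hv : 0 < v) (hT : 0 < T) :
    energy (potential n v) (rhoTau n (T / (n * v))) = v * enTau n (T / (n * v)) := by
  have hn1 := one_lt_cast hn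
  have h := ((isSaddleDensity_iff hn hv hT rfl).2 ⟨rfl, rfl⟩).1
  rw [h.energy_eq hn hT, enTau]
  field_simp

lemma action_rhoTau (hn : 2 ≤ n) (hv : 0 < v) (hT : 0 < T) :
    action (potential n v) T⁻¹ (rhoTau n (T / (n * v))) = actTau n (T / (n * v)) := by
  rcases lt_or_ge (T / (n * v)) (tauC n) with h | h
  · rw [rhoTau, if_pos h, action_rhoTwo hn hv hT rfl h, actTau, glue_of_lt h]
  · rw [rhoTau, if_neg (not_lt.2 h), action_rhoOne hn hv hT rfl, actTau, glue_of_le h]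

lemma hasDerivAt_action (hn : 2 ≤ n) (hv : 0 < v) {β : ℝ} (hβ : 0 < β) :
    HasDerivAt (fun s : ℝ => action (potential n v) s (rhoTau n (s⁻¹ / (n * v))))
      (energy (potential n v) (rhoTau n (β⁻¹ / (n * v)))) β := by
  have hn1 := one_lt_cast hn
  have hτ : 0 < β⁻¹ / (n * v) := by positivity
  have h := (hasDerivAt_actTau hn hτ).comp β ((hasDerivAt_inv hβ.ne').div_const (n * v))
  refine (h.congr_of_eventuallyEq ?_).congr_deriv ?_
  · filter_upwards [Ioi_mem_nhds hβ] with s hs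
    have := action_rhoTau hn hv (inv_pos.2 hs)
    rw [inv_inv] at this
    exact this
  · rw [energy_rhoTau hn hv (inv_pos.2 hβ), enTau]
    field_simp

lemma hasDerivAt_energy (hn : 2 ≤ n) (hv : 0 < v) (hT : 0 < T) :
    HasDerivAt (fun T : ℝ => energy (potential n v) (rhoTau n (T / (n * v))))
      (capTau n (T / (n * v)) / n) T := by
  have hn1 := one_lt_cast hn
  have hτ : 0 < T / (n * v) := by positivity
  have h := ((hasDerivAt_enTau hn hτ).comp T ((hasDerivAt_id T).div_const (n * v))).const_mul v
  refine (h.congr_of_eventuallyEq ?_).congr_deriv ?_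
  · filter_upwards [Ioi_mem_nhds hT] with s hs using energy_rhoTau hn hv hs
  · field_simp

end SphericalMatrix
end

theorem mainTheorem4 (v : ℕ → ℝ) (hv : ∀ n, 2 ≤ n → 0 < v n) :
    -- the transition for each monomial potential `v n * x ^ (2 * n)`
    (∀ n : ℕ, 2 ≤ n → ∀ (V : ℝ → ℝ) (Tc : ℝ),
      V = SphericalMatrix.potential n (v n) → Tc = SphericalMatrix.criticalTemp n (v n) →
      0 < Tc ∧
      -- `ρ₁ T`: the single-cut solution; `ρ T`: the non-negative saddle point density
      ∃ (a₁ μ₁ : ℝ → ℝ) (ρ₁ : ℝ → ℝ → ℝ) (μ : ℝ → ℝ) (ρ : ℝ → ℝ → ℝ),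
        -- existence and uniqueness of the (possibly signed) single-cut solution
        (∀ T, 0 < T → ∀ (a m : ℝ) (r : ℝ → ℝ),
          SphericalMatrix.IsSingleCut V T a m r ↔ (a = a₁ T ∧ m = μ₁ T ∧ r = ρ₁ T)) ∧
        -- lowering the temperature, it is positive above `Tc`, vanishes exactly at the origin at `Tc`, then turns negative
        (∀ T, Tc < T → ∀ x ∈ Ioo (-a₁ T) (a₁ T), 0 < ρ₁ T x) ∧
        ρ₁ Tc 0 = 0 ∧
        (∀ x ∈ Ioo (-a₁ Tc) (a₁ Tc), x ≠ 0 → 0 < ρ₁ Tc x) ∧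
        (∀ T, 0 < T → T < Tc → ρ₁ T 0 < 0) ∧
        a₁ Tc ^ 2 = 4 / 3 * ((1 + (n : ℝ)) / n) ∧
        -- existence and uniqueness of the non-negative saddle point density
        (∀ T, 0 < T → ∀ (m : ℝ) (r : ℝ → ℝ),
          SphericalMatrix.IsSaddleDensity V T m r ↔ (m = μ T ∧ r = ρ T)) ∧
        -- it is the single-cut solution down to `Tc` and a two-cut solution below `Tc`
        (∀ T, Tc ≤ T → μ T = μ₁ T ∧ ρ T = ρ₁ T) ∧
        (∀ T, 0 < T → T < Tc → ∃ a b : ℝ, SphericalMatrix.IsTwoCut V T a b (μ T) (ρ T) ∧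
          ∀ x ∈ Ioo a b, 0 < ρ T x) ∧
        -- the energy is minus the derivative of the leading order of `(log Z) / N²` in `β`
        (∀ β, 0 < β → HasDerivAt (fun s : ℝ => SphericalMatrix.action V s (ρ s⁻¹))
          (SphericalMatrix.energy V (ρ β⁻¹)) β) ∧
        -- energy and first derivative are continuous, the second derivative jumps at `Tc`
        (∀ E : ℝ → ℝ, E = (fun T : ℝ => SphericalMatrix.energy V (ρ T)) →
          ContDiffOn ℝ 1 E (Ioi 0) ∧ ContDiffOn ℝ 2 E (Ioo 0 Tc) ∧ ContDiffOn ℝ 2 E (Ioi Tc) ∧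
          E Tc = Tc * ((1 - 4 * (n : ℝ) ^ 2) / (2 * n * (1 - (n : ℝ) ^ 2))) ∧
          deriv E Tc = (1 - 2 * (n : ℝ)) ^ 2 / (2 * n * (1 + (n : ℝ)) ^ 2) ∧
          ∃ Lp Lm : ℝ,
            Tendsto (iteratedDeriv 2 E) (𝓝[>] Tc) (𝓝 Lp) ∧
            Tendsto (iteratedDeriv 2 E) (𝓝[<] Tc) (𝓝 Lm) ∧
            Lp = 2 / Tc * (-(3 * (1 - 2 * (n : ℝ)) ^ 2) / (4 * n * (1 + (n : ℝ)) ^ 3)) ∧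
            Lm = 2 / Tc *
              (-(3 * ((n : ℝ) - 2) * (2 * (n : ℝ) - 7)) / (2 * n * (1 + (n : ℝ)) ^ 3)) ∧
            Lp ≠ Lm) ∧
        -- third-order transition in the free energy
        (∀ F : ℝ → ℝ, F = (fun s : ℝ => SphericalMatrix.action V s (ρ s⁻¹)) →
          ContDiffOn ℝ 2 F (Ioi 0) ∧
          ContDiffOn ℝ 3 F (Ioo 0 Tc⁻¹) ∧ ContDiffOn ℝ 3 F (Ioi Tc⁻¹) ∧
          ∃ Lp Lm : ℝ,
            Tendsto (iteratedDeriv 3 F) (𝓝[>] Tc⁻¹) (𝓝 Lp) ∧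
            Tendsto (iteratedDeriv 3 F) (𝓝[<] Tc⁻¹) (𝓝 Lm) ∧ Lp ≠ Lm)) ∧
    -- behaviour of the critical temperature in `n`
    StrictMonoOn (fun n : ℕ => SphericalMatrix.criticalTemp n (v n) / v n) (Ici 2) ∧
    SphericalMatrix.criticalTemp 2 (v 2) = v 2 ∧
    (fun n : ℕ => SphericalMatrix.criticalTemp n (v n)) ~[atTop]
      (fun n : ℕ => v n * Real.sqrt (n * Real.exp 1 ^ 2 / (4 * Real.pi)) * (4 / 3) ^ n) := by
  refine ⟨fun n hn V Tc hV hTc => ?_, SphericalMatrix.strictMonoOn_criticalTemp hv,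
    SphericalMatrix.criticalTemp_two _, SphericalMatrix.isEquivalent_criticalTemp hv⟩
  have hvn := hv n hn
  have hn1 := SphericalMatrix.one_lt_cast hn
  have hn0 : (0 : ℝ) < n := by linarith
  have hTc0 : 0 < Tc := hTc ▸ SphericalMatrix.criticalTemp_pos hn hvn
  have hnv : 0 < n * v n := by positivity
  have hTc' : Tc = SphericalMatrix.tauC n * (n * v n) := by
    rw [hTc, SphericalMatrix.criticalTemp_eq hn]; ring
  have hτc : Tc / (n * v n) = SphericalMatrix.tauC n := by
    rw [hTc', mul_div_cancel_right₀ _ hnv.ne']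
  have htc0 := SphericalMatrix.tauC_pos hn
  have hpos : ∀ T, 0 < T → 0 < T / (n * v n) := fun T hT => by positivity
  have hlt : ∀ T, T < Tc → T / (n * v n) < SphericalMatrix.tauC n := fun T hT => by
    rwa [div_lt_iff₀ hnv, ← hTc']
  have hgt : ∀ T, Tc < T → SphericalMatrix.tauC n < T / (n * v n) := fun T hT => by
    rwa [lt_div_iff₀ hnv, ← hTc']
  have hge : ∀ T, Tc ≤ T → SphericalMatrix.tauC n ≤ T / (n * v n) := fun T hT => by
    rwa [le_div_iff₀ hnv, ← hTc']
  subst hV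
  -- The energy is `v` times a function of `τ = T / (n v)`, so its first derivative in `T` carries
  -- `1 / n` and each further one another factor `1 / (n v)`.
  set g : ℝ → ℝ := fun T => SphericalMatrix.capTau n (T / (n * v n)) / n with hg
  set g₂ : ℝ → ℝ := fun T => SphericalMatrix.capTauDeriv n (T / (n * v n)) / (n * (n * v n)) with hg₂
  have hdiv : ∀ T : ℝ, HasDerivAt (fun T => T / (n * v n)) (1 / (n * v n)) T := fun T =>
    (hasDerivAt_id T).div_const _
  have hgc : ∀ T, 0 < T → ContinuousAt g T := fun T hT =>
    (ContinuousAt.comp (f := fun T => T / (n * v n))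
      (SphericalMatrix.continuousAt_capTau hn (hpos T hT)) (hdiv T).continuousAt).div_const _
  have hne : ∀ T, T ≠ Tc → T / (n * v n) ≠ SphericalMatrix.tauC n := fun T h h' => h (by
    rw [hTc', ← h', div_mul_cancel₀ _ hnv.ne'])
  have hgd : ∀ T, 0 < T → T ≠ Tc → HasDerivAt g (g₂ T) T := fun T hT h => by
    have := ((SphericalMatrix.hasDerivAt_capTau hn (hpos T hT) (hne T h)).comp T
      (hdiv T)).div_const (n : ℝ)
    refine this.congr_deriv ?_
    simp only [hg₂]
    field_simp
  have hg₂c : ∀ T, 0 < T → T ≠ Tc → ContinuousAt g₂ T := fun T hT h =>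
    (ContinuousAt.comp (f := fun T => T / (n * v n))
      (SphericalMatrix.continuousAt_capTauDeriv hn (hpos T hT) (hne T h))
      (hdiv T).continuousAt).div_const _
  have hlim : Tendsto (fun T => T / (n * v n)) (𝓝 Tc) (𝓝 (SphericalMatrix.tauC n)) := by
    have := (hdiv Tc).continuousAt.tendsto
    rwa [hτc] at this
  have hp := ((SphericalMatrix.tendsto_capTauDeriv_right hn).comp (tendsto_nhdsWithin_iff.2
    ⟨hlim.mono_left (nhdsWithin_le_nhds (s := Ioi Tc)),
      mem_of_superset self_mem_nhdsWithin hgt⟩)).div_const (n * (n * v n))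
  have hm := ((SphericalMatrix.tendsto_capTauDeriv_left hn).comp (tendsto_nhdsWithin_iff.2
    ⟨hlim.mono_left (nhdsWithin_le_nhds (s := Iio Tc)),
      mem_of_superset self_mem_nhdsWithin hlt⟩)).div_const (n * (n * v n))
  have eLp : -(3 * (2 * (n : ℝ) - 1) ^ 2 / (2 * (n + 1) ^ 3)) / SphericalMatrix.tauC n
      / (n * (n * v n)) = 2 / Tc * (-(3 * (1 - 2 * (n : ℝ)) ^ 2) / (4 * n * (1 + (n : ℝ)) ^ 3)) := by
    rw [hTc']
    field_simp
    ring
  have eLm : 3 * ((n : ℝ) - 2) * (7 - 2 * n) / (n + 1) ^ 3 / SphericalMatrix.tauC n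
      / (n * (n * v n)) = 2 / Tc *
        (-(3 * ((n : ℝ) - 2) * (2 * (n : ℝ) - 7)) / (2 * n * (1 + (n : ℝ)) ^ 3)) := by
    rw [hTc']
    field_simp
    ring
  rw [eLp] at hp
  rw [eLm] at hm
  -- After clearing denominators, equality of the two limits would force `2n - 3 = 0`.
  have hL : 2 / Tc * (-(3 * (1 - 2 * (n : ℝ)) ^ 2) / (4 * n * (1 + (n : ℝ)) ^ 3)) ≠
      2 / Tc * (-(3 * ((n : ℝ) - 2) * (2 * (n : ℝ) - 7)) / (2 * n * (1 + (n : ℝ)) ^ 3)) := by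
    intro h
    have h2 := mul_left_cancel₀ (by positivity) h
    have hn2 : (2 : ℝ) ≤ n := by exact_mod_cast hn
    rw [div_eq_div_iff (by positivity) (by positivity)] at h2
    have h3 : 0 < (n : ℝ) * (1 + n) ^ 3 := by positivity
    have h4 : ((n : ℝ) * (1 + n) ^ 3) * (54 * (2 * n - 3)) = 0 := by linear_combination -h2
    rcases mul_eq_zero.1 h4 with h5 | h5 <;> linarith
  have hE : ∀ T, 0 < T → HasDerivAt (fun T : ℝ => SphericalMatrix.energy
      (SphericalMatrix.potential n (v n)) (SphericalMatrix.rhoTau n (T / (n * v n)))) (g T) T :=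
    fun T hT => SphericalMatrix.hasDerivAt_energy hn hvn hT
  have hcap : SphericalMatrix.multTau n (SphericalMatrix.tauC n)
      = -(3 * n ^ 2 / (2 * (n - 1) * (n + 1))) := by
    rw [SphericalMatrix.multTau, SphericalMatrix.glue_of_le le_rfl, SphericalMatrix.ySol_tauC hn,
      SphericalMatrix.muOne_yC hn]
  have en1 : (n : ℝ) - 1 ≠ 0 := by linarith
  have en2 : 1 - (n : ℝ) ^ 2 ≠ 0 := by nlinarith
  refine ⟨hTc0, fun T => √(SphericalMatrix.ySol n (T / (n * v n))),
    fun T => SphericalMatrix.muOne n (SphericalMatrix.ySol n (T / (n * v n))),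
    fun T => SphericalMatrix.rhoOne n (T / (n * v n)),
    fun T => SphericalMatrix.multTau n (T / (n * v n)),
    fun T => SphericalMatrix.rhoTau n (T / (n * v n)),
    fun T hT a m r => SphericalMatrix.isSingleCut_iff_sol hn hvn hT rfl,
    fun T hT x hx => SphericalMatrix.rhoOne_pos hn (hpos T (hTc0.trans hT)) (hgt T hT).le hx
      (Or.inl (hgt T hT)), ?_, fun x hx hx0 => ?_, fun T hT hT' =>
    SphericalMatrix.rhoOne_zero_neg hn (hpos T hT) (hlt T hT'), ?_,
    fun T hT m r => SphericalMatrix.isSaddleDensity_iff hn hvn hT rfl, fun T hT => ?_,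
    fun T hT hT' => ?_, fun β hβ => SphericalMatrix.hasDerivAt_action hn hvn hβ, ?_, ?_⟩
  · simp only [hτc, SphericalMatrix.rhoOne_tauC_zero hn]
  · simp only [hτc] at hx ⊢
    exact SphericalMatrix.rhoOne_pos hn htc0 le_rfl hx (Or.inr hx0)
  · have hy := SphericalMatrix.yC_mem hn
    simp only [hτc, SphericalMatrix.ySol_tauC hn]
    rw [Real.sq_sqrt hy.1.le, SphericalMatrix.yC]
    field_simp
    ring
  · simp only [SphericalMatrix.multTau, SphericalMatrix.glue_of_le (hge T hT),
      SphericalMatrix.rhoTau, if_neg (not_lt.2 (hge T hT)), and_self]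
  · obtain ⟨a, b, h1, h2, -⟩ := SphericalMatrix.isTwoCut_rhoTwo hn hvn hT rfl (hlt T hT')
    simp only [SphericalMatrix.multTau, SphericalMatrix.glue_of_lt (hlt T hT'),
      SphericalMatrix.rhoTau, if_pos (hlt T hT')]
    exact ⟨a, b, h1, h2⟩
  · rintro E rfl
    obtain ⟨r1, r2, r3, r4, r5⟩ := SphericalMatrix.jump_second_deriv hTc0 hE hgc hgd hg₂c hp hm
    refine ⟨by exact_mod_cast r1, by exact_mod_cast r2, by exact_mod_cast r3, ?_, ?_, _, _, r4, r5,
      rfl, rfl, hL⟩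
    · simp only
      rw [SphericalMatrix.energy_rhoTau hn hvn hTc0, hτc, SphericalMatrix.enTau, hcap, hTc']
      field_simp
      ring
    · rw [(hE Tc hTc0).deriv]
      simp only [hg]
      rw [hτc, SphericalMatrix.capTau, SphericalMatrix.glue_of_le le_rfl,
        SphericalMatrix.ySol_tauC hn, SphericalMatrix.capOne, SphericalMatrix.yC]
      field_simp
      ring
  · rintro F rfl
    have h := SphericalMatrix.jump_third_deriv hTc0
      (fun β hβ => SphericalMatrix.hasDerivAt_action hn hvn hβ) hE hgc hgd hg₂c hp hm hL
    exact_mod_cast h
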